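/- **Conventions.** The many-body system $S$ lives on a circle with $N$ sites, site $k\in\mathbb Z/N$ at angle $2\pi k/N$; angle $0$ is north and $\pi/2$ is east. $S_W,S_E,S_N,S_S$ consist of the sites with angle in $[-\pi,0)$, $[0,\pi)$, $[-\pi/2,\pi/2)$, $[\pi/2,3\pi/2)$. A unitary $U$ *spreads by at most $s$* if for every operator $A$ at a site $\phi$ the operator $UAU^\dagger$ is supported in $(\phi-s,\phi+s)$. **The code.** Take the central heptagon of the $\{7,3\}$ tiling of the Poincaré disk, centred at $0$, with $R\ge 1$ further layers of heptagons around it. Put on each heptagon the encoding tensor of the seven-qubit Steane code in cyclic form, its seven physical legs on the seven sides in cyclic order and its logical leg as a bulk qubit; contract the legs on each shared side. The outer sides carry the physical (boundary) qubits. Let $V$ be the normalized encoding map from bulk to boundary qubits. The code can be rotated by an angle $\theta$ and moved by the hyperbolic translation $z\mapsto (z+w)/(1+\bar w z)$, $|w|<1$; each boundary qubit then sits at the lattice site given by the argument of the midpoint of its (moved) side. In addition every site carries ancilla qubits in state $|0\rangle$. The translation unitary between two positions of a code swaps each boundary qubit with an ancilla at the site to which it has to move. **Statement.** There are a number of layers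 $R\ge1$, a lattice size $N$, an orientation $\theta$, a translation parameter $0<a<1$ and constants $c_1,c_2>0$ such that $V$ is an isometry and the following holds for all $n\ge 0$ and all $I,J\subseteq\{1,\dots,n\}$ (the input and output qubits of Alice; the others belong to Bob). Stack $n$ copies of the code, those in $I$ translated left (west) by $a$, the others right (east) by $a$. Let $V_0$ be the resulting encoding map into $S$, $V_0|0\rangle$ (all bulk qubits in $|0\rangle$) the resource state, and $V_\tau$ the encoding map when instead the copies in $J$ are translated up (north) and the others down (south) by $a$. 1. The translation unitaries from the left/right positions to the centre, and from the centre to the up/down positions, each spread by at most $2\pi/16$. 2. For $V_0$, the central bulk qubits of the copies in $I$ are recoverable on $S_W$ and those of the other copies on $S_E$; for $V_\tau$, those of the copies in $J$ are recoverable on $S_N$ and those of the other copies on $S_S$. 3. The entanglement entropy $E$ of the resource state between $S_W$ and $S_E$ is linear in $n$: $c_1 n\le E\le c_2 n$. 4. There are encoding channels $\mathcal N_{AS_W\to S_W}$, $\mathcal N_{BS_E\to S_E}$ and decoding channels $\mathcal D_{S_N\to\tilde A}$, $\mathcal D_{S_S\to\tilde B}$ such that for every $n$-qubit Clifford unitary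 $G$: - (transversal gates) there are Clifford unitaries $u_\ell$, one for each boundary leg $\ell$ and acting on the $n$ copies of that leg, and Clifford unitaries $g_t$, one for each tile $t$ and acting on the $n$ copies of its bulk qubit, with $g_t=G$ for the central tile, such that $\big(\bigotimes_\ell u_\ell\big)V^{\otimes n}=V^{\otimes n}\big(\bigotimes_t g_t\big)$; - the dynamics $U$ = (translate all copies to the centre, apply $\bigotimes_\ell u_\ell$, translate the copies in $J$ up and the others down) is a unitary that spreads by at most $2\pi/8$, with $UV_0=V_\tau\bigotimes_t g_t$; - the pseudo-bulk dynamics are exactly $G$: for every operator $\rho$ on the input qubits, $(\mathcal D_{S_N\to\tilde A}\otimes\mathcal D_{S_S\to\tilde B})\big[U\,(\mathcal N_{AS_W\to S_W}\otimes\mathcal N_{BS_E\to S_E})(\rho\otimes V_0|0\rangle\langle0|V_0^\dagger)\,U^\dagger\big]=G\rho G^\dagger$; - with an identical auxiliary system $S'$ there are unitaries $U_W,U_E,U_N,U_S$ on the regions $S_WS'_W$, $S_ES'_E$, $S_NS'_N$, $S_SS'_S$ and a unitary $U'$ on $S'$ with $U_NU_SU_WU_E=U_S\otimes U'_{S'}$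 (where $U_S$ on the right is $U$ acting on $S$), and the many-body non-local protocol implements $G$ exactly with the resource state $V_0|0\rangle$, Alice holding $S_W$ and Bob $S_E$: each party encodes its input, adds its part of $S'$ in state $|0\rangle$ and applies $U_W$ (resp. $U_E$); in one simultaneous exchange they pass to Alice holding $S_NS'_N$ and Bob $S_SS'_S$; they apply $U_N$ (resp. $U_S$), discard $S'$, and decode. -/

import Mathlib

noncomputable section

/-! ### Qubit registers, Clifford unitaries, channels -/

/-- Computational basis labels of a register of qubits indexed by `ι`; the Hilbert space of the
register is `Reg ι → ℂ`, its operators are `Matrix (Reg ι) (Reg ι) ℂ`. -/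
abbrev Reg (ι : Type) : Type := ι → ZMod 2

/-- The Pauli operator `X^p Z^q`. -/
def pauli {ι : Type} [Fintype ι] (p q : Reg ι) : Matrix (Reg ι) (Reg ι) ℂ :=
  fun x y => if x = y + p then (-1 : ℂ) ^ (∑ i, q i * y i).val else 0

/-- A unitary that conjugates every Pauli operator to a Pauli operator up to a phase
(the scalar `c` has modulus one automatically, by unitarity). -/
def IsClifford {ι : Type} [Fintype ι] [DecidableEq ι] (U : Matrix (Reg ι) (Reg ι) ℂ) : Prop :=
  U ∈ Matrix.unitaryGroup (Reg ι) ℂ ∧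
    ∀ p q : Reg ι, ∃ (p' q' : Reg ι) (c : ℂ), U * pauli p q * U.conjTranspose = c • pauli p' q'

/-- `A` acts as the identity on all qubits outside `P`, that is, `A = A_P ⊗ 1`. -/
def SupportedOn {ι : Type} (A : Matrix (Reg ι) (Reg ι) ℂ) (P : ι → Prop) : Prop :=
  (∀ x y : Reg ι, (∃ i, ¬ P i ∧ x i ≠ y i) → A x y = 0) ∧
    ∀ x y x' y' : Reg ι, (∀ i, P i → x i = x' i ∧ y i = y' i) →
      (∀ i, ¬ P i → x i = y i ∧ x' i = y' i) → A x y = A x' y'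

/-- Maps from operators with basis labels `X` to operators with basis labels `Y`. -/
abbrev Super (X Y : Type) : Type := Matrix X X ℂ → Matrix Y Y ℂ

/-- Completely positive and trace preserving, in Kraus form. -/
def IsChannel {X Y : Type} [Fintype X] [DecidableEq X] [Fintype Y] (Φ : Super X Y) : Prop :=
  ∃ (r : ℕ) (K : Fin r → Matrix Y X ℂ), ∑ i, (K i).conjTranspose * K i = 1 ∧
    ∀ ρ, Φ ρ = ∑ i, K i * ρ * (K i).conjTranspose

/-- The map `ρ ↦ M ρ M†`. -/
def conjBy {X Y : Type} [Fintype X] (M : Matrix Y X ℂ) : Super X Y :=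
  fun ρ => M * ρ * M.conjTranspose

/-- The tensor product of two linear maps on operators, through matrix units. -/
def tensorMap {X X' Y Y' : Type} [Fintype X] [DecidableEq X] [Fintype X'] [DecidableEq X']
    (Φ : Super X Y) (Ψ : Super X' Y') : Super (X × X') (Y × Y') :=
  fun ρ => ∑ x : X × X', ∑ z : X × X', ρ x z •
    Matrix.kroneckerMap (fun s t => s * t)
      (Φ (Matrix.single x.1 z.1 1)) (Ψ (Matrix.single x.2 z.2 1))

/-! ### Non-local quantum computation -/

/-- `ρ_{AB} ⊗ |φ⟩⟨φ|_{R_A R_B}`, with Alice's and Bob's systems grouped together. -/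
def withResource {A B RA RB : Type} (φ : RA × RB → ℂ) (ρ : Matrix (A × B) (A × B) ℂ) :
    Matrix ((A × RA) × (B × RB)) ((A × RA) × (B × RB)) ℂ :=
  fun x y => ρ (x.1.1, x.2.1) (y.1.1, y.2.1) *
    (φ (x.1.2, x.2.2) * star (φ (y.1.2, y.2.2)))

/-- The exchange of the two messages. -/
def exchange {KA MA KB MB : Type} (σ : Matrix ((KA × MA) × (KB × MB)) ((KA × MA) × (KB × MB)) ℂ) :
    Matrix ((KA × MB) × (KB × MA)) ((KA × MB) × (KB × MA)) ℂ :=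
  fun x y => σ ((x.1.1, x.2.2), (x.2.1, x.1.2)) ((y.1.1, y.2.2), (y.2.1, y.1.2))

/-- The four given maps form a non-local quantum computation protocol (local channels, one
simultaneous exchange of messages, local channels) that, with resource state `φ`, implements `V`
exactly. Equality on all operators on `AB` includes inputs entangled with a reference system. -/
def NLQCImplements {A B RA RB KA MA KB MB A' B' : Type}
    [Fintype A] [DecidableEq A] [Fintype B] [DecidableEq B]
    [Fintype RA] [DecidableEq RA] [Fintype RB] [DecidableEq RB]
    [Fintype KA] [DecidableEq KA] [Fintype MA] [DecidableEq MA]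
    [Fintype KB] [DecidableEq KB] [Fintype MB] [DecidableEq MB]
    [Fintype A'] [Fintype B']
    (φ : RA × RB → ℂ)
    (alice₁ : Super (A × RA) (KA × MA)) (bob₁ : Super (B × RB) (KB × MB))
    (alice₂ : Super (KA × MB) A') (bob₂ : Super (KB × MA) B')
    (V : Matrix (A' × B') (A × B) ℂ) : Prop :=
  IsChannel alice₁ ∧ IsChannel bob₁ ∧ IsChannel alice₂ ∧ IsChannel bob₂ ∧
    ∑ x, ‖φ x‖ ^ 2 = 1 ∧
    ∀ ρ, tensorMap alice₂ bob₂ (exchange (tensorMap alice₁ bob₁ (withResource φ ρ))) = conjBy V ρ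

/-- The von Neumann entropy (in nats) of the reduced state on `RA` of the pure state `φ`. -/
def entanglementEntropy {RA RB : Type} [Fintype RA] [DecidableEq RA] [Fintype RB]
    (φ : RA × RB → ℂ) : ℝ :=
  ∑ i, Real.negMulLog
    ((Matrix.isHermitian_mul_conjTranspose_self
      (Matrix.of fun a b => φ (a, b) : Matrix RA RB ℂ)).eigenvalues i)

/-! ### Many-body systems on a circle

The sites are `ZMod N`, site `k` having the angular coordinate `2πk/N`; the angle `0` is north and
`π/2` is east. Every site carries one qubit for each element of `F`. -/

section ManyBody

variable {N : ℕ} {F : Type}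

/-- Angles in `[-π, 0)`. -/
def west (k : ZMod N) : Prop := N ≤ 2 * k.val
/-- Angles in `[0, π)`. -/
def east (k : ZMod N) : Prop := 2 * k.val < N
/-- Angles in `[-π/2, π/2)`. -/
def north (k : ZMod N) : Prop := 4 * k.val < N ∨ 3 * N ≤ 4 * k.val
/-- Angles in `[π/2, 3π/2)`. -/
def south (k : ZMod N) : Prop := N ≤ 4 * k.val ∧ 4 * k.val < 3 * N

instance : DecidablePred (west (N := N)) := fun _ => inferInstanceAs (Decidable (_ ≤ _))
instance : DecidablePred (east (N := N)) := fun _ => inferInstanceAs (Decidable (_ < _))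
instance : DecidablePred (north (N := N)) := fun _ => inferInstanceAs (Decidable (_ ∨ _))
instance : DecidablePred (south (N := N)) := fun _ => inferInstanceAs (Decidable (_ ∧ _))

/-- The angular distance between two sites. -/
def angDist (j k : ZMod N) : ℝ := 2 * Real.pi / N * |((j - k).valMinAbs : ℝ)|

/-- The spread of `U` is at most `s`: for an operator `A` at site `k`, the operator `U A U†` is
supported in the open interval of radius `s` around site `k`. -/
def HasSpread [NeZero N] [Fintype F] [DecidableEq F]
    (U : Matrix (Reg (ZMod N × F)) (Reg (ZMod N × F)) ℂ) (s : ℝ) : Prop :=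
  ∀ (k : ZMod N) (A : Matrix (Reg (ZMod N × F)) (Reg (ZMod N × F)) ℂ),
    SupportedOn A (fun q => q.1 = k) →
      SupportedOn (U * A * U.conjTranspose) (fun q => angDist q.1 k < s)

/-- The register made of the qubits at the sites in `P`. -/
abbrev RegionReg (P : ZMod N → Prop) (F : Type) : Type := Reg ({k : ZMod N // P k} × F)

/-- Restriction of a basis label to the sites in `P`. -/
def restr (P : ZMod N → Prop) (x : Reg (ZMod N × F)) : RegionReg P F := fun q => x (q.1.1, q.2)

/-- Identification of the full register with the product of the registers of two complementary
regions. -/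
def split [Fintype F] [DecidableEq F] [NeZero N] (P P' : ZMod N → Prop)
    [DecidablePred P] [DecidablePred P'] :
    Matrix (RegionReg P F × RegionReg P' F) (Reg (ZMod N × F)) ℂ :=
  fun a x => if a = (restr P x, restr P' x) then 1 else 0

/-- The operator `M ⊗ 1`, with `M` acting on the region `P`. -/
def regionOp [Fintype F] [DecidableEq F] [NeZero N] (P : ZMod N → Prop) [DecidablePred P]
    (M : Matrix (RegionReg P F) (RegionReg P F) ℂ) : Matrix (Reg (ZMod N × F)) (Reg (ZMod N × F)) ℂ :=
  fun x y => if ∀ q, ¬ P q.1 → x q = y q then M (restr P x) (restr P y) else 0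

/-- The pseudo-bulk dynamics of the data `(U, ψ)`, encoding maps `encA, encB` and decoding maps
`decA, decB`. -/
def pseudoBulk [NeZero N] [Fintype F] [DecidableEq F] {A B A' B' : Type}
    [Fintype A] [DecidableEq A] [Fintype B] [DecidableEq B]
    (U : Matrix (Reg (ZMod N × F)) (Reg (ZMod N × F)) ℂ) (ψ : Reg (ZMod N × F) → ℂ)
    (encA : Super (A × RegionReg (west (N := N)) F) (RegionReg (west (N := N)) F))
    (encB : Super (B × RegionReg (east (N := N)) F) (RegionReg (east (N := N)) F))
    (decA : Super (RegionReg (north (N := N)) F) A') (decB : Super (RegionReg (south (N := N)) F) B') :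
    Super (A × B) (A' × B') :=
  fun ρ => tensorMap decA decB <| conjBy (split north south) <| conjBy U <|
    conjBy (split west east).conjTranspose <|
      tensorMap encA encB (withResource ((split west east).mulVec ψ) ρ)

/-- The system `S` together with an identical auxiliary system `S'` is the many-body system with
local qubits `F × Bool` (`false` for `S`, `true` for `S'`). This is the isometry that adds, on the
region `P`, the auxiliary qubits in the basis state `z`. -/
def ancilla [Fintype F] [DecidableEq F] [NeZero N] (P : ZMod N → Prop) [DecidablePred P]
    (z : RegionReg P F) : Matrix (RegionReg P (F × Bool)) (RegionReg P F) ℂ :=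
  fun x y => if x = fun q => if q.2.2 then z (q.1, q.2.1) else y (q.1, q.2.1) then 1 else 0

/-- Discarding the auxiliary qubits on the region `P`. -/
def dropAncilla [Fintype F] [DecidableEq F] [NeZero N] (P : ZMod N → Prop) [DecidablePred P] :
    Super (RegionReg P (F × Bool)) (RegionReg P F) :=
  fun ρ => ∑ z : RegionReg P F, conjBy (ancilla P z).conjTranspose ρ

/-- `U ⊗ U'` on `S S'`. -/
def onBoth (U U' : Matrix (Reg (ZMod N × F)) (Reg (ZMod N × F)) ℂ) :
    Matrix (Reg (ZMod N × (F × Bool))) (Reg (ZMod N × (F × Bool))) ℂ :=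
  fun x y => U (fun q => x (q.1, (q.2, false))) (fun q => y (q.1, (q.2, false))) *
    U' (fun q => x (q.1, (q.2, true))) (fun q => y (q.1, (q.2, true)))

/-- Identification of the register of the region `P` with the product of the registers of its parts
inside `K` and inside `M`. -/
def cut [Fintype F] [DecidableEq F] [NeZero N] (P K M : ZMod N → Prop)
    [DecidablePred P] [DecidablePred K] [DecidablePred M] :
    Matrix (RegionReg (fun k => P k ∧ K k) F × RegionReg (fun k => P k ∧ M k) F) (RegionReg P F) ℂ :=
  fun a x => if a = (fun q => x (⟨q.1.1, q.1.2.1⟩, q.2), fun q => x (⟨q.1.1, q.1.2.1⟩, q.2))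
    then 1 else 0

/-- First local operation of the many-body protocol, for the party that holds the region `P`:
encode the input, add the auxiliary system in the state `|0⟩`, apply `UP`, and separate the sites in
`K` (kept) from those in `M` (sent). -/
def firstRound [Fintype F] [DecidableEq F] [NeZero N] (P K M : ZMod N → Prop)
    [DecidablePred P] [DecidablePred K] [DecidablePred M] {A : Type}
    (enc : Super (A × RegionReg P F) (RegionReg P F))
    (UP : Matrix (RegionReg P (F × Bool)) (RegionReg P (F × Bool)) ℂ) :
    Super (A × RegionReg P F)
      (RegionReg (fun k => P k ∧ K k) (F × Bool) × RegionReg (fun k => P k ∧ M k) (F × Bool)) :=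
  fun ρ => conjBy (cut P K M) <| conjBy UP <| conjBy (ancilla P 0) <| enc ρ

/-- Second local operation of the many-body protocol, for the party that holds the region `K` after
the exchange, its part in `P` having been kept and its part in `P'` received: assemble the region,
apply `UK`, discard the auxiliary system, and decode. -/
def secondRound [Fintype F] [DecidableEq F] [NeZero N] (K P P' : ZMod N → Prop)
    [DecidablePred K] [DecidablePred P] [DecidablePred P'] {A' : Type}
    (UK : Matrix (RegionReg K (F × Bool)) (RegionReg K (F × Bool)) ℂ) (dec : Super (RegionReg K F) A') :
    Super (RegionReg (fun k => P k ∧ K k) (F × Bool) × RegionReg (fun k => P' k ∧ K k) (F × Bool)) A' :=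
  fun ρ => dec <| dropAncilla K <| conjBy UK <|
    conjBy (fun (x : RegionReg K (F × Bool))
      (a : RegionReg (fun k => P k ∧ K k) (F × Bool) × RegionReg (fun k => P' k ∧ K k) (F × Bool)) =>
        if a = (fun q => x (⟨q.1.1, q.1.2.2⟩, q.2), fun q => x (⟨q.1.1, q.1.2.2⟩, q.2))
          then (1 : ℂ) else 0) ρ

end ManyBody

/-! ### The order-3 heptagonal tiling of the Poincaré disk -/

/-- The hyperbolic translation of the unit disk that takes `0` to `a`. -/
def discTranslate (a z : ℂ) : ℂ := (z + a) / (1 + star a * z)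

/-- The half-turn of the unit disk about the point `e`. -/
def halfTurn (e z : ℂ) : ℂ := discTranslate e (-discTranslate (-e) z)

/-- Distance from `0` to the midpoints of the sides of the central tile, the regular heptagon with
interior angles `2π/3`: its hyperbolic inradius `r` satisfies `cosh r = cos (π/3) / sin (π/7)`, and
this is `tanh (r/2)`. -/
def sideRadius : ℝ :=
  Real.sqrt ((1 - 2 * Real.sin (Real.pi / 7)) / (1 + 2 * Real.sin (Real.pi / 7)))

/-- A tile is recorded through the midpoints of its seven sides in counterclockwise order; this is
the central tile. -/
def centralFrame : ZMod 7 → ℂ :=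
  fun k => sideRadius * Complex.exp (2 * Real.pi * Complex.I * (k.val : ℂ) / 7)

/-- The tiles within `R` layers around the central tile. The tile on the other side of the side
with midpoint `e` is obtained by the half-turn about `e`. (The same tile may occur with several
starting points of the counterclockwise order.) -/
def frames : ℕ → Finset (ZMod 7 → ℂ)
  | 0 => {centralFrame}
  | R + 1 => frames R ∪ (frames R).biUnion fun f =>
      Finset.univ.image fun k : ZMod 7 => fun j => halfTurn (f k) (f j)

/-- A tile as the set of the midpoints of its sides. -/
def tileOf (f : ZMod 7 → ℂ) : Finset ℂ := Finset.univ.image f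

def tiles (R : ℕ) : Finset (Finset ℂ) := (frames R).image tileOf

def sides (R : ℕ) : Finset ℂ := (tiles R).biUnion id

/-- Sides that belong to exactly one of the tiles. -/
def outerSides (R : ℕ) : Finset ℂ :=
  (sides R).filter fun e => ((tiles R).filter fun t => e ∈ t).card = 1

/-- Tiles; each carries one bulk (logical) qubit. -/
abbrev Tile (R : ℕ) : Type := {t : Finset ℂ // t ∈ tiles R}
abbrev Side (R : ℕ) : Type := {e : ℂ // e ∈ sides R}
/-- Boundary legs; each carries one boundary (physical) qubit. -/
abbrev Leg (R : ℕ) : Type := {e : ℂ // e ∈ outerSides R}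

/-! ### The holographic code built from the Steane code -/

/-- Up to normalization, the tensor of the encoding isometry of the seven-qubit Steane code, in
cyclic form: the logical basis state `b` is the uniform superposition of the words `x` of parity `b`
in the cyclic `[7,4]` Hamming code. -/
def steane (b : ZMod 2) (x : ZMod 7 → ZMod 2) : ℂ :=
  if (∀ j, x j + x (j + 1) + x (j + 2) + x (j + 4) = 0) ∧ ∑ j, x j = b then 1 else 0

/-- The contraction of one Steane tensor per tile along the sides shared by two tiles, for the
values `x` of the boundary legs and `b` of the bulk legs. A frame that repeats a tile repeats a
factor that is `0` or `1`. -/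
def network (R : ℕ) (x : Reg (Leg R)) (b : Reg (Tile R)) : ℂ :=
  ∑ y : Reg (Side R), if ∀ (e : Leg R) (s : Side R), s.1 = e.1 → y s = x e then
    ∏ f : {f : ZMod 7 → ℂ // f ∈ frames R},
      steane (b ⟨tileOf f.1, Finset.mem_image_of_mem _ f.2⟩)
        (fun j => y ⟨f.1 j, Finset.mem_biUnion.2 ⟨tileOf f.1, Finset.mem_image_of_mem _ f.2,
          Finset.mem_image_of_mem _ (Finset.mem_univ j)⟩⟩)
    else 0

/-- The normalized encoding map of the code, from bulk qubits to boundary qubits. -/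
def codeMap (R : ℕ) : Matrix (Reg (Leg R)) (Reg (Tile R)) ℂ :=
  fun x b => network R x b / (Real.sqrt (∑ x', ‖network R x' 0‖ ^ 2) : ℂ)

def IsCentral {R : ℕ} (t : Tile R) : Prop := t.1 = tileOf centralFrame

/-- `n` copies of an encoding map. -/
def stack {L T : Type} (n : ℕ) (V : Matrix (Reg L) (Reg T) ℂ) :
    Matrix (Reg (Fin n × L)) (Reg (Fin n × T)) ℂ :=
  fun x b => ∏ i, V (fun e => x (i, e)) (fun t => b (i, t))

/-- The tensor product over `ℓ : L` of operators `u ℓ` acting jointly on the `n` qubits at position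
`ℓ` of the `n` copies. -/
def transversal {L : Type} [Fintype L] {n : ℕ} (u : L → Matrix (Reg (Fin n)) (Reg (Fin n)) ℂ) :
    Matrix (Reg (Fin n × L)) (Reg (Fin n × L)) ℂ :=
  fun x y => ∏ e, u e (fun i => x (i, e)) (fun i => y (i, e))

/-- Every operator on the bulk qubits in `P` can be implemented, under the encoding `W`, by an
operator on the physical qubits in `Q` that preserves the code space. -/
def Recoverable {S T : Type} [Fintype S] [Fintype T] [DecidableEq S] [DecidableEq T]
    (W : Matrix (Reg S) (Reg T) ℂ) (P : T → Prop) (Q : S → Prop) : Prop :=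
  ∀ O : Matrix (Reg T) (Reg T) ℂ, SupportedOn O P →
    ∃ O' : Matrix (Reg S) (Reg S) ℂ, SupportedOn O' Q ∧
      O' * W = W * O ∧ O'.conjTranspose * W = W * O.conjTranspose

/-! ### Codes placed on the circle, and their translations -/

section Placement

variable {N n R : ℕ} [NeZero N]

/-- The site of the lattice in which the direction of `z`, as an angular coordinate, lies. -/
def siteOf (N : ℕ) (z : ℂ) : ZMod N := (⌊N * (Complex.arg z / (2 * Real.pi))⌋ : ℤ)

/-- The site of the leg `e` of the code with orientation `θ`, translated by `a`. -/
def legSite (N : ℕ) (θ : ℝ) (a : ℂ) (e : Leg R) : ZMod N :=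
  siteOf N (discTranslate a (Complex.exp (θ * Complex.I) * e.1))

/-- The local qubits of a site: for every copy and every leg there is a qubit, which either holds
that leg of that copy or is an ancilla in the state `|0⟩`. -/
abbrev Slot (n R : ℕ) : Type := Fin n × Leg R

/-- All copies in the centre. -/
def centred (N n R : ℕ) (θ : ℝ) : Slot n R → ZMod N := fun s => legSite N θ 0 s.2

/-- Copies in `A` translated to the left (west), the others to the right (east). -/
def leftRight (N R : ℕ) (θ a : ℝ) {n : ℕ} (A : Finset (Fin n)) : Slot n R → ZMod N :=
  fun s => if s.1 ∈ A then legSite N θ (-(a * Complex.I)) s.2 else legSite N θ (a * Complex.I) s.2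

/-- Copies in `A` translated up (north), the others down (south). -/
def upDown (N R : ℕ) (θ a : ℝ) {n : ℕ} (A : Finset (Fin n)) : Slot n R → ZMod N :=
  fun s => if s.1 ∈ A then legSite N θ a s.2 else legSite N θ (-a) s.2

/-- The isometry that puts the legs at the sites given by `p` and all ancillas in the state `|0⟩`. -/
def place (p : Slot n R → ZMod N) : Matrix (Reg (ZMod N × Slot n R)) (Reg (Slot n R)) ℂ :=
  fun x y => if x = fun q => if q.1 = p q.2 then y q.2 else 0 then 1 else 0

/-- The translation unitary between the positions `p` and `p'`: every leg is swapped with the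
ancilla at the site to which the leg has to move. -/
def swapLegs (p p' : Slot n R → ZMod N) :
    Matrix (Reg (ZMod N × Slot n R)) (Reg (ZMod N × Slot n R)) ℂ :=
  fun x y => if x = fun q => y (Equiv.swap (p q.2) (p' q.2) q.1, q.2) then 1 else 0

/-- The transversal operator on the legs of the centred codes. -/
def centredGate (N : ℕ) [NeZero N] (θ : ℝ) (u : Leg R → Matrix (Reg (Fin n)) (Reg (Fin n)) ℂ) :
    Matrix (Reg (ZMod N × Slot n R)) (Reg (ZMod N × Slot n R)) ℂ :=
  fun x y => if ∀ q, q.1 ≠ centred N n R θ q.2 → x q = y q then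
    transversal u (fun s => x (centred N n R θ s, s)) (fun s => y (centred N n R θ s, s)) else 0

/-- The dynamics: translate all copies to the centre, apply the transversal gate, and translate the
copies in `J` up and the others down. -/
def dynamics (N : ℕ) [NeZero N] (θ a : ℝ) (I J : Finset (Fin n))
    (u : Leg R → Matrix (Reg (Fin n)) (Reg (Fin n)) ℂ) :
    Matrix (Reg (ZMod N × Slot n R)) (Reg (ZMod N × Slot n R)) ℂ :=
  swapLegs (centred N n R θ) (upDown N R θ a J) * centredGate N θ u *
    swapLegs (leftRight N R θ a I) (centred N n R θ)

/-- The encoding map of the stack before the dynamics. -/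
def initialCode (N R : ℕ) [NeZero N] (θ a : ℝ) (I : Finset (Fin n)) :
    Matrix (Reg (ZMod N × Slot n R)) (Reg (Fin n × Tile R)) ℂ :=
  place (leftRight N R θ a I) * stack n (codeMap R)

/-- The encoding map of the stack after the dynamics. -/
def finalCode (N R : ℕ) [NeZero N] (θ a : ℝ) (J : Finset (Fin n)) :
    Matrix (Reg (ZMod N × Slot n R)) (Reg (Fin n × Tile R)) ℂ :=
  place (upDown N R θ a J) * stack n (codeMap R)

/-- The holographic resource state: the stack with all bulk qubits in the state `|0⟩`. -/
def resource (N R : ℕ) [NeZero N] (θ a : ℝ) (I : Finset (Fin n)) : Reg (ZMod N × Slot n R) → ℂ :=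
  fun x => initialCode N R θ a I x 0

end Placement

/-- `G` as an operator from (Alice's inputs, Bob's inputs) to (Alice's outputs, Bob's outputs), when
Alice's input qubits are those in `I` and her output qubits those in `J`. -/
def bipartite {n : ℕ} (I J : Finset (Fin n)) (G : Matrix (Reg (Fin n)) (Reg (Fin n)) ℂ) :
    Matrix (Reg {i // i ∈ J} × Reg {i // i ∉ J}) (Reg {i // i ∈ I} × Reg {i // i ∉ I}) ℂ :=
  G.submatrix (Equiv.piEquivPiSubtypeProd (fun i => i ∈ J) fun _ => ZMod 2).symm
    (Equiv.piEquivPiSubtypeProd (fun i => i ∈ I) fun _ => ZMod 2).symm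

end

open Matrix

set_option linter.unusedSectionVars false
set_option linter.unusedDecidableInType false
set_option linter.unusedFintypeInType false

/-! ### Operators acting on part of a register -/

section Emb

variable {σ ι : Type}

open Classical in
/-- The operator `M` acting on the qubits `j s`, tensored with the identity elsewhere. -/
noncomputable def emb (j : σ → ι) (M : Matrix (Reg σ) (Reg σ) ℂ) : Matrix (Reg ι) (Reg ι) ℂ :=
  fun x y => if ∀ q, q ∉ Set.range j → x q = y q then M (x ∘ j) (y ∘ j) else 0

open Classical in
/-- Splitting a register into the qubits `j s` and the others. -/
noncomputable def regSplit {j : σ → ι} (hj : Function.Injective j) :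
    Reg ι ≃ Reg σ × Reg {q // q ∉ Set.range j} where
  toFun x := (x ∘ j, fun q => x q.1)
  invFun a q := if h : q ∈ Set.range j then a.1 h.choose else a.2 ⟨q, h⟩
  left_inv x := by
    funext q
    by_cases h : q ∈ Set.range j
    · simp only [h, dif_pos, Function.comp]
      rw [h.choose_spec]
    · simp only [h, dif_neg, not_false_eq_true]
  right_inv a := by
    refine Prod.ext (funext fun s => ?_) (funext fun q => ?_)
    · have h : j s ∈ Set.range j := ⟨s, rfl⟩
      simp only [Function.comp, h, dif_pos]
      rw [hj h.choose_spec]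
    · simp only [q.2, dif_neg, not_false_eq_true]

open Classical in
theorem emb_apply {j : σ → ι} (hj : Function.Injective j) (M : Matrix (Reg σ) (Reg σ) ℂ)
    (x y : Reg ι) : emb j M x y = if (regSplit hj x).2 = (regSplit hj y).2 then
      M (regSplit hj x).1 (regSplit hj y).1 else 0 := by
  unfold emb
  refine if_congr ?_ rfl rfl
  simp only [regSplit, Equiv.coe_fn_mk, funext_iff, Subtype.forall]

variable [Fintype σ] [Fintype ι] [DecidableEq σ] [DecidableEq ι]

theorem emb_mul {j : σ → ι} (hj : Function.Injective j) (M M' : Matrix (Reg σ) (Reg σ) ℂ) :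
    emb j (M * M') = emb j M * emb j M' := by
  classical
  ext x y
  rw [mul_apply, ← (regSplit hj).symm.sum_comp, Fintype.sum_prod_type]
  simp only [emb_apply hj, Equiv.apply_symm_apply, mul_apply]
  split_ifs with h
  · refine Finset.sum_congr rfl fun a _ => ?_
    rw [Finset.sum_eq_single (regSplit hj x).2]
    · simp [h]
    · intro r _ hr
      rw [if_neg hr.symm, zero_mul]
    · simp
  · refine (Finset.sum_eq_zero fun a _ => Finset.sum_eq_zero fun r _ => ?_).symm
    by_cases hr : (regSplit hj x).2 = r
    · rw [if_neg fun h' => h (hr.trans h'), mul_zero]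
    · rw [if_neg hr, zero_mul]

theorem emb_one {j : σ → ι} (hj : Function.Injective j) :
    emb j (1 : Matrix (Reg σ) (Reg σ) ℂ) = 1 := by
  ext x y
  rw [emb_apply hj]
  by_cases hxy : x = y
  · subst hxy
    simp
  · rw [one_apply_ne hxy]
    split_ifs with h
    · exact one_apply_ne fun h' => hxy ((regSplit hj).injective (Prod.ext h' h))
    · rfl

theorem emb_conjTranspose (j : σ → ι) (M : Matrix (Reg σ) (Reg σ) ℂ) :
    emb j M.conjTranspose = (emb j M).conjTranspose := by
  ext x y
  simp only [emb, conjTranspose_apply, apply_ite star, star_zero]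
  by_cases h : ∀ q ∉ Set.range j, x q = y q
  · rw [if_pos h, if_pos fun q hq => (h q hq).symm]
  · rw [if_neg h, if_neg fun h' => h fun q hq => (h' q hq).symm]

theorem emb_mem_unitary {j : σ → ι} (hj : Function.Injective j) {M : Matrix (Reg σ) (Reg σ) ℂ}
    (hM : M ∈ unitaryGroup (Reg σ) ℂ) : emb j M ∈ unitaryGroup (Reg ι) ℂ := by
  rw [mem_unitaryGroup_iff, star_eq_conjTranspose] at *
  rw [← emb_conjTranspose, ← emb_mul hj, hM]
  exact emb_one hj

theorem SupportedOn.mono {A : Matrix (Reg ι) (Reg ι) ℂ} {P Q : ι → Prop} (hA : SupportedOn A P)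
    (h : ∀ q, P q → Q q) : SupportedOn A Q := by
  refine ⟨fun x y ⟨q, hq, hne⟩ => hA.1 x y ⟨q, fun hp => hq (h q hp), hne⟩, ?_⟩
  intro x y x' y' h1 h2
  by_cases hx : ∃ q, ¬ P q ∧ x q ≠ y q
  · rw [hA.1 x y hx, hA.1 x' y']
    obtain ⟨q, hq, hne⟩ := hx
    refine ⟨q, hq, ?_⟩
    by_cases hQ : Q q
    · rwa [← (h1 q hQ).1, ← (h1 q hQ).2]
    · exact absurd (h2 q hQ).1 hne
  · push Not at hx
    refine hA.2 _ _ _ _ (fun q hq => h1 q (h q hq)) fun q hq => ⟨hx q hq, ?_⟩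
    by_cases hQ : Q q
    · rw [← (h1 q hQ).1, ← (h1 q hQ).2]; exact hx q hq
    · exact (h2 q hQ).2

/-- The block of an operator in which the qubits outside the range of `j` are `0`. -/
noncomputable def restrictTo (j : σ → ι) (A : Matrix (Reg ι) (Reg ι) ℂ) :
    Matrix (Reg σ) (Reg σ) ℂ :=
  fun a b => A (Function.extend j a 0) (Function.extend j b 0)

theorem emb_restrictTo {j : σ → ι} (hj : Function.Injective j) {A : Matrix (Reg ι) (Reg ι) ℂ}
    {P : ι → Prop} (hA : SupportedOn A P) (hP : ∀ q, P q → q ∈ Set.range j) :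
    emb j (restrictTo j A) = A := by
  have hA := hA.mono hP
  ext x y
  unfold emb restrictTo
  split_ifs with h
  · refine hA.2 _ _ _ _ (fun q hq => ?_) fun q hq => ?_
    · obtain ⟨s, rfl⟩ := hq
      simp [hj.extend_apply]
    · refine ⟨?_, h q hq⟩
      rw [Function.extend_apply' _ _ _ hq, Function.extend_apply' _ _ _ hq]
  · push Not at h
    exact (hA.1 x y h).symm

theorem supportedOn_emb {j : σ → ι} (hj : Function.Injective j) {M : Matrix (Reg σ) (Reg σ) ℂ}
    {Q : σ → Prop} (hM : SupportedOn M Q) :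
    SupportedOn (emb j M) (fun q => ∃ s, j s = q ∧ Q s) := by
  constructor
  · rintro x y ⟨q, hq, hne⟩
    unfold emb
    split_ifs with h
    · by_cases hr : q ∈ Set.range j
      · obtain ⟨s, rfl⟩ := hr
        exact hM.1 _ _ ⟨s, fun hs => hq ⟨s, rfl, hs⟩, hne⟩
      · exact absurd (h q hr) hne
    · rfl
  · intro x y x' y' h h'
    unfold emb
    have h1 : (∀ q, q ∉ Set.range j → x q = y q) := fun q hq =>
      (h' q fun ⟨s, hs, _⟩ => hq ⟨s, hs⟩).1
    have h2 : (∀ q, q ∉ Set.range j → x' q = y' q) := fun q hq =>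
      (h' q fun ⟨s, hs, _⟩ => hq ⟨s, hs⟩).2
    rw [if_pos h1, if_pos h2]
    refine hM.2 _ _ _ _ (fun s hs => h (j s) ⟨s, rfl, hs⟩) fun s hs => h' (j s) ?_
    rintro ⟨t, ht, hQ⟩
    exact hs (hj ht ▸ hQ)

theorem supportedOn_true (A : Matrix (Reg ι) (Reg ι) ℂ) : SupportedOn A (fun _ => True) :=
  ⟨fun _ _ ⟨_, h, _⟩ => absurd trivial h, fun x y x' y' h _ => by
    rw [funext fun i => (h i trivial).1, funext fun i => (h i trivial).2]⟩

theorem SupportedOn.mul {A B : Matrix (Reg ι) (Reg ι) ℂ} {P : ι → Prop} (hA : SupportedOn A P)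
    (hB : SupportedOn B P) : SupportedOn (A * B) P := by
  classical
  have hj : Function.Injective (Subtype.val : {q // P q} → ι) := Subtype.val_injective
  have hr : ∀ q, P q → q ∈ Set.range (Subtype.val : {q // P q} → ι) := fun q hq => ⟨⟨q, hq⟩, rfl⟩
  rw [← emb_restrictTo hj hA hr, ← emb_restrictTo hj hB hr, ← emb_mul hj]
  refine (supportedOn_emb hj (supportedOn_true _)).mono ?_
  rintro _ ⟨s, rfl, _⟩
  exact s.2

theorem SupportedOn.conjTranspose {A : Matrix (Reg ι) (Reg ι) ℂ} {P : ι → Prop}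
    (hA : SupportedOn A P) : SupportedOn A.conjTranspose P := by
  constructor
  · rintro x y ⟨q, hq, hne⟩
    rw [conjTranspose_apply, hA.1 y x ⟨q, hq, hne.symm⟩, star_zero]
  · intro x y x' y' h h'
    rw [conjTranspose_apply, conjTranspose_apply, hA.2 y x y' x' (fun q hq => (h q hq).symm)
      fun q hq => ⟨(h' q hq).1.symm, (h' q hq).2.symm⟩]

theorem SupportedOn.commute {A B : Matrix (Reg ι) (Reg ι) ℂ} {P Q : ι → Prop}
    (hA : SupportedOn A P) (hB : SupportedOn B Q) (hPQ : ∀ q, P q → ¬ Q q) : A * B = B * A := by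
  classical
  have hB := hB.mono (Q := fun q => ¬ P q) fun q hq hp => hPQ q hp hq
  ext x y
  rw [mul_apply, mul_apply, Finset.sum_eq_single (fun q => if P q then y q else x q),
    Finset.sum_eq_single (fun q => if P q then x q else y q), mul_comm]
  · congr 1
    · refine hB.2 _ _ _ _ (fun q hq => ?_) fun q hq => ?_ <;> simp_all
    · refine hA.2 _ _ _ _ (fun q hq => ?_) fun q hq => ?_ <;> simp_all
  · intro w _ hw
    obtain ⟨q, hq⟩ := Function.ne_iff.1 hw
    by_cases hp : P q
    · rw [hB.1 x w ⟨q, not_not.2 hp, by simpa [hp, eq_comm] using hq⟩, zero_mul]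
    · rw [hA.1 w y ⟨q, hp, by simpa [hp] using hq⟩, mul_zero]
  · simp
  · intro w _ hw
    obtain ⟨q, hq⟩ := Function.ne_iff.1 hw
    by_cases hp : P q
    · rw [hB.1 w y ⟨q, not_not.2 hp, by simpa [hp] using hq⟩, mul_zero]
    · rw [hA.1 x w ⟨q, hp, by simpa [hp, eq_comm] using hq⟩, zero_mul]
  · simp

end Emb

/-! ### Matrices of functions and completely positive maps -/

section Kraus

variable {X Y Z X' Y' : Type}

open Classical in
/-- The matrix of a map between basis labels. -/
noncomputable def fmat (f : X → Y) : Matrix Y X ℂ := fun y x => if y = f x then 1 else 0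

theorem fmat_apply [DecidableEq Y] (f : X → Y) (y : Y) (x : X) :
    fmat f y x = if y = f x then 1 else 0 := by
  unfold fmat
  congr

theorem mul_fmat_apply [Fintype Y] (M : Matrix Z Y ℂ) (f : X → Y) (z : Z) (x : X) :
    (M * fmat f) z x = M z (f x) := by
  classical
  simp [mul_apply, fmat]

theorem fmat_conjTranspose_mul_apply [Fintype Y] (M : Matrix Y Z ℂ) (f : X → Y) (x : X) (z : Z) :
    ((fmat f).conjTranspose * M) x z = M (f x) z := by
  classical
  simp [mul_apply, fmat, apply_ite (starRingEnd ℂ)]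

theorem fmat_mul_fmat [Fintype Y] (g : Y → Z) (f : X → Y) : fmat g * fmat f = fmat (g ∘ f) := by
  ext z x
  rw [mul_fmat_apply]
  rfl

theorem fmat_isometry [DecidableEq X] [Fintype Y] {f : X → Y} (hf : Function.Injective f) :
    (fmat f).conjTranspose * fmat f = 1 := by
  ext x x'
  rw [fmat_conjTranspose_mul_apply, fmat, one_apply]
  by_cases h : x = x'
  · rw [if_pos (congrArg f h), if_pos h]
  · rw [if_neg fun h' => h (hf h'), if_neg h]

theorem fmat_conjTranspose {f : X → Y} {g : Y → X} (hgf : Function.LeftInverse g f)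
    (hfg : Function.RightInverse g f) : (fmat f).conjTranspose = fmat g := by
  ext x y
  simp only [fmat, conjTranspose_apply, apply_ite star, star_one, star_zero]
  by_cases h : y = f x
  · rw [if_pos h, if_pos (by rw [h, hgf])]
  · rw [if_neg h, if_neg fun h' => h (by rw [h', hfg])]

theorem fmat_coisometry [Fintype X] [DecidableEq Y] {f : X → Y} (hf : Function.Bijective f) :
    fmat f * (fmat f).conjTranspose = 1 := by
  obtain ⟨g, hgf, hfg⟩ := Function.bijective_iff_has_inverse.1 hf
  rw [fmat_conjTranspose hgf hfg, fmat_mul_fmat, hfg.comp_eq_id]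
  ext x y
  rw [fmat, one_apply]
  by_cases h : x = y
  · rw [if_pos h, if_pos (by exact h)]
  · rw [if_neg h, if_neg (by exact h)]

theorem kroneckerMap_fmat (f : X → Y) (g : X' → Y') :
    kroneckerMap (fun s t => s * t) (fmat f) (fmat g) = fmat (Prod.map f g) := by
  ext y x
  rw [kroneckerMap_apply, fmat, fmat, fmat]
  by_cases h : y = Prod.map f g x
  · rw [if_pos h, if_pos (by exact congrArg Prod.fst h), if_pos (by exact congrArg Prod.snd h), one_mul]
  · rw [if_neg h]
    by_cases h1 : y.1 = f x.1
    · rw [if_neg (fun h2 : y.2 = g x.2 => h (Prod.ext h1 h2)), mul_zero]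
    · rw [if_neg h1, zero_mul]

end Kraus

section Kraus

variable {X Y Z X' Y' : Type} [Fintype X] [Fintype Y] [Fintype X'] [Fintype Y']
  {κ κ' : Type} [Fintype κ] [Fintype κ']

/-- The completely positive map with Kraus operators `K k`. -/
def krausMap (K : κ → Matrix Y X ℂ) : Super X Y := fun ρ => ∑ k, K k * ρ * (K k).conjTranspose

theorem isChannel_krausMap [DecidableEq X] {K : κ → Matrix Y X ℂ} (hK : ∑ k, (K k).conjTranspose * K k = 1) :
    IsChannel (krausMap K) := by
  refine ⟨Fintype.card κ, fun i => K ((Fintype.equivFin κ).symm i), ?_, fun ρ => ?_⟩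
  · rw [← hK]
    exact (Fintype.equivFin κ).symm.sum_comp fun k => (K k).conjTranspose * K k
  · exact ((Fintype.equivFin κ).symm.sum_comp fun k => K k * ρ * (K k).conjTranspose).symm

theorem conjBy_conjBy (M : Matrix Z Y ℂ) (M' : Matrix Y X ℂ) (ρ : Matrix X X ℂ) :
    conjBy M (conjBy M' ρ) = conjBy (M * M') ρ := by
  simp only [conjBy, conjTranspose_mul, Matrix.mul_assoc]

theorem conjBy_krausMap (M : Matrix Z Y ℂ) (K : κ → Matrix Y X ℂ) (ρ : Matrix X X ℂ) :
    conjBy M (krausMap K ρ) = krausMap (fun k => M * K k) ρ := by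
  simp only [conjBy, krausMap, conjTranspose_mul, Matrix.mul_assoc, Matrix.mul_sum, Matrix.sum_mul]

theorem krausMap_conjBy (K : κ → Matrix Z Y ℂ) (M : Matrix Y X ℂ) (ρ : Matrix X X ℂ) :
    krausMap K (conjBy M ρ) = krausMap (fun k => K k * M) ρ := by
  simp only [conjBy, krausMap, conjTranspose_mul, Matrix.mul_assoc]

theorem krausMap_krausMap (K : κ → Matrix Z Y ℂ) (K' : κ' → Matrix Y X ℂ) (ρ : Matrix X X ℂ) :
    krausMap K (krausMap K' ρ) = krausMap (fun p : κ × κ' => K p.1 * K' p.2) ρ := by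
  simp only [krausMap, conjTranspose_mul, Matrix.mul_assoc, Matrix.mul_sum, Matrix.sum_mul,
    Fintype.sum_prod_type]

theorem krausMap_single_apply [DecidableEq X] (K : κ → Matrix Y X ℂ) (x z : X) (s t : Y) :
    krausMap K (single x z 1) s t = ∑ k, K k s x * star (K k t z) := by
  simp only [krausMap, Matrix.sum_apply]
  refine Finset.sum_congr rfl fun k _ => ?_
  rw [mul_apply, Finset.sum_eq_single z]
  · simp
  · intro w _ hw
    rw [mul_single_apply_of_ne _ _ _ _ _ hw, zero_mul]
  · simp

theorem tensorMap_krausMap [DecidableEq X] [DecidableEq X'] (K : κ → Matrix Y X ℂ) (L : κ' → Matrix Y' X' ℂ)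
    (ρ : Matrix (X × X') (X × X') ℂ) :
    tensorMap (krausMap K) (krausMap L) ρ =
      krausMap (fun p : κ × κ' => kroneckerMap (fun s t => s * t) (K p.1) (L p.2)) ρ := by
  have key : ∀ (A : Matrix (Y × Y') (X × X') ℂ) (s t : Y × Y'),
      (A * ρ * A.conjTranspose) s t = ∑ x, ∑ z, ρ x z * (A s x * star (A t z)) := by
    intro A s t
    simp only [mul_apply, conjTranspose_apply, Finset.sum_mul]
    rw [Finset.sum_comm]
    exact Finset.sum_congr rfl fun x _ => Finset.sum_congr rfl fun z _ => by ring
  ext s t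
  rw [krausMap, Matrix.sum_apply]
  simp only [key]
  rw [Finset.sum_comm, tensorMap, Matrix.sum_apply]
  refine Finset.sum_congr rfl fun x _ => ?_
  rw [Finset.sum_comm, Matrix.sum_apply]
  refine Finset.sum_congr rfl fun z _ => ?_
  rw [Matrix.smul_apply, kroneckerMap_apply, krausMap_single_apply, krausMap_single_apply,
    smul_eq_mul, ← Finset.mul_sum, Finset.sum_mul_sum, Fintype.sum_prod_type]
  simp only [kroneckerMap_apply, star_mul']
  congr 1
  exact Finset.sum_congr rfl fun k _ => Finset.sum_congr rfl fun l _ => by ring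

theorem krausMap_eq_conjBy {K : κ → Matrix Y X ℂ} {M : Matrix Y X ℂ} {c : κ → ℂ}
    (hK : ∀ k, K k = c k • M) (hc : ∑ k, c k * star (c k) = 1) (ρ : Matrix X X ℂ) :
    krausMap K ρ = conjBy M ρ := by
  simp only [krausMap, conjBy, hK, conjTranspose_smul, Matrix.smul_mul, Matrix.mul_smul, smul_smul,
    ← Finset.sum_smul]
  rw [Finset.sum_congr rfl fun k _ => mul_comm (star (c k)) (c k), hc, one_smul]

end Kraus

/-! ### Pauli operators, transversal operators and stacks -/

section Pauli

/-- The character `(-1)^a`. -/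
noncomputable def sgn (a : ZMod 2) : ℂ := (-1) ^ a.val

theorem sgn_zero : sgn 0 = 1 := by simp [sgn]

theorem sgn_one : sgn 1 = -1 := by simp [sgn, ZMod.val_one]

theorem zmod_two_cases : ∀ a : ZMod 2, a = 0 ∨ a = 1 := by decide

theorem sgn_add (a b : ZMod 2) : sgn (a + b) = sgn a * sgn b := by
  rcases zmod_two_cases a with rfl | rfl <;> rcases zmod_two_cases b with rfl | rfl <;>
    simp [sgn_zero, sgn_one, CharTwo.add_self_eq_zero]

theorem sgn_mul_self (a : ZMod 2) : sgn a * sgn a = 1 := by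
  rw [← sgn_add, CharTwo.add_self_eq_zero, sgn_zero]

theorem star_sgn (a : ZMod 2) : star (sgn a) = sgn a := by
  rcases zmod_two_cases a with rfl | rfl <;> simp [sgn_zero, sgn_one]

theorem sgn_injective : Function.Injective sgn := by
  intro a b
  rcases zmod_two_cases a with rfl | rfl <;> rcases zmod_two_cases b with rfl | rfl <;>
    norm_num [sgn_zero, sgn_one]

theorem sgn_sum {ι : Type} (s : Finset ι) (f : ι → ZMod 2) :
    sgn (∑ i ∈ s, f i) = ∏ i ∈ s, sgn (f i) := by
  classical
  induction s using Finset.induction_on with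
  | empty => simp [sgn_zero]
  | insert i s hi ih => rw [Finset.sum_insert hi, Finset.prod_insert hi, sgn_add, ih]

theorem reg_add_self {ι : Type} (x : Reg ι) : x + x = 0 := funext fun _ =>
  CharTwo.add_self_eq_zero _

theorem reg_add_cancel {ι : Type} (x y : Reg ι) : x + y + y = x := by
  rw [add_assoc, reg_add_self, add_zero]

theorem reg_eq_add_iff {ι : Type} {x y z : Reg ι} : x = y + z ↔ y = x + z :=
  ⟨fun h => by rw [h, reg_add_cancel], fun h => by rw [h, reg_add_cancel]⟩

variable {ι κ : Type} [Fintype ι] [DecidableEq ι] [Fintype κ] [DecidableEq κ]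

theorem pauli_apply (p q x y : Reg ι) :
    pauli p q x y = if x = y + p then sgn (q ⬝ᵥ y) else 0 := rfl

theorem pauli_mul_apply (p q : Reg ι) (M : Matrix (Reg ι) (Reg κ) ℂ) (x : Reg ι) (b : Reg κ) :
    (pauli p q * M) x b = sgn (q ⬝ᵥ (x + p)) * M (x + p) b := by
  rw [mul_apply, Finset.sum_eq_single (x + p)]
  · rw [pauli_apply, if_pos (reg_add_cancel x p).symm]
  · intro w _ hw
    rw [pauli_apply, if_neg fun h => hw (reg_eq_add_iff.1 h), zero_mul]
  · simp

theorem mul_pauli_apply (p q : Reg κ) (M : Matrix (Reg ι) (Reg κ) ℂ) (x : Reg ι) (b : Reg κ) :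
    (M * pauli p q) x b = M x (b + p) * sgn (q ⬝ᵥ b) := by
  rw [mul_apply, Finset.sum_eq_single (b + p)]
  · rw [pauli_apply, if_pos rfl]
  · intro w _ hw
    rw [pauli_apply, if_neg hw, mul_zero]
  · simp

theorem pauli_zero_zero : pauli (0 : Reg ι) 0 = 1 := by
  ext x y
  rw [pauli_apply, one_apply, zero_dotProduct, sgn_zero, add_zero]

theorem pauli_conjTranspose_mul_self (p q : Reg ι) : (pauli p q).conjTranspose * pauli p q = 1 := by
  ext x y
  rw [mul_pauli_apply, conjTranspose_apply, pauli_apply, one_apply]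
  by_cases h : x = y
  · rw [if_pos (by rw [h]), if_pos h, h, star_sgn, sgn_mul_self]
  · rw [if_neg fun h' => h (add_right_cancel h').symm, if_neg h, star_zero, zero_mul]

theorem pauli_mem_unitary (p q : Reg ι) : pauli p q ∈ unitaryGroup (Reg ι) ℂ :=
  mem_unitaryGroup_iff'.2 (pauli_conjTranspose_mul_self p q)

theorem pauli_mul_pauli (a b p q : Reg ι) :
    pauli a b * pauli p q = sgn (b ⬝ᵥ p + q ⬝ᵥ a) • (pauli p q * pauli a b) := by
  ext x y
  rw [Matrix.smul_apply, mul_pauli_apply, mul_pauli_apply, pauli_apply, pauli_apply,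
    add_right_comm y p a, smul_eq_mul]
  split_ifs
  · rw [dotProduct_add, dotProduct_add, sgn_add, sgn_add, sgn_add]
    linear_combination (-sgn (q ⬝ᵥ y) * sgn (b ⬝ᵥ y) * sgn (b ⬝ᵥ p)) * sgn_mul_self (q ⬝ᵥ a)
  · simp

theorem IsClifford.mul_pauli {U : Matrix (Reg ι) (Reg ι) ℂ} (hU : IsClifford U) {c : ℂ}
    (hc : star c * c = 1) (a b : Reg ι) : IsClifford (c • (U * pauli a b)) := by
  refine ⟨?_, fun p q => ?_⟩
  · rw [mem_unitaryGroup_iff', star_eq_conjTranspose, conjTranspose_smul, Matrix.smul_mul,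
      Matrix.mul_smul, smul_smul, hc, one_smul]
    exact mem_unitaryGroup_iff'.1 (mul_mem hU.1 (pauli_mem_unitary a b))
  · obtain ⟨p', q', c', h⟩ := hU.2 p q
    refine ⟨p', q', sgn (b ⬝ᵥ p + q ⬝ᵥ a) * c', ?_⟩
    have h1 : pauli a b * pauli p q * (pauli a b).conjTranspose =
        sgn (b ⬝ᵥ p + q ⬝ᵥ a) • pauli p q := by
      have := mem_unitaryGroup_iff.1 (pauli_mem_unitary a b)
      rw [star_eq_conjTranspose] at this
      rw [pauli_mul_pauli, Matrix.smul_mul, Matrix.mul_assoc, this, Matrix.mul_one]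
    calc c • (U * pauli a b) * pauli p q * (c • (U * pauli a b)).conjTranspose
        = (star c * c) • (U * (pauli a b * pauli p q * (pauli a b).conjTranspose)
            * U.conjTranspose) := by
          simp only [conjTranspose_smul, conjTranspose_mul, Matrix.smul_mul, Matrix.mul_smul,
            smul_smul, Matrix.mul_assoc]
      _ = _ := by
          rw [hc, one_smul, h1, Matrix.mul_smul, Matrix.smul_mul, h, smul_smul]

end Pauli

section Transversal

variable {L T : Type} [Fintype L] [DecidableEq L] [Fintype T] [DecidableEq T] {n : ℕ}

/-- Sums over a two-index register of products over the second index. -/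
theorem sum_prod_snd (f : L → Reg (Fin n) → ℂ) :
    ∑ x : Reg (Fin n × L), ∏ e, f e (fun i => x (i, e)) = ∏ e, ∑ a, f e a := by
  rw [Finset.prod_univ_sum, Fintype.piFinset_univ]
  refine Fintype.sum_equiv ⟨fun x e i => x (i, e), fun y s => y s.2 s.1, fun _ => rfl,
    fun _ => rfl⟩ _ _ fun x => rfl

theorem sum_prod_fst (f : Fin n → Reg L → ℂ) :
    ∑ x : Reg (Fin n × L), ∏ i, f i (fun e => x (i, e)) = ∏ i, ∑ a, f i a := by
  rw [Finset.prod_univ_sum, Fintype.piFinset_univ]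
  refine Fintype.sum_equiv ⟨fun x i e => x (i, e), fun y s => y s.1 s.2, fun _ => rfl,
    fun _ => rfl⟩ _ _ fun x => rfl

theorem transversal_mul (u v : L → Matrix (Reg (Fin n)) (Reg (Fin n)) ℂ) :
    transversal u * transversal v = transversal (fun e => u e * v e) := by
  ext x y
  simp only [mul_apply, transversal, ← Finset.prod_mul_distrib]
  exact sum_prod_snd fun e w => u e (fun i => x (i, e)) w * v e w fun i => y (i, e)

theorem transversal_one :
    transversal (fun _ : L => (1 : Matrix (Reg (Fin n)) (Reg (Fin n)) ℂ)) = 1 := by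
  ext x y
  simp only [transversal, one_apply, Finset.prod_ite_zero, Finset.prod_const_one]
  refine if_congr ?_ rfl rfl
  simp only [funext_iff, Finset.mem_univ, true_imp_iff, Prod.forall]
  exact forall_comm

theorem transversal_conjTranspose (u : L → Matrix (Reg (Fin n)) (Reg (Fin n)) ℂ) :
    (transversal u).conjTranspose = transversal (fun e => (u e).conjTranspose) := by
  ext x y
  simp only [transversal, conjTranspose_apply, star_prod]

theorem transversal_smul (c : L → ℂ) (u : L → Matrix (Reg (Fin n)) (Reg (Fin n)) ℂ) :
    transversal (fun e => c e • u e) = (∏ e, c e) • transversal u := by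
  ext x y
  simp only [transversal, Matrix.smul_apply, smul_eq_mul, Finset.prod_mul_distrib]

theorem transversal_mem_unitary {u : L → Matrix (Reg (Fin n)) (Reg (Fin n)) ℂ}
    (hu : ∀ e, u e ∈ unitaryGroup (Reg (Fin n)) ℂ) :
    transversal u ∈ unitaryGroup (Reg (Fin n × L)) ℂ := by
  rw [mem_unitaryGroup_iff, star_eq_conjTranspose, transversal_conjTranspose, transversal_mul,
    ← transversal_one]
  congr 1
  exact funext fun e => mem_unitaryGroup_iff.1 (hu e)

theorem transversal_pauli (p q : L → Reg (Fin n)) :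
    transversal (fun e => pauli (p e) (q e)) =
      pauli (fun s : Fin n × L => p s.2 s.1) (fun s => q s.2 s.1) := by
  ext x y
  simp only [transversal, pauli_apply, Finset.prod_ite_zero, ← sgn_sum]
  refine if_congr ?_ ?_ rfl
  · simp only [funext_iff, Finset.mem_univ, true_imp_iff, Prod.forall, Pi.add_apply]
    exact forall_comm
  · simp only [dotProduct, Fintype.sum_prod_type]
    rw [Finset.sum_comm]

theorem stack_isometry {V : Matrix (Reg L) (Reg T) ℂ} (hV : V.conjTranspose * V = 1) :
    (stack n V).conjTranspose * stack n V = 1 := by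
  ext b b'
  simp only [mul_apply, conjTranspose_apply, stack, star_prod, ← Finset.prod_mul_distrib]
  rw [sum_prod_fst fun i a => star (V a fun t => b (i, t)) * V a fun t => b' (i, t)]
  have : ∀ i, ∑ a, star (V a fun t => b (i, t)) * V a (fun t => b' (i, t)) =
      (1 : Matrix (Reg T) (Reg T) ℂ) (fun t => b (i, t)) (fun t => b' (i, t)) := fun i => by
    rw [← hV]; rfl
  simp only [this, one_apply, Finset.prod_ite_zero, Finset.prod_const_one]
  refine if_congr ?_ rfl rfl
  simp only [funext_iff, Finset.mem_univ, true_imp_iff, Prod.forall]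

end Transversal

/-! ### Transversal Clifford gates of self-dual codes -/

section SelfDual

variable {Λ T : Type} [Fintype Λ] [DecidableEq Λ] [Fintype T] [DecidableEq T]

/-- `V` is, up to a factor, the indicator function of a self-dual linear code whose words are
determined by their physical part, and an isometry. -/
structure IsSelfDualCode (L : Submodule (ZMod 2) (Reg Λ × Reg T)) (V : Matrix (Reg Λ) (Reg T) ℂ)
    (κ : ℂ) : Prop where
  apply_mem : ∀ x b, (x, b) ∈ L → V x b = κ
  apply_not_mem : ∀ x b, (x, b) ∉ L → V x b = 0
  dual : ∀ z, z ∈ L ↔ ∀ w ∈ L, w.1 ⬝ᵥ z.1 + w.2 ⬝ᵥ z.2 = 0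
  inj : ∀ b, ((0 : Reg Λ), b) ∈ L → b = 0
  isometry : V.conjTranspose * V = 1

variable {L : Submodule (ZMod 2) (Reg Λ × Reg T)} {V : Matrix (Reg Λ) (Reg T) ℂ} {κ : ℂ} {n : ℕ}

/-- The word `p` in the copies selected by `α`. -/
def spreadOver (α : Reg (Fin n)) {ι : Type} (p : Reg ι) : Reg (Fin n × ι) := fun s => p s.2 * α s.1

/-- The `i`-th copy of a word. -/
def copy {ι : Type} (x : Reg (Fin n × ι)) (i : Fin n) : Reg ι := fun e => x (i, e)

open Classical in
theorem IsSelfDualCode.stack_apply (hL : IsSelfDualCode L V κ) (x : Reg (Fin n × Λ))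
    (b : Reg (Fin n × T)) :
    stack n V x b = if ∀ i, (copy x i, copy b i) ∈ L then κ ^ n else 0 := by
  change ∏ i, V (copy x i) (copy b i) = _
  split_ifs with h
  · rw [Finset.prod_congr rfl fun i _ => hL.apply_mem _ _ (h i)]
    simp
  · push Not at h
    obtain ⟨i, hi⟩ := h
    exact Finset.prod_eq_zero (Finset.mem_univ i) (hL.apply_not_mem _ _ hi)

theorem spreadOver_dotProduct {ι : Type} [Fintype ι] [DecidableEq ι] (β : Reg (Fin n)) (p : Reg ι)
    (x : Reg (Fin n × ι)) : spreadOver β p ⬝ᵥ x = ∑ i, β i * (p ⬝ᵥ copy x i) := by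
  simp only [dotProduct, spreadOver, copy, Fintype.sum_prod_type, Finset.mul_sum]
  exact Finset.sum_congr rfl fun i _ => Finset.sum_congr rfl fun e _ => by ring

theorem transversal_pauli_spreadOver {ι : Type} [Fintype ι] [DecidableEq ι] (α β : Reg (Fin n))
    (p : Reg ι) : transversal (fun e => pauli (p e • α) (p e • β)) =
      pauli (spreadOver α p) (spreadOver β p) :=
  transversal_pauli _ _

theorem IsSelfDualCode.pauli_mul_stack_mul_pauli (hL : IsSelfDualCode L V κ) (α β : Reg (Fin n))
    {l : Reg Λ × Reg T} (hl : l ∈ L) :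
    ∃ c : ℂ, pauli (spreadOver α l.1) (spreadOver β l.1) * stack n V *
      pauli (spreadOver α l.2) (spreadOver β l.2) = c • stack n V := by
  refine ⟨sgn (spreadOver β l.1 ⬝ᵥ spreadOver α l.1), ?_⟩
  ext x b
  rw [mul_pauli_apply, pauli_mul_apply, Matrix.smul_apply, hL.stack_apply, hL.stack_apply,
    smul_eq_mul]
  have hcopy : ∀ {ι : Type} (y : Reg (Fin n × ι)) (p : Reg ι) (i : Fin n),
      copy (y + spreadOver α p) i = copy y i + α i • p := fun y p i => by
    funext e; simp [copy, spreadOver, mul_comm]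
  have hmem : (∀ i, (copy (x + spreadOver α l.1) i, copy (b + spreadOver α l.2) i) ∈ L) ↔
      ∀ i, (copy x i, copy b i) ∈ L := forall_congr' fun i => by
    rw [hcopy, hcopy, ← Prod.mk_add_mk, L.add_mem_iff_left]
    exact L.smul_mem (α i) hl
  by_cases h : ∀ i, (copy x i, copy b i) ∈ L
  · rw [if_pos h, if_pos (hmem.2 h), dotProduct_add, sgn_add]
    have : spreadOver β l.1 ⬝ᵥ x + spreadOver β l.2 ⬝ᵥ b = 0 := by
      rw [spreadOver_dotProduct, spreadOver_dotProduct, ← Finset.sum_add_distrib]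
      refine Finset.sum_eq_zero fun i _ => ?_
      rw [← mul_add, (hL.dual _).1 (h i) l hl, mul_zero]
    have := congrArg sgn this
    rw [sgn_add, sgn_zero] at this
    linear_combination sgn (spreadOver β l.1 ⬝ᵥ spreadOver α l.1) * κ ^ n * this
  · rw [if_neg h, if_neg fun h' => h (hmem.1 h')]
    simp

theorem IsClifford.transversal_mul_pauli {G : Matrix (Reg (Fin n)) (Reg (Fin n)) ℂ}
    {α β α' β' : Reg (Fin n)} {c : ℂ} (hG : G ∈ unitaryGroup (Reg (Fin n)) ℂ)
    (h : G * pauli α β * G.conjTranspose = c • pauli α' β') {ι : Type} [Fintype ι] [DecidableEq ι]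
    (p : Reg ι) : ∃ C : ℂ, transversal (fun _ : ι => G) * pauli (spreadOver α p) (spreadOver β p) =
      C • (pauli (spreadOver α' p) (spreadOver β' p) * transversal (fun _ : ι => G)) := by
  refine ⟨∏ e, if p e = 0 then 1 else c, ?_⟩
  rw [← transversal_pauli_spreadOver, ← transversal_pauli_spreadOver, transversal_mul,
    transversal_mul, ← transversal_smul]
  congr 1
  funext e
  rcases zmod_two_cases (p e) with he | he
  · simp [he, pauli_zero_zero]
  · rw [he, one_smul, one_smul, one_smul, one_smul, if_neg one_ne_zero, ← Matrix.smul_mul, ← h,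
      Matrix.mul_assoc _ G.conjTranspose, ← star_eq_conjTranspose,
      mem_unitaryGroup_iff'.1 hG, Matrix.mul_one]

/-- The stack conjugated by a transversal gate has the same stabilizers up to phases. -/
theorem IsSelfDualCode.pauli_mul_conj_mul_pauli (hL : IsSelfDualCode L V κ)
    {G : Matrix (Reg (Fin n)) (Reg (Fin n)) ℂ} (hG : IsClifford G) (α β : Reg (Fin n))
    {l : Reg Λ × Reg T} (hl : l ∈ L) {W' : Matrix (Reg (Fin n × Λ)) (Reg (Fin n × T)) ℂ}
    (hW' : transversal (fun _ : Λ => G) * W' = stack n V * transversal (fun _ : T => G)) :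
    ∃ c : ℂ, pauli (spreadOver α l.1) (spreadOver β l.1) * W' *
      pauli (spreadOver α l.2) (spreadOver β l.2) = c • W' := by
  obtain ⟨α', β', c, hc⟩ := hG.2 α β
  obtain ⟨C₁, h₁⟩ := IsClifford.transversal_mul_pauli hG.1 hc l.1
  obtain ⟨C₂, h₂⟩ := IsClifford.transversal_mul_pauli hG.1 hc l.2
  obtain ⟨d, hd⟩ := hL.pauli_mul_stack_mul_pauli α' β' hl
  have hu : (transversal (fun _ : Λ => G)).conjTranspose * transversal (fun _ : Λ => G) = 1 :=
    mem_unitaryGroup_iff'.1 (transversal_mem_unitary fun _ => hG.1)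
  have key : transversal (fun _ : Λ => G) * (pauli (spreadOver α l.1) (spreadOver β l.1) * W' *
      pauli (spreadOver α l.2) (spreadOver β l.2)) =
      transversal (fun _ : Λ => G) * ((C₁ * C₂ * d) • W') := by
    calc _ = (transversal (fun _ : Λ => G) * pauli (spreadOver α l.1) (spreadOver β l.1)) * W' *
          pauli (spreadOver α l.2) (spreadOver β l.2) := by simp only [Matrix.mul_assoc]
      _ = C₁ • (pauli (spreadOver α' l.1) (spreadOver β' l.1) * stack n V *
          (transversal (fun _ : T => G) * pauli (spreadOver α l.2) (spreadOver β l.2))) := by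
          simp only [h₁, Matrix.smul_mul, Matrix.mul_assoc]
          rw [← Matrix.mul_assoc _ W', hW', Matrix.mul_assoc]
      _ = (C₁ * C₂) • (pauli (spreadOver α' l.1) (spreadOver β' l.1) * stack n V *
          pauli (spreadOver α' l.2) (spreadOver β' l.2) * transversal (fun _ : T => G)) := by
          simp only [h₂, Matrix.mul_smul, smul_smul, Matrix.mul_assoc]
      _ = _ := by
          rw [hd, Matrix.smul_mul, Matrix.mul_smul, hW', smul_smul]
  refine ⟨C₁ * C₂ * d, ?_⟩
  have := congrArg (fun M => (transversal (fun _ : Λ => G)).conjTranspose * M) key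
  simpa only [← Matrix.mul_assoc, hu, Matrix.one_mul] using this

/-- A sign character of the code is given by a word of physical signs. -/
theorem IsSelfDualCode.exists_character (hL : IsSelfDualCode L V κ) (τ : L → ℂ) (h0 : τ 0 = 1)
    (hadd : ∀ l l', τ (l + l') = τ l * τ l') :
    ∃ q : Reg Λ, ∀ l : L, τ l = sgn (q ⬝ᵥ l.1.1) := by
  have hcases : ∀ l, τ l = 1 ∨ τ l = -1 := fun l => by
    refine mul_self_eq_one_iff.1 ?_
    rw [← hadd, ← h0]
    congr 1
    exact Subtype.ext (Prod.ext (reg_add_self _) (reg_add_self _))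
  choose f hf using fun l => show ∃ a : ZMod 2, τ l = sgn a from
    (hcases l).elim (fun h => ⟨0, h.trans sgn_zero.symm⟩) fun h => ⟨1, h.trans sgn_one.symm⟩
  let F : L →+ ZMod 2 :=
    { toFun := f
      map_zero' := sgn_injective (by rw [← hf, h0, sgn_zero])
      map_add' := fun l l' => sgn_injective (by rw [← hf, hadd, sgn_add, ← hf, ← hf]) }
  let π : L →ₗ[ZMod 2] Reg Λ := (LinearMap.fst (ZMod 2) (Reg Λ) (Reg T)).comp L.subtype
  have hπ : LinearMap.ker π = ⊥ := by
    refine LinearMap.ker_eq_bot'.2 fun l hl => ?_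
    have h1 : l.1.1 = 0 := hl
    refine Subtype.ext (Prod.ext h1 (hL.inj _ ?_))
    rw [← h1]
    exact l.2
  obtain ⟨g, hg⟩ := π.exists_leftInverse_of_injective hπ
  refine ⟨fun e => (F.toZModLinearMap 2).comp g (Pi.single e 1), fun l => ?_⟩
  rw [hf]
  congr 1
  have h1 : f l = (F.toZModLinearMap 2).comp g (π l) := by
    have : g (π l) = l := LinearMap.congr_fun hg l
    rw [LinearMap.comp_apply, this]
    rfl
  rw [h1, LinearMap.pi_apply_eq_sum_univ]
  simp only [dotProduct, smul_eq_mul, mul_comm]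
  refine Finset.sum_congr rfl fun e _ => ?_
  congr 2
  funext e'
  simp [Pi.single_apply, eq_comm]

theorem IsSelfDualCode.exists_pauli_of_stabilizers (hL : IsSelfDualCode L V κ)
    {W : Matrix (Reg (Fin n × Λ)) (Reg (Fin n × T)) ℂ}
    (hW : W.conjTranspose * W = 1)
    (hstab : ∀ (α β : Reg (Fin n)) (l : Reg Λ × Reg T), l ∈ L →
      ∃ c : ℂ, pauli (spreadOver α l.1) (spreadOver β l.1) * W *
        pauli (spreadOver α l.2) (spreadOver β l.2) = c • W) :
    ∃ (p q : Reg (Fin n × Λ)) (c : ℂ), star c * c = 1 ∧ W = c • (pauli p q * stack n V) := by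
  classical
  obtain ⟨x₀, hx₀⟩ : ∃ x₀, W x₀ 0 ≠ 0 := by
    by_contra! h
    have := congrFun (congrFun hW 0) 0
    simp [mul_apply, h] at this
  have hX : ∀ (i : Fin n) (l : L), ∃ τ : ℂ, ∀ x b,
      W (x + spreadOver (Pi.single i 1) l.1.1) (b + spreadOver (Pi.single i 1) l.1.2) = τ * W x b := by
    intro i l
    obtain ⟨c, hc⟩ := hstab (Pi.single i 1) 0 l.1 l.2
    refine ⟨c, fun x b => ?_⟩
    have := congrFun (congrFun hc x) b
    rw [mul_pauli_apply, pauli_mul_apply, Matrix.smul_apply, spreadOver_dotProduct,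
      spreadOver_dotProduct] at this
    simpa [sgn_zero] using this
  choose τ hτ using hX
  have hτ0 : ∀ i, τ i 0 = 1 := fun i => by
    have h := hτ i 0 x₀ 0
    have h0 : ∀ {ι : Type}, spreadOver (Pi.single i 1 : Reg (Fin n)) (0 : Reg ι) = 0 := by
      intro ι; funext s; simp [spreadOver]
    rw [show ((0 : L) : Reg Λ × Reg T).1 = 0 from rfl, show ((0 : L) : Reg Λ × Reg T).2 = 0 from rfl,
      h0, h0, add_zero, add_zero] at h
    exact mul_right_cancel₀ hx₀ (by rw [one_mul, ← h])
  have hτadd : ∀ i l l', τ i (l + l') = τ i l * τ i l' := fun i l l' => by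
    have hadd : ∀ {ι : Type} (p p' : Reg ι), spreadOver (Pi.single i 1 : Reg (Fin n)) (p + p') =
        spreadOver (Pi.single i 1) p' + spreadOver (Pi.single i 1) p := by
      intro ι p p'; funext s; simp [spreadOver]; ring
    have h := hτ i (l + l') x₀ 0
    rw [show ((l + l' : L) : Reg Λ × Reg T).1 = l.1.1 + l'.1.1 from rfl,
      show ((l + l' : L) : Reg Λ × Reg T).2 = l.1.2 + l'.1.2 from rfl, hadd, hadd, ← add_assoc,
      ← add_assoc, hτ, hτ, ← mul_assoc] at h
    exact (mul_right_cancel₀ hx₀ h).symm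
  choose q hq using fun i => hL.exists_character (τ i) (hτ0 i) (hτadd i)
  have hZ : ∀ x b, W x b ≠ 0 → ∀ i, (copy (x + x₀) i, copy b i) ∈ L := by
    intro x b hxb i
    refine (hL.dual _).2 fun l hl => ?_
    obtain ⟨c, hc⟩ := hstab 0 (Pi.single i 1) l hl
    have hent : ∀ x b, sgn (l.1 ⬝ᵥ copy x i) * W x b * sgn (l.2 ⬝ᵥ copy b i) = c * W x b := by
      intro x b
      have := congrFun (congrFun hc x) b
      rw [mul_pauli_apply, pauli_mul_apply, Matrix.smul_apply, spreadOver_dotProduct,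
        spreadOver_dotProduct] at this
      have h0 : ∀ {ι : Type} (p : Reg ι), spreadOver (0 : Reg (Fin n)) p = 0 := by
        intro ι p; funext s; simp [spreadOver]
      rw [h0, h0, add_zero, add_zero] at this
      simpa [Pi.single_apply] using this
    have h1 : sgn (l.1 ⬝ᵥ copy x i) * sgn (l.2 ⬝ᵥ copy b i) = c :=
      mul_right_cancel₀ hxb (by rw [← hent]; ring)
    have h2 : sgn (l.1 ⬝ᵥ copy x₀ i) = c := mul_right_cancel₀ hx₀ (by
      rw [← hent, show copy (0 : Reg (Fin n × T)) i = 0 from rfl, dotProduct_zero, sgn_zero, mul_one])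
    refine sgn_injective ?_
    rw [show copy (x + x₀) i = copy x i + copy x₀ i from rfl, dotProduct_add, sgn_add, sgn_add, h2,
      mul_right_comm, h1, ← h2, sgn_mul_self, sgn_zero]
  have hmem : ∀ z b, (∀ i, (copy z i, copy b i) ∈ L) → ∀ s : Finset (Fin n),
      W (x₀ + fun e => if e.1 ∈ s then z e else 0) (fun e => if e.1 ∈ s then b e else 0) =
        (∏ i ∈ s, sgn (q i ⬝ᵥ copy z i)) * W x₀ 0 := by
    intro z b hzb s
    induction s using Finset.induction_on with
    | empty =>
      simp only [Finset.notMem_empty, if_false, Finset.prod_empty, one_mul]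
      rw [show (fun _ => 0 : Reg (Fin n × Λ)) = 0 from rfl, add_zero]
      rfl
    | insert i s hi ih =>
      have hins : ∀ {ι : Type} (y : Reg (Fin n × ι)),
          (fun e => if e.1 ∈ insert i s then y e else 0 : Reg (Fin n × ι)) =
            (fun e => if e.1 ∈ s then y e else 0) + spreadOver (Pi.single i 1) (copy y i) := by
        intro ι y
        funext ⟨k, e⟩
        by_cases hk : k = i
        · subst hk; simp [spreadOver, copy, hi]
        · simp [spreadOver, copy, hk]
      rw [hins, hins, ← add_assoc, hτ i ⟨_, hzb i⟩, ih, hq, Finset.prod_insert hi, mul_assoc]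
  have hform : ∀ x b, W x b =
      if ∀ i, (copy (x + x₀) i, copy b i) ∈ L then
        (∏ i, sgn (q i ⬝ᵥ copy (x + x₀) i)) * W x₀ 0 else 0 := by
    intro x b
    split_ifs with h
    · have := hmem _ _ h Finset.univ
      simp only [Finset.mem_univ, if_true] at this
      rw [← this]
      congr 1
      exact (by rw [add_comm x₀]; exact (reg_add_cancel x x₀).symm)
    · exact by_contra fun h' => h (hZ x b h')
  have hκ : κ ^ n ≠ 0 := fun h => by
    have h1 := congrFun (congrFun (stack_isometry (n := n) hL.isometry) 0) 0
    simp [mul_apply, hL.stack_apply, h] at h1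
  have hWeq : W = (W x₀ 0 / κ ^ n) • (pauli x₀ (fun e => q e.1 e.2) * stack n V) := by
    ext x b
    rw [Matrix.smul_apply, pauli_mul_apply, hL.stack_apply, hform x b]
    have : (fun e => q e.1 e.2 : Reg (Fin n × Λ)) ⬝ᵥ (x + x₀) =
        ∑ i, q i ⬝ᵥ copy (x + x₀) i := by
      simp only [dotProduct, Fintype.sum_prod_type, copy]
    rw [this, sgn_sum]
    split_ifs
    · rw [smul_eq_mul]; field_simp
    · simp
  refine ⟨x₀, fun e => q e.1 e.2, _, ?_, hWeq⟩
  rw [hWeq, conjTranspose_smul, Matrix.smul_mul, Matrix.mul_smul, smul_smul, conjTranspose_mul,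
    Matrix.mul_assoc, ← Matrix.mul_assoc _ (pauli _ _), pauli_conjTranspose_mul_self,
    Matrix.one_mul, stack_isometry hL.isometry] at hW
  simpa using congrFun (congrFun hW 0) 0

/-- Every Clifford unitary on `n` qubits is implemented transversally on `n` copies of a self-dual
code, acting in the same way on the bulk qubits of all tiles. -/
theorem IsSelfDualCode.exists_transversal [Nonempty Λ] (hL : IsSelfDualCode L V κ)
    {G : Matrix (Reg (Fin n)) (Reg (Fin n)) ℂ} (hG : IsClifford G) :
    ∃ u : Λ → Matrix (Reg (Fin n)) (Reg (Fin n)) ℂ, (∀ e, IsClifford (u e)) ∧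
      transversal u * stack n V = stack n V * transversal (fun _ : T => G) := by
  have hΛ := mem_unitaryGroup_iff'.1 (transversal_mem_unitary fun _ : Λ => hG.1)
  have hΛ' := mem_unitaryGroup_iff.1 (transversal_mem_unitary fun _ : Λ => hG.1)
  have hT := mem_unitaryGroup_iff'.1 (transversal_mem_unitary fun _ : T => hG.1)
  rw [star_eq_conjTranspose] at hΛ hΛ' hT
  set W := (transversal (fun _ : Λ => G)).conjTranspose * (stack n V * transversal (fun _ : T => G))
    with hWdef
  have hW' : transversal (fun _ : Λ => G) * W = stack n V * transversal (fun _ : T => G) := by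
    rw [hWdef, ← Matrix.mul_assoc, hΛ', Matrix.one_mul]
  have hiso : W.conjTranspose * W = 1 := by
    rw [hWdef, conjTranspose_mul, conjTranspose_conjTranspose, Matrix.mul_assoc,
      ← Matrix.mul_assoc _ _ (stack n V * _), hΛ', Matrix.one_mul, conjTranspose_mul,
      Matrix.mul_assoc, ← Matrix.mul_assoc _ (stack n V), stack_isometry hL.isometry,
      Matrix.one_mul, hT]
  obtain ⟨p, q, c, hc, h⟩ := hL.exists_pauli_of_stabilizers hiso
    fun α β l hl => hL.pauli_mul_conj_mul_pauli hG α β hl hW'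
  obtain ⟨e₀⟩ := ‹Nonempty Λ›
  refine ⟨fun e => (if e = e₀ then c else 1) • (G * pauli (fun i => p (i, e)) (fun i => q (i, e))), fun e => ?_, ?_⟩
  · refine hG.mul_pauli ?_ _ _
    split_ifs
    · exact hc
    · simp
  · rw [transversal_smul, ← transversal_mul, transversal_pauli, Finset.prod_ite_eq' Finset.univ e₀,
      if_pos (Finset.mem_univ _), Matrix.smul_mul, ← hW', h, Matrix.mul_smul, Matrix.mul_assoc]

end SelfDual

/-! ### Permutations of the qubits of a register -/

section RegPerm

variable {ι : Type} [Fintype ι] [DecidableEq ι]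

/-- The unitary that permutes the qubits of a register. -/
noncomputable def regPerm (e : ι ≃ ι) : Matrix (Reg ι) (Reg ι) ℂ := fmat fun y => y ∘ e

theorem regPerm_mul (e f : ι ≃ ι) : regPerm e * regPerm f = regPerm (e.trans f) := by
  rw [regPerm, regPerm, fmat_mul_fmat]
  rfl

theorem regPerm_mem_unitary (e : ι ≃ ι) : regPerm e ∈ unitaryGroup (Reg ι) ℂ :=
  mem_unitaryGroup_iff'.2 (fmat_isometry fun x y h => funext fun i => by
    simpa using congrFun h (e.symm i))

theorem regPerm_conj_apply (e : ι ≃ ι) (A : Matrix (Reg ι) (Reg ι) ℂ) (x y : Reg ι) :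
    (regPerm e * A * (regPerm e).conjTranspose) x y = A (x ∘ e.symm) (y ∘ e.symm) := by
  have h : regPerm e = (fmat fun y : Reg ι => y ∘ e.symm).conjTranspose :=
    (fmat_conjTranspose (fun y => by simp [Function.comp_assoc])
      (fun y => by simp [Function.comp_assoc])).symm
  rw [h, conjTranspose_conjTranspose, mul_fmat_apply, fmat_conjTranspose_mul_apply]

theorem SupportedOn.regPerm_conj {A : Matrix (Reg ι) (Reg ι) ℂ} {P : ι → Prop}
    (hA : SupportedOn A P) (e : ι ≃ ι) :
    SupportedOn (regPerm e * A * (regPerm e).conjTranspose) (fun q => P (e q)) := by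
  constructor
  · rintro x y ⟨q, hq, hne⟩
    rw [regPerm_conj_apply]
    exact hA.1 _ _ ⟨e q, hq, by simpa using hne⟩
  · intro x y x' y' h h'
    rw [regPerm_conj_apply, regPerm_conj_apply]
    exact hA.2 _ _ _ _ (fun q hq => h (e.symm q) (by simpa using hq))
      fun q hq => h' (e.symm q) (by simpa using hq)

theorem supportedOn_regPerm {e : ι ≃ ι} {P : ι → Prop} (he : ∀ q, ¬ P q → e q = q) :
    SupportedOn (regPerm e) P := by
  have heP : ∀ q, P q → P (e q) := fun q hq => by
    by_contra h
    rw [e.injective (he _ h)] at h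
    exact h hq
  constructor
  · rintro x y ⟨q, hq, hne⟩
    refine if_neg fun h => hne ?_
    rw [h]
    exact congrArg y (he q hq)
  · intro x y x' y' h h'
    rw [regPerm, fmat_apply, fmat_apply]
    refine if_congr ?_ rfl rfl
    simp only [funext_iff, Function.comp]
    refine forall_congr' fun q => ?_
    by_cases hq : P q
    · rw [(h q hq).1, (h _ (heP q hq)).2]
    · rw [he q hq, (h' q hq).1, (h' q hq).2]
      simp

end RegPerm

section Angle

variable {N : ℕ} [NeZero N]

theorem angDist_self (j : ZMod N) : angDist j j = 0 := by simp [angDist]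

theorem angDist_comm (j k : ZMod N) : angDist j k = angDist k j := by
  unfold angDist
  have : |(j - k).valMinAbs| = |(k - j).valMinAbs| :=
    ZMod.abs_valMinAbs_eq_abs_valMinAbs.2 (Or.inr (neg_sub k j).symm)
  rw [← Int.cast_abs, ← Int.cast_abs, this]

theorem angDist_triangle (i j k : ZMod N) : angDist i k ≤ angDist i j + angDist j k := by
  unfold angDist
  rw [← mul_add]
  refine mul_le_mul_of_nonneg_left ?_ (by positivity)
  have h := ZMod.natAbs_valMinAbs_add_le (i - j) (j - k)
  rw [sub_add_sub_cancel] at h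
  have h2 := Int.natAbs_add_le (i - j).valMinAbs (j - k).valMinAbs
  have h3 : |(i - k).valMinAbs| ≤ |(i - j).valMinAbs| + |(j - k).valMinAbs| := by
    simp only [Int.abs_eq_natAbs]
    omega
  exact_mod_cast h3

end Angle

section Legs

variable {N n R : ℕ} [NeZero N]

/-- Exchange of the sites `p s` and `p' s` in every slot `s`. -/
def slotSwap (p p' : Slot n R → ZMod N) : ZMod N × Slot n R ≃ ZMod N × Slot n R where
  toFun q := (Equiv.swap (p q.2) (p' q.2) q.1, q.2)
  invFun q := (Equiv.swap (p q.2) (p' q.2) q.1, q.2)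
  left_inv q := by simp
  right_inv q := by simp

theorem swapLegs_eq (p p' : Slot n R → ZMod N) : swapLegs p p' = regPerm (slotSwap p p') := by
  ext x y
  rw [regPerm, fmat_apply]
  rfl

theorem swapLegs_mem_unitary (p p' : Slot n R → ZMod N) :
    swapLegs p p' ∈ unitaryGroup (Reg (ZMod N × Slot n R)) ℂ := by
  rw [swapLegs_eq]
  exact regPerm_mem_unitary _

theorem angDist_slotSwap_lt {p p' : Slot n R → ZMod N} {s : ℝ} (hs : 0 < s)
    (h : ∀ t, angDist (p t) (p' t) < s) (q : ZMod N × Slot n R) :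
    angDist q.1 (slotSwap p p' q).1 < s := by
  simp only [slotSwap, Equiv.coe_fn_mk, Equiv.swap_apply_def]
  split_ifs with h1 h2
  · rw [h1]; exact h _
  · rw [h2, angDist_comm]; exact h _
  · rwa [angDist_self]

theorem SupportedOn.swapLegs_conj {p p' : Slot n R → ZMod N} {s : ℝ} (hs : 0 < s)
    (h : ∀ t, angDist (p t) (p' t) < s) {k : ZMod N} {r : ℝ}
    {A : Matrix (Reg (ZMod N × Slot n R)) (Reg (ZMod N × Slot n R)) ℂ}
    (hA : SupportedOn A (fun q => angDist q.1 k < r)) :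
    SupportedOn (swapLegs p p' * A * (swapLegs p p').conjTranspose)
      (fun q => angDist q.1 k < s + r) := by
  rw [swapLegs_eq]
  refine (hA.regPerm_conj _).mono fun q hq => ?_
  have h1 := angDist_triangle q.1 (slotSwap p p' q).1 k
  have h2 := angDist_slotSwap_lt hs h q
  linarith

theorem hasSpread_swapLegs {p p' : Slot n R → ZMod N} {s : ℝ} (hs : 0 < s)
    (h : ∀ t, angDist (p t) (p' t) < s) : HasSpread (swapLegs p p') s := by
  intro k A hA
  rw [swapLegs_eq]
  refine (hA.regPerm_conj _).mono fun q hq => ?_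
  have h2 := angDist_slotSwap_lt hs h q
  rwa [hq] at h2

theorem swapLegs_mul_place (p p' : Slot n R → ZMod N) : swapLegs p p' * place p = place p' := by
  have h : ∀ p : Slot n R → ZMod N,
      place p = fmat fun y : Reg (Slot n R) => fun q => if q.1 = p q.2 then y q.2 else 0 := by
    intro p
    ext x y
    rw [fmat_apply]
    rfl
  rw [swapLegs_eq, h, h, regPerm, fmat_mul_fmat]
  congr 1
  funext y q
  simp only [Function.comp, slotSwap, Equiv.coe_fn_mk]
  refine if_congr ?_ rfl rfl
  rw [Equiv.swap_apply_eq_iff, Equiv.swap_apply_left]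

theorem supportedOn_swapLegs {p p' : Slot n R → ZMod N} {P : ZMod N × Slot n R → Prop}
    (h : ∀ s, p s = p' s ∨ P (p s, s) ∧ P (p' s, s)) : SupportedOn (swapLegs p p') P := by
  rw [swapLegs_eq]
  refine supportedOn_regPerm ?_
  rintro ⟨k, s⟩ hq
  refine Prod.ext ?_ rfl
  simp only [slotSwap, Equiv.coe_fn_mk]
  rcases h s with h | ⟨h1, h2⟩
  · rw [h, Equiv.swap_self, Equiv.refl_apply]
  · exact Equiv.swap_apply_of_ne_of_ne (fun h => hq (by rwa [h])) fun h => hq (by rwa [h])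

variable {θ : ℝ}

/-- The qubit that holds the slot `s` of the centred codes. -/
noncomputable def centredQubit (N : ℕ) (θ : ℝ) (s : Slot n R) : ZMod N × Slot n R :=
  (centred N n R θ s, s)

theorem centredQubit_injective : Function.Injective (centredQubit (n := n) (R := R) N θ) :=
  fun _ _ h => congrArg Prod.snd h

theorem mem_range_centredQubit (q : ZMod N × Slot n R) :
    q ∈ Set.range (centredQubit N θ) ↔ q.1 = centred N n R θ q.2 :=
  ⟨fun ⟨s, hs⟩ => by rw [← hs]; rfl, fun h => ⟨q.2, Prod.ext h.symm rfl⟩⟩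

theorem centredGate_eq (u : Leg R → Matrix (Reg (Fin n)) (Reg (Fin n)) ℂ) :
    centredGate N θ u = emb (centredQubit N θ) (transversal u) := by
  ext x y
  have h : (∀ q, q ∉ Set.range (centredQubit N θ) → x q = y q) ↔
      ∀ q, q.1 ≠ centred N n R θ q.2 → x q = y q := by
    simp only [mem_range_centredQubit, ne_eq]
  unfold centredGate emb
  by_cases h' : ∀ q, q.1 ≠ centred N n R θ q.2 → x q = y q
  · rw [if_pos h', if_pos (h.2 h')]
    rfl
  · rw [if_neg h', if_neg fun h'' => h' (h.1 h'')]

theorem centredGate_mul (u v : Leg R → Matrix (Reg (Fin n)) (Reg (Fin n)) ℂ) :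
    centredGate N θ u * centredGate N θ v = centredGate N θ fun e => u e * v e := by
  rw [centredGate_eq, centredGate_eq, centredGate_eq, ← emb_mul centredQubit_injective,
    transversal_mul]

theorem centredGate_mem_unitary {u : Leg R → Matrix (Reg (Fin n)) (Reg (Fin n)) ℂ}
    (hu : ∀ e, u e ∈ unitaryGroup (Reg (Fin n)) ℂ) :
    centredGate N θ u ∈ unitaryGroup (Reg (ZMod N × Slot n R)) ℂ := by
  rw [centredGate_eq]
  exact emb_mem_unitary centredQubit_injective (transversal_mem_unitary hu)

theorem centredGate_mul_place (u : Leg R → Matrix (Reg (Fin n)) (Reg (Fin n)) ℂ) :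
    centredGate N θ u * place (centred N n R θ) = place (centred N n R θ) * transversal u := by
  ext x y
  have h : place (centred N n R θ) = fmat fun y : Reg (Slot n R) => fun q =>
      if q.1 = centred N n R θ q.2 then y q.2 else 0 := by
    ext x y
    rw [fmat_apply]
    rfl
  rw [h, mul_fmat_apply, mul_apply, centredGate]
  have h2 : (fun s : Slot n R => if centred N n R θ s = centred N n R θ s then y s else 0) = y :=
    funext fun s => if_pos rfl
  dsimp only
  rw [h2]
  split_ifs with hx
  · rw [Finset.sum_eq_single fun s => x (centred N n R θ s, s)]
    · rw [fmat, if_pos, one_mul]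
      funext q
      split_ifs with hq
      · change x q = x (centred N n R θ q.2, q.2)
        rw [← hq]
      · exact (hx q hq).trans (if_neg hq)
    · intro w _ hw
      rw [fmat, if_neg, zero_mul]
      rintro rfl
      exact hw (funext fun s => (if_pos rfl).symm)
    · simp
  · refine (Finset.sum_eq_zero fun w _ => ?_).symm
    rw [fmat, if_neg, zero_mul]
    rintro rfl
    exact hx fun q hq => by simp [hq]

theorem supportedOn_transversal {L : Type} [Fintype L] [DecidableEq L]
    {u : L → Matrix (Reg (Fin n)) (Reg (Fin n)) ℂ} {P : L → Prop} (hu : ∀ e, ¬ P e → u e = 1) :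
    SupportedOn (transversal u) fun s => P s.2 := by
  constructor
  · rintro x y ⟨⟨i, e⟩, he, hne⟩
    refine Finset.prod_eq_zero (Finset.mem_univ e) ?_
    rw [hu e he, one_apply_ne fun h => hne (congrFun h i)]
  · intro x y x' y' h h'
    refine Finset.prod_congr rfl fun e _ => ?_
    by_cases he : P e
    · rw [funext fun i => (h (i, e) he).1, funext fun i => (h (i, e) he).2]
    · rw [hu e he, funext fun i => (h' (i, e) he).1, funext fun i => (h' (i, e) he).2, one_apply_eq,
        one_apply_eq]

theorem supportedOn_centredGate {u : Leg R → Matrix (Reg (Fin n)) (Reg (Fin n)) ℂ}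
    {P : ZMod N × Slot n R → Prop} (hu : ∀ i e, ¬ P (legSite N θ 0 e, (i, e)) → u e = 1) :
    SupportedOn (centredGate N θ u) P := by
  rw [centredGate_eq]
  refine (supportedOn_emb centredQubit_injective
    (supportedOn_transversal (P := fun e => u e ≠ 1) fun e => not_not.1)).mono ?_
  rintro _ ⟨⟨i, e⟩, rfl, he⟩
  exact by_contra fun h => he (hu i e h)

open Classical in
theorem SupportedOn.centredGate_conj {u : Leg R → Matrix (Reg (Fin n)) (Reg (Fin n)) ℂ}
    (hu : ∀ e, u e ∈ unitaryGroup (Reg (Fin n)) ℂ) {P : ZMod N → Prop}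
    {A : Matrix (Reg (ZMod N × Slot n R)) (Reg (ZMod N × Slot n R)) ℂ}
    (hA : SupportedOn A (fun q => P q.1)) :
    SupportedOn (centredGate N θ u * A * (centredGate N θ u).conjTranspose) (fun q => P q.1) := by
  set v : Leg R → Matrix (Reg (Fin n)) (Reg (Fin n)) ℂ :=
    fun e => if P (legSite N θ 0 e) then u e else 1
  set w : Leg R → Matrix (Reg (Fin n)) (Reg (Fin n)) ℂ :=
    fun e => if P (legSite N θ 0 e) then 1 else u e
  have huvw : centredGate N θ u = centredGate N θ v * centredGate N θ w := by
    rw [centredGate_mul]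
    congr 1
    funext e
    by_cases h : P (legSite N θ 0 e) <;> simp [v, w, h]
  have hv : SupportedOn (centredGate N θ v) (fun q => P q.1) :=
    supportedOn_centredGate fun i e h => if_neg h
  have hw : SupportedOn (centredGate N θ w) (fun q => ¬ P q.1) :=
    supportedOn_centredGate fun i e h => if_pos (not_not.1 h)
  have hwu := mem_unitaryGroup_iff.1 (centredGate_mem_unitary (N := N) (θ := θ) (u := w) fun e => by
    by_cases h : P (legSite N θ 0 e)
    · simp only [w, h, if_true]; exact one_mem _
    · simp only [w, h, if_false]; exact hu e)
  rw [star_eq_conjTranspose] at hwu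
  have : centredGate N θ u * A * (centredGate N θ u).conjTranspose =
      centredGate N θ v * A * (centredGate N θ v).conjTranspose := by
    rw [huvw, conjTranspose_mul, Matrix.mul_assoc _ (centredGate N θ w),
      ← hA.commute hw fun q h h' => h' h, Matrix.mul_assoc, Matrix.mul_assoc,
      ← Matrix.mul_assoc (centredGate N θ w), hwu, Matrix.one_mul, Matrix.mul_assoc]
  rw [this]
  exact (hv.mul hA).mul hv.conjTranspose

end Legs

/-! ### The dynamics and its localization -/

section Dynamics

variable {N n R : ℕ} [NeZero N] {θ : ℝ}

/-- Move the legs from the sites `p` to the centred positions, apply a transversal gate, move the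
legs to the sites `q`. -/
noncomputable def moveGate (θ : ℝ) (p q : Slot n R → ZMod N)
    (u : Leg R → Matrix (Reg (Fin n)) (Reg (Fin n)) ℂ) :
    Matrix (Reg (ZMod N × Slot n R)) (Reg (ZMod N × Slot n R)) ℂ :=
  swapLegs (centred N n R θ) q * centredGate N θ u * swapLegs p (centred N n R θ)

theorem moveGate_mem_unitary (p q : Slot n R → ZMod N)
    {u : Leg R → Matrix (Reg (Fin n)) (Reg (Fin n)) ℂ}
    (hu : ∀ e, u e ∈ unitaryGroup (Reg (Fin n)) ℂ) :
    moveGate θ p q u ∈ unitaryGroup (Reg (ZMod N × Slot n R)) ℂ :=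
  mul_mem (mul_mem (swapLegs_mem_unitary _ _) (centredGate_mem_unitary hu))
    (swapLegs_mem_unitary _ _)

theorem hasSpread_moveGate {p q : Slot n R → ZMod N}
    {u : Leg R → Matrix (Reg (Fin n)) (Reg (Fin n)) ℂ}
    (hu : ∀ e, u e ∈ unitaryGroup (Reg (Fin n)) ℂ) {s : ℝ} (hs : 0 < s)
    (hp : ∀ t, angDist (p t) (centred N n R θ t) < s)
    (hq : ∀ t, angDist (centred N n R θ t) (q t) < s) :
    HasSpread (moveGate θ p q u) (s + s) := by
  intro k A hA
  have h1 := hasSpread_swapLegs hs hp k A hA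
  have h2 := h1.centredGate_conj (θ := θ) hu (P := fun j => angDist j k < s)
  have h3 := h2.swapLegs_conj hs hq
  simpa only [moveGate, conjTranspose_mul, Matrix.mul_assoc] using h3

theorem moveGate_mul_place (p q : Slot n R → ZMod N)
    (u : Leg R → Matrix (Reg (Fin n)) (Reg (Fin n)) ℂ) :
    moveGate θ p q u * place p = place q * transversal u := by
  rw [moveGate, Matrix.mul_assoc, swapLegs_mul_place, Matrix.mul_assoc, centredGate_mul_place,
    ← Matrix.mul_assoc, swapLegs_mul_place]

section Factor

variable (Λ : Leg R → Prop) [DecidablePred Λ]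

/-- The positions `p` for the legs in `Λ`, the centred positions for the others. -/
noncomputable def movedOn (θ : ℝ) (p : Slot n R → ZMod N) : Slot n R → ZMod N :=
  fun s => if Λ s.2 then p s else centred N n R θ s

/-- The gates `u` on the legs in `Λ`, the identity on the others. -/
def gateOn (u : Leg R → Matrix (Reg (Fin n)) (Reg (Fin n)) ℂ) :
    Leg R → Matrix (Reg (Fin n)) (Reg (Fin n)) ℂ :=
  fun e => if Λ e then u e else 1

theorem moveGate_factor (p q : Slot n R → ZMod N)
    (u : Leg R → Matrix (Reg (Fin n)) (Reg (Fin n)) ℂ) :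
    moveGate θ p q u = moveGate θ (movedOn Λ θ p) (movedOn Λ θ q) (gateOn Λ u) *
      moveGate θ (movedOn (fun e => ¬ Λ e) θ p) (movedOn (fun e => ¬ Λ e) θ q)
        (gateOn (fun e => ¬ Λ e) u) := by
  have hA : swapLegs p (centred N n R θ) = swapLegs (movedOn Λ θ p) (centred N n R θ) *
      swapLegs (movedOn (fun e => ¬ Λ e) θ p) (centred N n R θ) := by
    rw [swapLegs_eq, swapLegs_eq, swapLegs_eq, regPerm_mul]
    congr 1
    ext ⟨k, s⟩ : 1
    by_cases h : Λ s.2 <;> simp [slotSwap, movedOn, h]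
  have hC : swapLegs (centred N n R θ) q = swapLegs (centred N n R θ) (movedOn Λ θ q) *
      swapLegs (centred N n R θ) (movedOn (fun e => ¬ Λ e) θ q) := by
    rw [swapLegs_eq, swapLegs_eq, swapLegs_eq, regPerm_mul]
    congr 1
    ext ⟨k, s⟩ : 1
    by_cases h : Λ s.2 <;> simp [slotSwap, movedOn, h]
  have hB : centredGate N θ u = centredGate N θ (gateOn Λ u) *
      centredGate N θ (gateOn (fun e => ¬ Λ e) u) := by
    rw [centredGate_mul]
    congr 1
    funext e
    by_cases h : Λ e <;> simp [gateOn, h]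
  have sA : SupportedOn (swapLegs (movedOn Λ θ p) (centred N n R θ)) fun x => Λ x.2.2 :=
    supportedOn_swapLegs fun s => by by_cases h : Λ s.2 <;> simp [movedOn, h]
  have sC : SupportedOn (swapLegs (centred N n R θ) (movedOn (fun e => ¬ Λ e) θ q))
      fun x => ¬ Λ x.2.2 :=
    supportedOn_swapLegs fun s => by by_cases h : Λ s.2 <;> simp [movedOn, h]
  have sB : SupportedOn (centredGate N θ (gateOn Λ u)) fun x => Λ x.2.2 :=
    supportedOn_centredGate fun i e h => if_neg h
  have sB' : SupportedOn (centredGate N θ (gateOn (fun e => ¬ Λ e) u)) fun x => ¬ Λ x.2.2 :=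
    supportedOn_centredGate fun i e h => if_neg h
  have c1 := sB.commute sC fun q h h' => h' h
  have c2 := sA.commute (sC.mul sB') fun q h h' => h' h
  rw [moveGate, hA, hB, hC, moveGate, moveGate]
  simp only [Matrix.mul_assoc] at c1 c2 ⊢
  rw [← Matrix.mul_assoc (swapLegs (centred N n R θ) (movedOn (fun e => ¬ Λ e) θ q)), ← c1,
    Matrix.mul_assoc]
  congr 2
  simp only [← Matrix.mul_assoc] at c2 ⊢
  rw [c2]

end Factor

theorem supportedOn_moveGate {p q : Slot n R → ZMod N}
    {u : Leg R → Matrix (Reg (Fin n)) (Reg (Fin n)) ℂ} {P : ZMod N → Prop}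
    (hp : ∀ s, p s = centred N n R θ s ∨ P (p s) ∧ P (centred N n R θ s))
    (hq : ∀ s, centred N n R θ s = q s ∨ P (centred N n R θ s) ∧ P (q s))
    (hu : ∀ e, ¬ P (legSite N θ 0 e) → u e = 1) :
    SupportedOn (moveGate θ p q u) fun x => P x.1 :=
  ((supportedOn_swapLegs hq).mul (supportedOn_centredGate fun _ e h => hu e h)).mul
    (supportedOn_swapLegs hp)

/-- The interval of radius `2π/16` around `k` is inside `P`. -/
def conePart (P : ZMod N → Prop) (k : ZMod N) : Prop :=
  ∀ j, angDist j k < 2 * Real.pi / 16 → P j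

theorem supportedOn_moveGate_of_cone {p q : Slot n R → ZMod N}
    {u : Leg R → Matrix (Reg (Fin n)) (Reg (Fin n)) ℂ} {P : ZMod N → Prop} {Λ : Leg R → Prop}
    (hΛ : ∀ e, Λ e → conePart P (legSite N θ 0 e))
    (hp : ∀ s, p s = centred N n R θ s ∨
      Λ s.2 ∧ angDist (p s) (centred N n R θ s) < 2 * Real.pi / 16)
    (hq : ∀ s, q s = centred N n R θ s ∨
      Λ s.2 ∧ angDist (centred N n R θ s) (q s) < 2 * Real.pi / 16)
    (hu : ∀ e, ¬ Λ e → u e = 1) :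
    SupportedOn (moveGate θ p q u) fun x => P x.1 := by
  have hself : ∀ e, Λ e → P (legSite N θ 0 e) := fun e he => hΛ e he _ <| by
    rw [angDist_self]; positivity
  refine supportedOn_moveGate (fun s => (hp s).imp_right fun h => ⟨hΛ _ h.1 _ h.2, hself _ h.1⟩)
    (fun s => ?_) fun e he => hu e fun h => he (hself e h)
  rcases hq s with h | h
  · exact Or.inl h.symm
  · refine Or.inr ⟨hself _ h.1, hΛ _ h.1 _ ?_⟩
    rw [angDist_comm]
    exact h.2

/-- The dynamics is a product of unitaries localized in the four half circles. -/
theorem exists_localized_factors {p q : Slot n R → ZMod N}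
    {u : Leg R → Matrix (Reg (Fin n)) (Reg (Fin n)) ℂ}
    (hu : ∀ e, u e ∈ unitaryGroup (Reg (Fin n)) ℂ)
    (hp : ∀ t, angDist (p t) (centred N n R θ t) < 2 * Real.pi / 16)
    (hq : ∀ t, angDist (centred N n R θ t) (q t) < 2 * Real.pi / 16)
    (hcone : ∀ k : ZMod N, conePart north k ∨ conePart south k ∨ conePart west k ∨
      conePart east k) :
    ∃ A B C D : Matrix (Reg (ZMod N × Slot n R)) (Reg (ZMod N × Slot n R)) ℂ,
      (A ∈ unitaryGroup _ ℂ ∧ SupportedOn A fun x => north x.1) ∧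
      (B ∈ unitaryGroup _ ℂ ∧ SupportedOn B fun x => south x.1) ∧
      (C ∈ unitaryGroup _ ℂ ∧ SupportedOn C fun x => west x.1) ∧
      (D ∈ unitaryGroup _ ℂ ∧ SupportedOn D fun x => east x.1) ∧
      moveGate θ p q u = A * B * C * D := by
  classical
  have hgate : ∀ (Λ : Leg R → Prop) [DecidablePred Λ] {v : Leg R → Matrix _ _ ℂ},
      (∀ e, v e ∈ unitaryGroup (Reg (Fin n)) ℂ) →
      ∀ e, gateOn Λ v e ∈ unitaryGroup (Reg (Fin n)) ℂ := by
    intro Λ _ v hv e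
    unfold gateOn
    split_ifs
    exacts [hv e, one_mem _]
  have h1 := moveGate_factor (θ := θ) (fun e => conePart north (legSite N θ 0 e)) p q u
  have h2 := moveGate_factor (θ := θ) (fun e => conePart south (legSite N θ 0 e))
    (movedOn (fun e => ¬ conePart north (legSite N θ 0 e)) θ p)
    (movedOn (fun e => ¬ conePart north (legSite N θ 0 e)) θ q)
    (gateOn (fun e => ¬ conePart north (legSite N θ 0 e)) u)
  have h3 := moveGate_factor (θ := θ) (fun e => conePart west (legSite N θ 0 e))
    (movedOn (fun e => ¬ conePart south (legSite N θ 0 e)) θ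
      (movedOn (fun e => ¬ conePart north (legSite N θ 0 e)) θ p))
    (movedOn (fun e => ¬ conePart south (legSite N θ 0 e)) θ
      (movedOn (fun e => ¬ conePart north (legSite N θ 0 e)) θ q))
    (gateOn (fun e => ¬ conePart south (legSite N θ 0 e))
      (gateOn (fun e => ¬ conePart north (legSite N θ 0 e)) u))
  rw [h3, ← Matrix.mul_assoc] at h2
  rw [h2, ← Matrix.mul_assoc, ← Matrix.mul_assoc] at h1
  refine ⟨_, _, _, _, ⟨moveGate_mem_unitary _ _ (hgate _ hu), ?_⟩,
    ⟨moveGate_mem_unitary _ _ (hgate _ (hgate _ hu)), ?_⟩,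
    ⟨moveGate_mem_unitary _ _ (hgate _ (hgate _ (hgate _ hu))), ?_⟩,
    ⟨moveGate_mem_unitary _ _ (hgate _ (hgate _ (hgate _ hu))), ?_⟩, h1⟩
  · refine supportedOn_moveGate_of_cone (Λ := fun e => conePart north (legSite N θ 0 e))
      (fun e h => h) (fun s => ?_) (fun s => ?_) fun e h => if_neg h
    · by_cases h : conePart north (legSite N θ 0 s.2) <;> simp [movedOn, h, hp s]
    · by_cases h : conePart north (legSite N θ 0 s.2) <;> simp [movedOn, h, hq s]
  · refine supportedOn_moveGate_of_cone (Λ := fun e => conePart south (legSite N θ 0 e))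
      (fun e h => h) (fun s => ?_) (fun s => ?_) fun e h => if_neg h
    · by_cases h : conePart north (legSite N θ 0 s.2) <;>
      by_cases h' : conePart south (legSite N θ 0 s.2) <;> simp [movedOn, h, h', hp s]
    · by_cases h : conePart north (legSite N θ 0 s.2) <;>
      by_cases h' : conePart south (legSite N θ 0 s.2) <;> simp [movedOn, h, h', hq s]
  · refine supportedOn_moveGate_of_cone (Λ := fun e => conePart west (legSite N θ 0 e))
      (fun e h => h) (fun s => ?_) (fun s => ?_) fun e h => if_neg h
    · by_cases h : conePart north (legSite N θ 0 s.2) <;>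
      by_cases h' : conePart south (legSite N θ 0 s.2) <;>
      by_cases h'' : conePart west (legSite N θ 0 s.2) <;> simp [movedOn, h, h', h'', hp s]
    · by_cases h : conePart north (legSite N θ 0 s.2) <;>
      by_cases h' : conePart south (legSite N θ 0 s.2) <;>
      by_cases h'' : conePart west (legSite N θ 0 s.2) <;> simp [movedOn, h, h', h'', hq s]
  · have h4 : ∀ e : Leg R, ¬ conePart north (legSite N θ 0 e) → ¬ conePart south (legSite N θ 0 e) →
        ¬ conePart west (legSite N θ 0 e) → conePart east (legSite N θ 0 e) := fun e h h' h'' =>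
      (((hcone _).resolve_left h).resolve_left h').resolve_left h''
    refine supportedOn_moveGate_of_cone (Λ := fun e => conePart east (legSite N θ 0 e))
      (fun e h => h) (fun s => ?_) (fun s => ?_) fun e h => ?_
    · by_cases h : conePart north (legSite N θ 0 s.2) <;>
      by_cases h' : conePart south (legSite N θ 0 s.2) <;>
      by_cases h'' : conePart west (legSite N θ 0 s.2) <;>
        simp [movedOn, h, h', h'', hp s, h4 s.2]
    · by_cases h : conePart north (legSite N θ 0 s.2) <;>
      by_cases h' : conePart south (legSite N θ 0 s.2) <;>
      by_cases h'' : conePart west (legSite N θ 0 s.2) <;>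
        simp [movedOn, h, h', h'', hq s, h4 s.2]
    · by_cases h1 : conePart north (legSite N θ 0 e)
      · simp [gateOn, h1]
      · by_cases h2 : conePart south (legSite N θ 0 e)
        · simp [gateOn, h2]
        · by_cases h3 : conePart west (legSite N θ 0 e)
          · simp [gateOn, h3]
          · exact absurd (h4 e h1 h2 h3) h

end Dynamics

section RegionOps

variable {N : ℕ} [NeZero N] {F : Type} [Fintype F] [DecidableEq F]

/-- The qubits of a region among all qubits. -/
def regionQubit (P : ZMod N → Prop) (F : Type) (q : {k : ZMod N // P k} × F) : ZMod N × F :=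
  (q.1.1, q.2)

theorem regionQubit_injective (P : ZMod N → Prop) : Function.Injective (regionQubit P F) :=
  fun _ _ h => Prod.ext (Subtype.ext (congrArg Prod.fst h)) (congrArg Prod.snd h :)

theorem mem_range_regionQubit {P : ZMod N → Prop} (q : ZMod N × F) :
    q ∈ Set.range (regionQubit P F) ↔ P q.1 :=
  ⟨fun ⟨s, hs⟩ => by rw [← hs]; exact s.1.2, fun h => ⟨(⟨q.1, h⟩, q.2), rfl⟩⟩

theorem regionOp_eq (P : ZMod N → Prop) [DecidablePred P]
    (M : Matrix (RegionReg P F) (RegionReg P F) ℂ) : regionOp P M = emb (regionQubit P F) M := by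
  ext x y
  have h : (∀ q, q ∉ Set.range (regionQubit P F) → x q = y q) ↔ ∀ q, ¬ P q.1 → x q = y q := by
    simp only [mem_range_regionQubit]
  unfold regionOp emb
  by_cases h' : ∀ q, ¬ P q.1 → x q = y q
  · rw [if_pos h', if_pos (h.2 h')]
    rfl
  · rw [if_neg h', if_neg fun h'' => h' (h.1 h'')]

theorem emb_injective {σ ι : Type} {j : σ → ι} (hj : Function.Injective j) :
    Function.Injective (emb j) := by
  intro M M' h
  have key : ∀ (M : Matrix (Reg σ) (Reg σ) ℂ) (a b : Reg σ),
      emb j M (Function.extend j a 0) (Function.extend j b 0) = M a b := by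
    intro M a b
    unfold emb
    rw [if_pos fun q hq => by
      rw [Function.extend_apply' _ _ _ hq, Function.extend_apply' _ _ _ hq]]
    exact congrArg₂ M (Function.extend_comp hj a 0) (Function.extend_comp hj b 0)
  ext a b
  rw [← key M, h, key]

theorem exists_regionOp {P : ZMod N → Prop} [DecidablePred P]
    {A : Matrix (Reg (ZMod N × F)) (Reg (ZMod N × F)) ℂ} (hA : A ∈ unitaryGroup _ ℂ)
    (hs : SupportedOn A fun q => P q.1) :
    ∃ M ∈ unitaryGroup (RegionReg P F) ℂ, regionOp P M = A := by
  have hj := regionQubit_injective (F := F) P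
  have h := emb_restrictTo hj hs fun q hq => (mem_range_regionQubit q).2 hq
  refine ⟨restrictTo (regionQubit P F) A, ?_, by rw [regionOp_eq, h]⟩
  rw [mem_unitaryGroup_iff, star_eq_conjTranspose] at hA ⊢
  refine emb_injective hj ?_
  rw [emb_mul hj, emb_conjTranspose, h, hA, emb_one hj]

/-- The qubits of `S` in `S S'`. -/
def mainQubit (q : ZMod N × F) : ZMod N × (F × Bool) := (q.1, (q.2, false))

theorem mainQubit_injective : Function.Injective (mainQubit (N := N) (F := F)) := by
  rintro ⟨k, f⟩ ⟨k', f'⟩ h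
  simpa [mainQubit] using h

theorem emb_mainQubit (U : Matrix (Reg (ZMod N × F)) (Reg (ZMod N × F)) ℂ) :
    emb mainQubit U = onBoth U 1 := by
  ext x y
  have h : (∀ q, q ∉ Set.range (mainQubit (N := N) (F := F)) → x q = y q) ↔
      (fun q : ZMod N × F => x (q.1, (q.2, true))) = fun q => y (q.1, (q.2, true)) := by
    rw [funext_iff]
    constructor
    · intro h q
      exact h _ fun ⟨s, hs⟩ => by simp [mainQubit] at hs
    · rintro h ⟨k, f, b⟩ hq
      cases b
      · exact absurd ⟨(k, f), rfl⟩ hq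
      · exact h (k, f)
  unfold emb onBoth
  rw [one_apply]
  by_cases h' : (fun q : ZMod N × F => x (q.1, (q.2, true))) = fun q => y (q.1, (q.2, true))
  · rw [if_pos (h.2 h'), if_pos h', mul_one]
    rfl
  · rw [if_neg fun h'' => h' (h.1 h''), if_neg h', mul_zero]

theorem exists_regionOp_main {P : ZMod N → Prop} [DecidablePred P]
    {A : Matrix (Reg (ZMod N × F)) (Reg (ZMod N × F)) ℂ} (hA : A ∈ unitaryGroup _ ℂ)
    (hs : SupportedOn A fun q => P q.1) :
    ∃ M ∈ unitaryGroup (RegionReg P (F × Bool)) ℂ, regionOp P M = emb mainQubit A :=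
  exists_regionOp (emb_mem_unitary mainQubit_injective hA)
    ((supportedOn_emb mainQubit_injective hs).mono fun _ ⟨_, h, hP⟩ => h ▸ hP)

end RegionOps

/-! ### Logical qubits inside a register -/

section Logical

variable {ι S T : Type} [Fintype ι] [DecidableEq ι] [Fintype S] [DecidableEq S]
  [Fintype T] [DecidableEq T]

/-- The parities of a word with the words `p i`. -/
def syn (p : ι → Reg S) (x : Reg S) : Reg ι := fun i => p i ⬝ᵥ x

/-- The linear combination of the words `p i`. -/
def comb (p : ι → Reg S) (z : Reg ι) : Reg S := ∑ i, z i • p i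

/-- The word with the values `z i` at the positions `t i`. -/
def lift (t : ι → T) (z : Reg ι) : Reg T := comb (fun i => Pi.single (t i) 1) z

theorem comb_apply (p : ι → Reg S) (z : Reg ι) (s : S) : comb p z s = ∑ i, z i * p i s := by
  simp [comb, Finset.sum_apply]

theorem comb_add (p : ι → Reg S) (z w : Reg ι) : comb p (z + w) = comb p z + comb p w := by
  simp [comb, add_smul, Finset.sum_add_distrib]

theorem syn_add (p : ι → Reg S) (x y : Reg S) : syn p (x + y) = syn p x + syn p y :=
  funext fun i => dotProduct_add (p i) x y

theorem lift_apply {t : ι → T} (ht : Function.Injective t) (z : Reg ι) (i : ι) :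
    lift t z (t i) = z i := by
  rw [lift, comb_apply, Finset.sum_eq_single i]
  · simp
  · intro j _ hj
    simp [ht.ne hj.symm]
  · simp

theorem lift_apply_of_notMem {t : ι → T} (z : Reg ι) {τ : T} (hτ : τ ∉ Set.range t) :
    lift t z τ = 0 := by
  rw [lift, comb_apply]
  refine Finset.sum_eq_zero fun j _ => ?_
  rw [Pi.single_eq_of_ne fun h => hτ ⟨j, h.symm⟩, mul_zero]

/-- The words `p i` are orthonormal. -/
def Orthonormal₂ (p : ι → Reg S) : Prop := ∀ i j, p i ⬝ᵥ p j = if i = j then 1 else 0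

theorem Orthonormal₂.syn_comb {p : ι → Reg S} (hp : Orthonormal₂ p) (z : Reg ι) :
    syn p (comb p z) = z := by
  funext i
  rw [syn, comb, dotProduct_sum]
  simp [hp i]

/-- The words `p i` give both logical operators of the bulk qubits `t i` under the encoding `W`. -/
structure IsLogical (W : Matrix (Reg S) (Reg T) ℂ) (p : ι → Reg S) (t : ι → T) : Prop where
  orth : Orthonormal₂ p
  inj : Function.Injective t
  shift : ∀ i x b, W (x + p i) (b + Pi.single (t i) 1) = W x b
  eig : ∀ i x b, W x b ≠ 0 → p i ⬝ᵥ x = b (t i)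

variable {W : Matrix (Reg S) (Reg T) ℂ} {p : ι → Reg S} {t : ι → T}

theorem IsLogical.shift_comb (h : IsLogical W p t) (z : Reg ι) (x : Reg S) (b : Reg T) :
    W (x + comb p z) (b + lift t z) = W x b := by
  have key : ∀ s : Finset ι, ∀ x b, W (x + ∑ i ∈ s, z i • p i)
      (b + ∑ i ∈ s, z i • Pi.single (t i) 1) = W x b := by
    intro s
    induction s using Finset.induction_on with
    | empty => simp
    | insert i s hi ih =>
      intro x b
      rw [Finset.sum_insert hi, Finset.sum_insert hi, ← add_assoc, ← add_assoc, ih]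
      rcases zmod_two_cases (z i) with hz | hz
      · simp [hz]
      · rw [hz, one_smul, one_smul, h.shift]
  exact key Finset.univ x b

theorem IsLogical.shift_left (h : IsLogical W p t) (z : Reg ι) (x : Reg S) (b : Reg T) :
    W (x + comb p z) b = W x (b + lift t z) := by
  have := h.shift_comb z x (b + lift t z)
  rwa [reg_add_cancel] at this

theorem IsLogical.syn_eq (h : IsLogical W p t) {x : Reg S} {b : Reg T} (hW : W x b ≠ 0) :
    syn p x = b ∘ t := funext fun i => h.eig i x b hW

/-- The operator `O` transferred from the bulk qubits to the logical qubits. -/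
noncomputable def transfer (p : ι → Reg S) (t : ι → T) (O : Matrix (Reg T) (Reg T) ℂ) :
    Matrix (Reg S) (Reg S) ℂ := fun x y =>
  if x + comb p (syn p x) = y + comb p (syn p y) then O (lift t (syn p x)) (lift t (syn p y)) else 0

theorem transfer_conjTranspose (p : ι → Reg S) (t : ι → T) (O : Matrix (Reg T) (Reg T) ℂ) :
    (transfer p t O).conjTranspose = transfer p t O.conjTranspose := by
  ext x y
  simp only [transfer, conjTranspose_apply, apply_ite star, star_zero]
  exact if_congr eq_comm rfl rfl

theorem supportedOn_transfer {Q : S → Prop} (hQ : ∀ i s, p i s ≠ 0 → Q s)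
    (O : Matrix (Reg T) (Reg T) ℂ) : SupportedOn (transfer p t O) Q := by
  have hcomb : ∀ z s, ¬ Q s → comb p z s = 0 := fun z s hs => by
    rw [comb_apply]
    exact Finset.sum_eq_zero fun i _ => by
      rw [show p i s = 0 from by_contra fun h => hs (hQ i s h), mul_zero]
  constructor
  · rintro x y ⟨s, hs, hne⟩
    refine if_neg fun h => hne ?_
    have := congrFun h s
    rwa [Pi.add_apply, Pi.add_apply, hcomb _ s hs, hcomb _ s hs, add_zero, add_zero] at this
  · intro x y x' y' h h'
    have hsyn : ∀ x x' : Reg S, (∀ s, Q s → x s = x' s) → syn p x = syn p x' := by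
      intro x x' hx
      refine funext fun i => Finset.sum_congr rfl fun s _ => ?_
      by_cases hs : Q s
      · rw [hx s hs]
      · rw [show p i s = 0 from by_contra fun h => hs (hQ i s h), zero_mul, zero_mul]
    unfold transfer
    rw [hsyn x x' fun s hs => (h s hs).1, hsyn y y' fun s hs => (h s hs).2]
    refine if_congr ?_ rfl rfl
    simp only [funext_iff, Pi.add_apply]
    refine forall_congr' fun s => ?_
    by_cases hs : Q s
    · rw [(h s hs).1, (h s hs).2]
    · rw [hcomb _ s hs, hcomb _ s hs, add_zero, add_zero, add_zero, add_zero]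
      exact iff_of_true (h' s hs).1 (h' s hs).2

theorem IsLogical.transfer_mul (h : IsLogical W p t) {P : T → Prop} (hP : ∀ τ, P τ → τ ∈ Set.range t)
    {O : Matrix (Reg T) (Reg T) ℂ} (hO : SupportedOn O P) : transfer p t O * W = W * O := by
  have hO := hO.mono hP
  ext x b
  rw [mul_apply, mul_apply, Finset.sum_eq_single (x + comb p (syn p x + b ∘ t)),
    Finset.sum_eq_single (b + lift t (syn p x + b ∘ t)), ← h.shift_left, mul_comm]
  · by_cases hW : W (x + comb p (syn p x + b ∘ t)) b = 0
    · rw [hW, zero_mul, zero_mul]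
    · have hs := h.syn_eq hW
      rw [transfer, hs, if_pos (by rw [comb_add, ← add_assoc, reg_add_cancel])]
      congr 1
      refine hO.2 _ _ _ _ ?_ ?_
      · rintro _ ⟨i, rfl⟩
        simp only [Pi.add_apply, lift_apply h.inj, Function.comp, and_true]
        rw [add_left_comm, CharTwo.add_self_eq_zero, add_zero]
      · intro τ hτ
        simp only [Pi.add_apply, lift_apply_of_notMem _ hτ, add_zero, and_self]
  · intro b' _ hb'
    by_cases hW : W x b' = 0
    · rw [hW, zero_mul]
    · rw [hO.1, mul_zero]
      by_contra! hc
      refine hb' (funext fun τ => ?_)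
      by_cases hτ : τ ∈ Set.range t
      · obtain ⟨i, rfl⟩ := hτ
        rw [Pi.add_apply, lift_apply h.inj, h.syn_eq hW, Pi.add_apply, Function.comp, Function.comp,
          add_left_comm, CharTwo.add_self_eq_zero, add_zero]
      · rw [Pi.add_apply, lift_apply_of_notMem _ hτ, add_zero]
        exact hc τ hτ
  · simp
  · intro y _ hy
    by_cases hW : W y b = 0
    · rw [hW, mul_zero]
    · rw [transfer, if_neg, zero_mul]
      rw [h.syn_eq hW]
      intro hc
      refine hy ?_
      rw [comb_add, ← add_assoc, hc, reg_add_cancel]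
  · simp

theorem IsLogical.recoverable (h : IsLogical W p t) {P : T → Prop} {Q : S → Prop}
    (hP : ∀ τ, P τ → τ ∈ Set.range t) (hQ : ∀ i s, p i s ≠ 0 → Q s) : Recoverable W P Q :=
  fun O hO => ⟨transfer p t O, supportedOn_transfer hQ O, h.transfer_mul hP hO, by
    rw [transfer_conjTranspose]
    exact h.transfer_mul hP hO.conjTranspose⟩

theorem IsLogical.comp {ι' : Type} [Fintype ι'] [DecidableEq ι'] (h : IsLogical W p t) {f : ι' → ι}
    (hf : Function.Injective f) : IsLogical W (p ∘ f) (t ∘ f) :=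
  ⟨fun i j => (h.orth (f i) (f j)).trans (if_congr hf.eq_iff rfl rfl), h.inj.comp hf,
    fun i => h.shift (f i), fun i => h.eig (f i)⟩

/-! ### Encoding into and decoding from logical qubits -/

/-- Kraus operators of the channel that writes a register into the logical qubits. -/
noncomputable def encOp (p : ι → Reg S) (w : Reg ι) : Matrix (Reg S) (Reg ι × Reg S) ℂ :=
  fun x a => if syn p a.2 = w ∧ x = a.2 + comb p (w + a.1) then 1 else 0

/-- Kraus operators of the channel that reads the logical qubits. -/
noncomputable def decOp (p : ι → Reg S) (d : {d : Reg S // syn p d = 0}) :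
    Matrix (Reg ι) (Reg S) ℂ :=
  (fmat fun z => d.1 + comb p z).conjTranspose

theorem sum_encOp (hp : Orthonormal₂ p) :
    ∑ w, (encOp p w).conjTranspose * encOp p w = 1 := by
  ext ⟨a, y⟩ ⟨a', y'⟩
  rw [Matrix.sum_apply, Finset.sum_eq_single (syn p y), mul_apply,
    Finset.sum_eq_single (y + comb p (syn p y + a)), conjTranspose_apply, encOp, if_pos ⟨rfl, rfl⟩,
    star_one, one_mul, encOp, one_apply]
  · refine if_congr ⟨?_, ?_⟩ rfl rfl
    · rintro ⟨h1, h2⟩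
      have h3 := congrArg (syn p) h2
      rw [syn_add, syn_add, hp.syn_comb, hp.syn_comb, h1] at h3
      have h4 : a = a' := add_left_cancel (add_left_cancel h3)
      rw [h4] at h2 ⊢
      rw [add_right_cancel h2]
    · intro h
      rw [Prod.mk.injEq] at h
      rw [h.1, h.2]
      exact ⟨rfl, rfl⟩
  · intro x _ hx
    rw [conjTranspose_apply, encOp, if_neg fun h => hx h.2, star_zero, zero_mul]
  · simp
  · intro w _ hw
    rw [mul_apply]
    refine Finset.sum_eq_zero fun x _ => ?_
    rw [conjTranspose_apply, encOp, if_neg fun h => hw h.1.symm, star_zero, zero_mul]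
  · simp

theorem sum_decOp (hp : Orthonormal₂ p) :
    ∑ d, (decOp p d).conjTranspose * decOp p d = 1 := by
  ext x y
  have h0 : syn p (x + comb p (syn p x)) = 0 := by
    rw [syn_add, hp.syn_comb, reg_add_self]
  have hz : ∀ (d : {d : Reg S // syn p d = 0}) z, x = d.1 + comb p z →
      z = syn p x ∧ d.1 = x + comb p (syn p x) := by
    rintro d z h
    have : z = syn p x := by rw [h, syn_add, hp.syn_comb, d.2, zero_add]
    refine ⟨this, ?_⟩
    rw [← this, h, reg_add_cancel]
  have hx : x = x + comb p (syn p x) + comb p (syn p x) := (reg_add_cancel _ _).symm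
  rw [Matrix.sum_apply, Finset.sum_eq_single ⟨x + comb p (syn p x), h0⟩, mul_apply,
    Finset.sum_eq_single (syn p x)]
  · rw [decOp, conjTranspose_conjTranspose, conjTranspose_apply, fmat_apply, fmat_apply, if_pos hx, one_mul,
      one_apply, apply_ite star, star_one, star_zero]
    dsimp only
    rw [← hx]
    exact if_congr eq_comm rfl rfl
  · intro z _ hzx
    rw [decOp, conjTranspose_conjTranspose, fmat, if_neg fun h => hzx (hz _ z h).1, zero_mul]
  · simp
  · intro d _ hd
    rw [mul_apply]
    refine Finset.sum_eq_zero fun z _ => ?_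
    rw [decOp, conjTranspose_conjTranspose, fmat, if_neg fun h => hd (Subtype.ext (hz d z h).2),
      zero_mul]
  · simp

end Logical

/-! ### Complementary regions, and the pseudo-bulk dynamics -/

section Regions

variable {N : ℕ} [NeZero N] {F : Type} [Fintype F] [DecidableEq F]
  {P P' : ZMod N → Prop} [DecidablePred P] [DecidablePred P']

/-- Restriction of a basis label to two regions. -/
def splitMap (P P' : ZMod N → Prop) (x : Reg (ZMod N × F)) : RegionReg P F × RegionReg P' F :=
  (restr P x, restr P' x)

theorem split_eq : split P P' = fmat (splitMap (F := F) P P') := by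
  ext a x
  exact (fmat_apply _ _ _).symm

theorem splitMap_bijective (hc : ∀ k, P' k ↔ ¬ P k) :
    Function.Bijective (splitMap (F := F) P P') := by
  constructor
  · intro x y h
    funext q
    by_cases hq : P q.1
    · exact congrFun (congrArg Prod.fst h) (⟨q.1, hq⟩, q.2)
    · exact congrFun (congrArg Prod.snd h) (⟨q.1, (hc _).2 hq⟩, q.2)
  · intro a
    refine ⟨fun q => if h : P q.1 then a.1 (⟨q.1, h⟩, q.2) else a.2 (⟨q.1, (hc _).2 h⟩, q.2), ?_⟩
    refine Prod.ext (funext fun q => ?_) (funext fun q => ?_)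
    · exact dif_pos q.1.2
    · exact dif_neg ((hc _).1 q.1.2)

theorem fmat_mul_apply_of_injective {X Y Z : Type} [Fintype X] [DecidableEq X] [Fintype Y]
    [DecidableEq Y] {f : X → Y} (hf : Function.Injective f) (M : Matrix X Z ℂ) (x : X) (z : Z) :
    (fmat f * M) (f x) z = M x z := by
  rw [mul_apply, Finset.sum_eq_single x]
  · rw [fmat, if_pos rfl, one_mul]
  · intro w _ hw
    rw [fmat, if_neg fun h => hw (hf h).symm, zero_mul]
  · simp

theorem fmat_mulVec_apply_of_injective {X Y : Type} [Fintype X] [DecidableEq X] [Fintype Y]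
    [DecidableEq Y] {f : X → Y} (hf : Function.Injective f) (v : X → ℂ) (x : X) : (fmat f).mulVec v (f x) = v x := by
  change ∑ w, fmat f (f x) w * v w = v x
  rw [Finset.sum_eq_single x]
  · rw [fmat, if_pos rfl, one_mul]
  · intro w _ hw
    rw [fmat, if_neg fun h => hw (hf h).symm, zero_mul]
  · simp

theorem splitMap_add (x y : Reg (ZMod N × F)) :
    splitMap P P' (x + y) = splitMap P P' x + splitMap P P' y := rfl

theorem restr_dotProduct {f : Reg (ZMod N × F)} (hf : ∀ q, f q ≠ 0 → P q.1)
    (x : Reg (ZMod N × F)) : restr P f ⬝ᵥ restr P x = f ⬝ᵥ x := by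
  refine Finset.sum_of_injOn (regionQubit P F) (regionQubit_injective P).injOn
    (fun _ _ => Finset.mem_univ _) (fun q _ hq => ?_) fun q _ => rfl
  rw [show f q = 0 from by_contra fun h =>
    hq ⟨(⟨q.1, hf q h⟩, q.2), Finset.mem_coe.2 (Finset.mem_univ _), rfl⟩, zero_mul]

/-- Alice's and Bob's registers put together. -/
def joinReg {n : ℕ} (I : Finset (Fin n)) (a : Reg {i // i ∈ I} × Reg {i // i ∉ I}) : Reg (Fin n) :=
  (Equiv.piEquivPiSubtypeProd (fun i => i ∈ I) fun _ => ZMod 2).symm a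

theorem joinReg_mem {n : ℕ} (I : Finset (Fin n)) (a : Reg {i // i ∈ I} × Reg {i // i ∉ I})
    (i : {i // i ∈ I}) : joinReg I a i.1 = a.1 i := dif_pos i.2

theorem joinReg_notMem {n : ℕ} (I : Finset (Fin n)) (a : Reg {i // i ∈ I} × Reg {i // i ∉ I})
    (i : {i // i ∉ I}) : joinReg I a i.1 = a.2 i := dif_neg i.2

/-- The words `p i` with `i ∈ I` are supported in `P`, the others in `P'`. -/
structure SplitsOver {n : ℕ} (p : Fin n → Reg (ZMod N × F)) (I : Finset (Fin n))
    (P P' : ZMod N → Prop) : Prop where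
  mem : ∀ i ∈ I, ∀ q, p i q ≠ 0 → P q.1
  notMem : ∀ i ∉ I, ∀ q, p i q ≠ 0 → P' q.1

/-- The restrictions to `P` of some of the words `p i`. -/
def regFam {n : ℕ} {ι : Type} (P : ZMod N → Prop) (p : Fin n → Reg (ZMod N × F)) (f : ι → Fin n)
    (i : ι) : RegionReg P F := restr P (p (f i))

variable {n : ℕ} {I J : Finset (Fin n)} {p : Fin n → Reg (ZMod N × F)}

theorem Orthonormal₂.regFam {ι : Type} [DecidableEq ι] {f : ι → Fin n} (hf : Function.Injective f)
    (hp : Orthonormal₂ p) (hP : ∀ i q, p (f i) q ≠ 0 → P q.1) :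
    Orthonormal₂ (regFam P p f) := by
  intro i j
  rw [_root_.regFam, _root_.regFam, restr_dotProduct (hP i), hp]
  exact if_congr hf.eq_iff rfl rfl

theorem syn_regFam {ι : Type} {f : ι → Fin n} (hP : ∀ i q, p (f i) q ≠ 0 → P q.1)
    (x : Reg (ZMod N × F)) : syn (regFam P p f) (restr P x) = fun i => syn p x (f i) :=
  funext fun i => restr_dotProduct (hP i) x

theorem SplitsOver.splitMap_comb (hI : SplitsOver p I P P') (hc : ∀ k, P' k ↔ ¬ P k)
    (a : Reg {i // i ∈ I} × Reg {i // i ∉ I}) :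
    splitMap P P' (comb p (joinReg I a)) =
      (comb (regFam P p Subtype.val) a.1, comb (regFam P' p Subtype.val) a.2) := by
  refine Prod.ext (funext fun q => ?_) (funext fun q => ?_)
  · change comb p (joinReg I a) (q.1.1, q.2) = comb (regFam P p Subtype.val) a.1 q
    rw [comb_apply, comb_apply]
    refine (Finset.sum_of_injOn Subtype.val Subtype.val_injective.injOn
      (fun _ _ => Finset.mem_univ _) (fun i _ hi => ?_) fun i _ => ?_).symm
    · rw [show p i (q.1.1, q.2) = 0 from by_contra fun h => ?_, mul_zero]
      by_cases hiI : i ∈ I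
      · exact hi ⟨⟨i, hiI⟩, Finset.mem_coe.2 (Finset.mem_univ _), rfl⟩
      · exact (hc _).1 (hI.notMem i hiI _ h) q.1.2
    · rw [joinReg_mem]
      rfl
  · change comb p (joinReg I a) (q.1.1, q.2) = comb (regFam P' p Subtype.val) a.2 q
    rw [comb_apply, comb_apply]
    refine (Finset.sum_of_injOn Subtype.val Subtype.val_injective.injOn
      (fun _ _ => Finset.mem_univ _) (fun i _ hi => ?_) fun i _ => ?_).symm
    · rw [show p i (q.1.1, q.2) = 0 from by_contra fun h => ?_, mul_zero]
      by_cases hiI : i ∈ I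
      · exact (hc _).1 q.1.2 (hI.mem i hiI _ h)
      · exact hi ⟨⟨i, hiI⟩, Finset.mem_coe.2 (Finset.mem_univ _), rfl⟩
    · rw [joinReg_notMem]
      rfl

/-- The isometry that adds the resource state. -/
def resMat {A B RA RB : Type} [DecidableEq A] [DecidableEq B] (φ : RA × RB → ℂ) :
    Matrix ((A × RA) × (B × RB)) (A × B) ℂ :=
  fun x a => if x.1.1 = a.1 ∧ x.2.1 = a.2 then φ (x.1.2, x.2.2) else 0

theorem withResource_eq {A B RA RB : Type} [Fintype A] [DecidableEq A] [Fintype B] [DecidableEq B]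
    (φ : RA × RB → ℂ) (ρ : Matrix (A × B) (A × B) ℂ) :
    withResource φ ρ = conjBy (resMat φ) ρ := by
  ext x y
  have h : ∀ (x : (A × RA) × (B × RB)) (c : A × B), resMat φ x c =
      if c = (x.1.1, x.2.1) then φ (x.1.2, x.2.2) else 0 := fun x c =>
    if_congr (by rw [Prod.ext_iff, eq_comm (a := c.1), eq_comm (a := c.2)]) rfl rfl
  rw [conjBy, mul_apply, Finset.sum_eq_single (y.1.1, y.2.1), mul_apply,
    Finset.sum_eq_single (x.1.1, x.2.1), conjTranspose_apply, h, h, if_pos rfl, if_pos rfl,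
    withResource]
  · ring
  · intro c _ hc
    rw [h, if_neg hc, zero_mul]
  · simp
  · intro c _ hc
    rw [conjTranspose_apply, h, if_neg hc, star_zero, mul_zero]
  · simp

variable {T : Type} [Fintype T] [DecidableEq T] {t : Fin n → T}

theorem IsLogical.split_conjTranspose_mul_encOp {W : Matrix (Reg (ZMod N × F)) (Reg T) ℂ}
    (h : IsLogical W p t) (hI : SplitsOver p I P P') (hc : ∀ k, P' k ↔ ¬ P k)
    (w : Reg {i // i ∈ I}) (w' : Reg {i // i ∉ I}) :
    (split (F := F) P P').conjTranspose * (kroneckerMap (fun s t => s * t)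
      (encOp (regFam P p Subtype.val) w) (encOp (regFam P' p Subtype.val) w') *
        resMat (A := Reg {i // i ∈ I}) (B := Reg {i // i ∉ I}) ((split (F := F) P P').mulVec fun x => W x 0)) =
      if w = 0 ∧ w' = 0 then W * fmat fun a => lift t (joinReg I a) else 0 := by
  have hb := splitMap_bijective (F := F) hc
  have hin : ∀ (i : {i // i ∈ I}) q, p i.1 q ≠ 0 → P q.1 := fun i => hI.mem i.1 i.2
  have hout : ∀ (i : {i // i ∉ I}) q, p i.1 q ≠ 0 → P' q.1 := fun i => hI.notMem i.1 i.2
  ext x ⟨a, a'⟩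
  set y := x + comb p (joinReg I (w + a, w' + a')) with hy
  have hsplit : splitMap P P' y = (restr P x + comb (regFam P p Subtype.val) (w + a),
      restr P' x + comb (regFam P' p Subtype.val) (w' + a')) := by
    rw [hy, splitMap_add, hI.splitMap_comb hc]
    rfl
  have h1 : restr P y = _ := congrArg Prod.fst hsplit
  have h2 : restr P' y = _ := congrArg Prod.snd hsplit
  rw [split_eq, fmat_conjTranspose_mul_apply, mul_apply,
    Finset.sum_eq_single ((a, restr P y), (a', restr P' y))]
  · rw [resMat, if_pos ⟨rfl, rfl⟩, kroneckerMap_apply]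
    dsimp only
    rw [show (restr P y, restr P' y) = splitMap P P' y from rfl,
      fmat_mulVec_apply_of_injective hb.1, encOp, encOp]
    dsimp only
    rw [syn_regFam hin, syn_regFam hout]
    have hx1 : restr P x = restr P y + comb (regFam P p Subtype.val) (w + a) := by
      rw [h1, reg_add_cancel]
    have hx2 : restr P' x = restr P' y + comb (regFam P' p Subtype.val) (w' + a') := by
      rw [h2, reg_add_cancel]
    by_cases hψ : W y 0 = 0
    · rw [hψ, mul_zero]
      split_ifs with hw
      · rw [mul_fmat_apply, ← zero_add (lift t _), ← h.shift_left]
        rw [hy, hw.1, hw.2, zero_add, zero_add] at hψ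
        exact hψ.symm
      · rfl
    · have hsyn : syn p y = 0 := h.syn_eq hψ
      by_cases hw : w = 0 ∧ w' = 0
      · rw [if_pos hw, if_pos, if_pos, one_mul, one_mul, mul_fmat_apply, ← zero_add (lift t _),
          ← h.shift_left, hy, hw.1, hw.2, zero_add, zero_add]
        · exact ⟨by rw [hsyn, hw.2]; rfl, hx2⟩
        · exact ⟨by rw [hsyn, hw.1]; rfl, hx1⟩
      · rw [if_neg hw]
        by_cases hw1 : w = 0
        · rw [mul_comm (ite _ _ _) (ite _ _ _), if_neg, zero_mul, zero_mul]
          · rfl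
          · exact fun h' => hw ⟨hw1, by rw [← h'.1, hsyn]; rfl⟩
        · rw [if_neg, zero_mul, zero_mul]
          · rfl
          · exact fun h' => hw1 (by rw [← h'.1, hsyn]; rfl)
  · rintro ⟨⟨b, r⟩, ⟨b', r'⟩⟩ _ hne
    rw [resMat]
    split_ifs with hbb
    · obtain ⟨rfl, rfl⟩ : b = a ∧ b' = a' := hbb
      rw [kroneckerMap_apply, encOp, encOp]
      by_cases hr : restr P x = r + comb (regFam P p Subtype.val) (w + b)
      · by_cases hr' : restr P' x = r' + comb (regFam P' p Subtype.val) (w' + b')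
        · refine absurd ?_ hne
          rw [h1, h2, hr, hr', reg_add_cancel, reg_add_cancel]
        · rw [mul_comm (ite _ _ _) (ite _ _ _), if_neg fun h => hr' h.2, zero_mul, zero_mul]
      · rw [if_neg fun h => hr h.2, zero_mul, zero_mul]
    · rw [mul_zero]
  · simp

/-- The two labels put together. -/
noncomputable def joinSplit (hc : ∀ k, P' k ↔ ¬ P k) (a : RegionReg P F × RegionReg P' F) :
    Reg (ZMod N × F) := (Equiv.ofBijective _ (splitMap_bijective hc)).symm a

theorem splitMap_joinSplit (hc : ∀ k, P' k ↔ ¬ P k) (a : RegionReg P F × RegionReg P' F) :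
    splitMap P P' (joinSplit hc a) = a :=
  (Equiv.ofBijective _ (splitMap_bijective hc)).apply_symm_apply a

theorem IsLogical.decOp_mul_split {W : Matrix (Reg (ZMod N × F)) (Reg T) ℂ}
    (h : IsLogical W p t) (hI : SplitsOver p I P P') (hc : ∀ k, P' k ↔ ¬ P k)
    (d : {d // syn (regFam P p (Subtype.val : {i // i ∈ I} → Fin n)) d = 0})
    (d' : {d // syn (regFam P' p (Subtype.val : {i // i ∉ I} → Fin n)) d = 0})
    (z : Reg {i // i ∈ I} × Reg {i // i ∉ I}) (b : Reg T) :
    (kroneckerMap (fun s t => s * t) (decOp _ d) (decOp _ d') * (split (F := F) P P' * W)) z b =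
      W (joinSplit hc (d.1, d'.1)) (b + lift t (joinReg I z)) := by
  have hk : kroneckerMap (fun s t => s * t) (decOp _ d) (decOp _ d') =
      (fmat (Prod.map (fun z => d.1 + comb (regFam P p Subtype.val) z)
        fun z => d'.1 + comb (regFam P' p Subtype.val) z)).conjTranspose := by
    rw [← kroneckerMap_fmat]
    exact (conjTranspose_kronecker _ _).symm
  have hs : Prod.map (fun z => d.1 + comb (regFam P p Subtype.val) z)
      (fun z => d'.1 + comb (regFam P' p Subtype.val) z) z =
      splitMap P P' (joinSplit hc (d.1, d'.1) + comb p (joinReg I z)) := by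
    rw [splitMap_add, splitMap_joinSplit, hI.splitMap_comb hc]
    rfl
  rw [hk, fmat_conjTranspose_mul_apply, hs, split_eq,
    fmat_mul_apply_of_injective (splitMap_bijective hc).1, h.shift_left]

end Regions

section Kronecker

variable {l m k l' m' k' : Type} [Fintype m] [Fintype m']

theorem kroneckerMap_mul_kroneckerMap (A : Matrix l m ℂ) (B : Matrix m k ℂ) (A' : Matrix l' m' ℂ)
    (B' : Matrix m' k' ℂ) : kroneckerMap (fun s t => s * t) (A * B) (A' * B') =
      kroneckerMap (fun s t => s * t) A A' * kroneckerMap (fun s t => s * t) B B' :=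
  mul_kronecker_mul A B A' B'

theorem kroneckerMap_conjTranspose (A : Matrix l m ℂ) (B : Matrix l' m' ℂ) :
    kroneckerMap (fun s t => s * t) A.conjTranspose B.conjTranspose =
      (kroneckerMap (fun s t => s * t) A B).conjTranspose :=
  (conjTranspose_kronecker A B).symm

end Kronecker

section Implementation

variable {N : ℕ} [NeZero N] {F T : Type} [Fintype F] [DecidableEq F] [Fintype T] [DecidableEq T]
  {P P' Q Q' : ZMod N → Prop} [DecidablePred P] [DecidablePred P'] [DecidablePred Q]
  [DecidablePred Q'] {n : ℕ} {I J : Finset (Fin n)} {p q : Fin n → Reg (ZMod N × F)}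
  {W₀ W₁ : Matrix (Reg (ZMod N × F)) (Reg (Fin n × T)) ℂ} {c : T}
  {G : Matrix (Reg (Fin n)) (Reg (Fin n)) ℂ} {U : Matrix (Reg (ZMod N × F)) (Reg (ZMod N × F)) ℂ}

theorem transversal_apply_lift (b : Reg (Fin n × T)) (hb : (b ∘ fun i => (i, c)) = 0)
    (z a : Reg (Fin n)) :
    transversal (fun _ : T => G) (b + lift (fun i => (i, c)) z) (lift (fun i => (i, c)) a) =
      G z a * transversal (fun τ : T => if τ = c then 1 else G) b 0 := by
  have hinj : Function.Injective fun i : Fin n => (i, c) := fun i j h => congrArg Prod.fst h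
  unfold transversal
  rw [← Finset.mul_prod_erase _ _ (Finset.mem_univ c),
    ← Finset.mul_prod_erase (a := c) _ (fun e => (if e = c then (1 : Matrix _ _ ℂ) else G) _ _)
      (Finset.mem_univ c)]
  have h1 : (fun i => (b + lift (fun i => (i, c)) z) (i, c)) = z := by
    funext i
    rw [Pi.add_apply, lift_apply hinj, show b (i, c) = 0 from congrFun hb i, zero_add]
  have h2 : (fun i => lift (fun i => (i, c)) a (i, c)) = a := funext fun i => lift_apply hinj a i
  have h3 : (fun i => b (i, c)) = fun i => (0 : Reg (Fin n × T)) (i, c) := funext fun i =>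
    congrFun hb i
  rw [h1, h2, if_pos rfl, h3, one_apply_eq, one_mul]
  congr 1
  refine Finset.prod_congr rfl fun τ hτ => ?_
  have hne := (Finset.mem_erase.1 hτ).1
  rw [if_neg hne]
  have h4 : ∀ (z : Reg (Fin n)) i, lift (fun i => (i, c)) z (i, τ) = 0 := fun z i =>
    lift_apply_of_notMem _ fun ⟨j, hj⟩ => hne (congrArg Prod.snd hj).symm
  refine congrArg₂ G (funext fun i => ?_) (funext fun i => h4 a i)
  rw [Pi.add_apply, h4, add_zero]

/-- The amplitude of the syndrome `g` when the central bulk qubits are `0` and the gate `G` has been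
applied to the bulk qubits of all other tiles. -/
noncomputable def amplitude (W₁ : Matrix (Reg (ZMod N × F)) (Reg (Fin n × T)) ℂ) (c : T)
    (G : Matrix (Reg (Fin n)) (Reg (Fin n)) ℂ) (g : Reg (ZMod N × F)) : ℂ :=
  (W₁ * transversal (fun τ : T => if τ = c then 1 else G)) g 0

theorem sum_amplitude (hiso : W₁.conjTranspose * W₁ = 1) (hG : G ∈ unitaryGroup (Reg (Fin n)) ℂ)
    (h : IsLogical W₁ q fun i => (i, c)) (hJ : SplitsOver q J Q Q') (hc : ∀ k, Q' k ↔ ¬ Q k) :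
    ∑ d : {d // syn (regFam Q q (Subtype.val : {i // i ∈ J} → Fin n)) d = 0},
      ∑ d' : {d // syn (regFam Q' q (Subtype.val : {i // i ∉ J} → Fin n)) d = 0},
        amplitude W₁ c G (joinSplit hc (d.1, d'.1)) *
          star (amplitude W₁ c G (joinSplit hc (d.1, d'.1))) = 1 := by
  set M := W₁ * transversal (fun τ : T => if τ = c then 1 else G) with hM
  have hMiso : M.conjTranspose * M = 1 := by
    have hu := mem_unitaryGroup_iff'.1 (transversal_mem_unitary
      (u := fun τ : T => if τ = c then 1 else G) fun τ => by
        split_ifs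
        exacts [one_mem _, hG])
    rw [star_eq_conjTranspose] at hu
    rw [hM, conjTranspose_mul, Matrix.mul_assoc, ← Matrix.mul_assoc _ W₁, hiso, Matrix.one_mul, hu]
  have hsum : ∑ x, M x 0 * star (M x 0) = 1 := by
    have := congrFun (congrFun hMiso 0) 0
    rw [mul_apply, one_apply_eq] at this
    rw [← this]
    exact Finset.sum_congr rfl fun x _ => mul_comm _ _
  rw [← hsum, ← Fintype.sum_prod_type']
  have hin : ∀ (i : {i // i ∈ J}) x, q i.1 x ≠ 0 → Q x.1 := fun i => hJ.mem i.1 i.2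
  have hout : ∀ (i : {i // i ∉ J}) x, q i.1 x ≠ 0 → Q' x.1 := fun i => hJ.notMem i.1 i.2
  refine Finset.sum_of_injOn (fun d => joinSplit hc (d.1.1, d.2.1)) ?_
    (fun _ _ => Finset.mem_univ _) (fun x _ hx => ?_) fun d _ => rfl
  · rintro ⟨d, d'⟩ _ ⟨e, e'⟩ _ hde
    have := congrArg (splitMap Q Q') hde
    dsimp only at this
    rw [splitMap_joinSplit, splitMap_joinSplit, Prod.mk.injEq] at this
    exact Prod.ext (Subtype.ext this.1) (Subtype.ext this.2)
  · rw [show M x 0 = 0 from ?_, zero_mul]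
    rw [hM, mul_apply]
    refine Finset.sum_eq_zero fun b _ => ?_
    by_cases hW : W₁ x b = 0
    · rw [hW, zero_mul]
    have hs := h.syn_eq hW
    by_cases hb : (b ∘ fun i => (i, c)) = 0
    · refine absurd ?_ hx
      rw [hb] at hs
      refine ⟨(⟨restr Q x, ?_⟩, ⟨restr Q' x, ?_⟩), Finset.mem_coe.2 (Finset.mem_univ _), ?_⟩
      · rw [syn_regFam hin, hs]; rfl
      · rw [syn_regFam hout, hs]; rfl
      · refine (splitMap_bijective hc).1 ?_
        dsimp only
        rw [splitMap_joinSplit]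
        rfl
    · rw [transversal, Finset.prod_eq_zero (Finset.mem_univ c), mul_zero]
      rw [if_pos rfl]
      exact one_apply_ne fun h' => hb (funext fun i => congrFun h' i)

open Classical in
/-- The factor of `G` in a Kraus operator of the pseudo-bulk dynamics. -/
noncomputable def krausCoeff {A B : Type} (W₁ : Matrix (Reg (ZMod N × F)) (Reg (Fin n × T)) ℂ)
    (c : T) (G : Matrix (Reg (Fin n)) (Reg (Fin n)) ℂ) (g : Reg (ZMod N × F)) (w : Reg A)
    (w' : Reg B) : ℂ :=
  if w = 0 ∧ w' = 0 then amplitude W₁ c G g else 0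

/-- The Kraus operators of the pseudo-bulk dynamics are multiples of `G`. -/
theorem kraus_eq_smul (h₀ : IsLogical W₀ p fun i => (i, c)) (hI : SplitsOver p I P P')
    (hc : ∀ k, P' k ↔ ¬ P k) (h₁ : IsLogical W₁ q fun i => (i, c)) (hJ : SplitsOver q J Q Q')
    (hc' : ∀ k, Q' k ↔ ¬ Q k) (hU : U * W₀ = W₁ * transversal (fun _ : T => G))
    (d : {d // syn (regFam Q q (Subtype.val : {i // i ∈ J} → Fin n)) d = 0})
    (d' : {d // syn (regFam Q' q (Subtype.val : {i // i ∉ J} → Fin n)) d = 0})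
    (w : Reg {i // i ∈ I}) (w' : Reg {i // i ∉ I}) :
    kroneckerMap (fun s t => s * t) (decOp _ d) (decOp _ d') * (split (F := F) Q Q' * (U *
      ((split (F := F) P P').conjTranspose * (kroneckerMap (fun s t => s * t)
        (encOp (regFam P p Subtype.val) w) (encOp (regFam P' p Subtype.val) w') *
          resMat (A := Reg {i // i ∈ I}) (B := Reg {i // i ∉ I})
            ((split (F := F) P P').mulVec fun x => W₀ x 0))))) =
      krausCoeff W₁ c G (joinSplit hc' (d.1, d'.1)) w w' • bipartite I J G := by
  unfold krausCoeff
  rw [h₀.split_conjTranspose_mul_encOp hI hc]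
  by_cases hw : w = 0 ∧ w' = 0
  · rw [if_pos hw, if_pos hw, ← Matrix.mul_assoc U, hU, Matrix.mul_assoc,
      ← Matrix.mul_assoc (split (F := F) Q Q'), ← Matrix.mul_assoc]
    ext z a
    rw [mul_apply, Matrix.smul_apply, smul_eq_mul]
    simp only [h₁.decOp_mul_split hJ hc', mul_fmat_apply]
    rw [← Equiv.sum_comp (Equiv.addRight (lift (fun i => (i, c)) (joinReg J z)))]
    rw [amplitude, mul_apply, Finset.sum_mul]
    refine Finset.sum_congr rfl fun b _ => ?_
    rw [Equiv.coe_addRight, reg_add_cancel]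
    by_cases hW : W₁ (joinSplit hc' (d.1, d'.1)) b = 0
    · rw [hW, zero_mul, zero_mul, zero_mul]
    · have hb : (b ∘ fun i => (i, c)) = 0 := by
        rw [← h₁.syn_eq hW]
        have hin : ∀ (i : {i // i ∈ J}) x, q i.1 x ≠ 0 → Q x.1 := fun i => hJ.mem i.1 i.2
        have hout : ∀ (i : {i // i ∉ J}) x, q i.1 x ≠ 0 → Q' x.1 := fun i => hJ.notMem i.1 i.2
        have hsp := splitMap_joinSplit hc' (d.1, d'.1)
        have e1 := syn_regFam hin (joinSplit hc' (d.1, d'.1))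
        have e2 := syn_regFam hout (joinSplit hc' (d.1, d'.1))
        rw [show restr Q (joinSplit hc' (d.1, d'.1)) = d.1 from congrArg Prod.fst hsp, d.2] at e1
        rw [show restr Q' (joinSplit hc' (d.1, d'.1)) = d'.1 from congrArg Prod.snd hsp, d'.2] at e2
        funext i
        by_cases hi : i ∈ J
        · exact (congrFun e1 ⟨i, hi⟩).symm
        · exact (congrFun e2 ⟨i, hi⟩).symm
      rw [transversal_apply_lift b hb]
      have : bipartite I J G z a = G (joinReg J z) (joinReg I a) := rfl
      rw [this]
      ring
  · rw [if_neg hw, if_neg hw]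
    simp

theorem sum_krausCoeff (hiso : W₁.conjTranspose * W₁ = 1)
    (hG : G ∈ unitaryGroup (Reg (Fin n)) ℂ) (h : IsLogical W₁ q fun i => (i, c))
    (hJ : SplitsOver q J Q Q') (hc : ∀ k, Q' k ↔ ¬ Q k) :
    ∑ d : {d // syn (regFam Q q (Subtype.val : {i // i ∈ J} → Fin n)) d = 0} ×
      {d // syn (regFam Q' q (Subtype.val : {i // i ∉ J} → Fin n)) d = 0},
      ∑ w : Reg {i // i ∈ I} × Reg {i // i ∉ I},
        krausCoeff W₁ c G (joinSplit hc (d.1.1, d.2.1)) w.1 w.2 *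
          star (krausCoeff W₁ c G (joinSplit hc (d.1.1, d.2.1)) w.1 w.2) = 1 := by
  rw [← sum_amplitude hiso hG h hJ hc, Fintype.sum_prod_type]
  refine Finset.sum_congr rfl fun d _ => Finset.sum_congr rfl fun d' _ => ?_
  rw [Finset.sum_eq_single (0, 0)]
  · rw [krausCoeff, if_pos ⟨rfl, rfl⟩]
  · intro w _ hw
    rw [krausCoeff, if_neg fun h => hw (Prod.ext h.1 h.2), zero_mul]
  · simp

theorem pseudoBulk_eq {p q : Fin n → Reg (ZMod N × F)} (h₀ : IsLogical W₀ p fun i => (i, c))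
    (hI : SplitsOver p I west east)
    (hc : ∀ k : ZMod N, east k ↔ ¬ west k) (h₁ : IsLogical W₁ q fun i => (i, c))
    (hJ : SplitsOver q J north south)
    (hc' : ∀ k : ZMod N, south k ↔ ¬ north k) (hU : U * W₀ = W₁ * transversal (fun _ : T => G))
    (hiso : W₁.conjTranspose * W₁ = 1) (hG : G ∈ unitaryGroup (Reg (Fin n)) ℂ)
    (ρ : Matrix (Reg {i // i ∈ I} × Reg {i // i ∉ I}) (Reg {i // i ∈ I} × Reg {i // i ∉ I}) ℂ) :
    pseudoBulk U (fun x => W₀ x 0)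
      (krausMap (encOp (regFam west p (Subtype.val : {i // i ∈ I} → Fin n))))
      (krausMap (encOp (regFam east p (Subtype.val : {i // i ∉ I} → Fin n))))
      (krausMap (decOp (regFam north q (Subtype.val : {i // i ∈ J} → Fin n))))
      (krausMap (decOp (regFam south q (Subtype.val : {i // i ∉ J} → Fin n)))) ρ =
        conjBy (bipartite I J G) ρ := by
  unfold pseudoBulk
  rw [withResource_eq, tensorMap_krausMap (encOp _) (encOp _), krausMap_conjBy, conjBy_krausMap, conjBy_krausMap,
    conjBy_krausMap, tensorMap_krausMap, krausMap_krausMap]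
  refine krausMap_eq_conjBy
    (c := fun k => krausCoeff W₁ c G (joinSplit hc' (k.1.1.1, k.1.2.1)) k.2.1 k.2.2)
    (fun k => ?_) ?_ ρ
  · rw [← kraus_eq_smul h₀ hI hc h₁ hJ hc' hU]
  · rw [Fintype.sum_prod_type]
    exact sum_krausCoeff hiso hG h₁ hJ hc'

end Implementation

/-! ### The many-body protocol -/

section Protocol

variable {N : ℕ} [NeZero N] {F : Type} [Fintype F] [DecidableEq F]
  {P P' Q Q' : ZMod N → Prop} [DecidablePred P] [DecidablePred P'] [DecidablePred Q]
  [DecidablePred Q']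

/-- Separation of a region into two parts. -/
def cutMap (P K M : ZMod N → Prop) (x : RegionReg P F) :
    RegionReg (fun k => P k ∧ K k) F × RegionReg (fun k => P k ∧ M k) F :=
  (fun q => x (⟨q.1.1, q.1.2.1⟩, q.2), fun q => x (⟨q.1.1, q.1.2.1⟩, q.2))

theorem cut_eq (P K M : ZMod N → Prop) [DecidablePred P] [DecidablePred K] [DecidablePred M] :
    cut P K M = fmat (cutMap (F := F) P K M) := by
  ext a x
  rw [fmat_apply]
  rfl

theorem cutMap_injective (hc : ∀ k, Q' k ↔ ¬ Q k) :
    Function.Injective (cutMap (F := F) P Q Q') := by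
  intro x y h
  funext q
  by_cases hq : Q q.1.1
  · exact congrFun (congrArg Prod.fst h) (⟨q.1.1, q.1.2, hq⟩, q.2)
  · exact congrFun (congrArg Prod.snd h) (⟨q.1.1, q.1.2, (hc _).2 hq⟩, q.2)

/-- The parts of a region that lie in two other regions. -/
def partsMap (K P P' : ZMod N → Prop) (x : RegionReg K F) :
    RegionReg (fun k => P k ∧ K k) F × RegionReg (fun k => P' k ∧ K k) F :=
  (fun q => x (⟨q.1.1, q.1.2.2⟩, q.2), fun q => x (⟨q.1.1, q.1.2.2⟩, q.2))

theorem partsMap_bijective (hc : ∀ k, P' k ↔ ¬ P k) :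
    Function.Bijective (partsMap (F := F) Q P P') := by
  constructor
  · intro x y h
    funext q
    by_cases hq : P q.1.1
    · exact congrFun (congrArg Prod.fst h) (⟨q.1.1, hq, q.1.2⟩, q.2)
    · exact congrFun (congrArg Prod.snd h) (⟨q.1.1, (hc _).2 hq, q.1.2⟩, q.2)
  · intro a
    refine ⟨fun q => if h : P q.1.1 then a.1 (⟨q.1.1, h, q.1.2⟩, q.2) else
      a.2 (⟨q.1.1, (hc _).2 h, q.1.2⟩, q.2), ?_⟩
    refine Prod.ext (funext fun q => ?_) (funext fun q => ?_)
    · exact dif_pos q.1.2.1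
    · exact dif_neg ((hc _).1 q.1.2.1)

/-- Addition of auxiliary qubits in the state `z`. -/
def ancillaMap {K : Type} (z y : Reg (K × F)) : Reg (K × (F × Bool)) :=
  fun q => if q.2.2 then z (q.1, q.2.1) else y (q.1, q.2.1)

theorem ancilla_eq (P : ZMod N → Prop) [DecidablePred P] (z : RegionReg P F) :
    ancilla P z = fmat (ancillaMap z) := by
  ext x y
  rw [fmat_apply]
  rfl

theorem ancillaMap_injective {K : Type} (z : Reg (K × F)) : Function.Injective (ancillaMap z) :=
  fun _ _ h => funext fun q => congrFun h (q.1, (q.2, false))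

theorem sum_ancilla (P : ZMod N → Prop) [DecidablePred P] :
    ∑ z : RegionReg P F, ancilla P z * (ancilla P z).conjTranspose = 1 := by
  ext x x'
  have hx : ∀ {y z : RegionReg P F} {x : RegionReg P (F × Bool)}, x = ancillaMap z y →
      z = (fun q => x (q.1, (q.2, true))) ∧ y = fun q => x (q.1, (q.2, false)) := by
    rintro y z x rfl
    exact ⟨rfl, rfl⟩
  have hx' : ∀ x : RegionReg P (F × Bool), x = ancillaMap (fun q => x (q.1, (q.2, true)))
      (fun q => x (q.1, (q.2, false))) := by
    intro x
    funext ⟨k, f, b⟩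
    cases b <;> rfl
  rw [Matrix.sum_apply, Finset.sum_eq_single (fun q => x (q.1, (q.2, true))), mul_apply,
    Finset.sum_eq_single (fun q => x (q.1, (q.2, false))), conjTranspose_apply, ancilla_eq,
    fmat_apply, fmat_apply, if_pos (hx' x), one_mul, ← hx' x, one_apply, apply_ite star, star_one, star_zero]
  · exact if_congr eq_comm rfl rfl
  · intro y _ hy
    rw [ancilla_eq, fmat, if_neg fun h => hy (hx h).2, zero_mul]
  · simp
  · intro z _ hz
    rw [mul_apply]
    refine Finset.sum_eq_zero fun y _ => ?_
    rw [ancilla_eq, fmat, if_neg fun h => hz (hx h).1, zero_mul]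
  · simp

theorem split_conj_kroneckerMap (hc : ∀ k, P' k ↔ ¬ P k)
    (M : Matrix (RegionReg P F) (RegionReg P F) ℂ) (M' : Matrix (RegionReg P' F) (RegionReg P' F) ℂ) :
    (split (F := F) P P').conjTranspose * (kroneckerMap (fun s t => s * t) M M' *
      split (F := F) P P') = regionOp P M * regionOp P' M' := by
  ext x y
  rw [split_eq, fmat_conjTranspose_mul_apply, mul_fmat_apply, kroneckerMap_apply, mul_apply,
    Finset.sum_eq_single fun q => if P q.1 then y q else x q]
  · rw [regionOp, regionOp, if_pos, if_pos]
    · refine congrArg₂ (· * ·) (congrArg (M _) (funext fun q => ?_))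
        (congrArg (fun a => M' a _) (funext fun q => ?_))
      · exact (if_pos q.1.2).symm
      · exact (if_neg ((hc _).1 q.1.2)).symm
    · intro q hq
      exact if_pos (by_contra fun h => hq ((hc _).2 h))
    · intro q hq
      exact (if_neg hq).symm
  · intro w _ hw
    obtain ⟨q, hq⟩ := Function.ne_iff.1 hw
    by_cases hP : P q.1
    · rw [if_pos hP] at hq
      rw [regionOp, regionOp, if_neg (c := ∀ q, ¬ P' q.1 → w q = y q), mul_zero]
      exact fun h => hq (h q fun h' => (hc _).1 h' hP)
    · rw [if_neg hP] at hq
      rw [regionOp, if_neg, zero_mul]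
      exact fun h => hq (h q hP).symm
  · simp

theorem split_isometry (hc : ∀ k, P' k ↔ ¬ P k) :
    (split (F := F) P P').conjTranspose * split (F := F) P P' = 1 := by
  rw [split_eq]
  exact fmat_isometry (splitMap_bijective hc).1

theorem split_coisometry (hc : ∀ k, P' k ↔ ¬ P k) :
    split (F := F) P P' * (split (F := F) P P').conjTranspose = 1 := by
  rw [split_eq]
  exact fmat_coisometry (splitMap_bijective hc)

theorem kroneckerMap_mul_split (hc : ∀ k, P' k ↔ ¬ P k)
    (M : Matrix (RegionReg P F) (RegionReg P F) ℂ) (M' : Matrix (RegionReg P' F) (RegionReg P' F) ℂ) :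
    kroneckerMap (fun s t => s * t) M M' * split (F := F) P P' =
      split (F := F) P P' * (regionOp P M * regionOp P' M') := by
  rw [← split_conj_kroneckerMap hc, ← Matrix.mul_assoc, split_coisometry hc, Matrix.one_mul]

theorem split_conjTranspose_mul_kroneckerMap (hc : ∀ k, P' k ↔ ¬ P k)
    (M : Matrix (RegionReg P F) (RegionReg P F) ℂ) (M' : Matrix (RegionReg P' F) (RegionReg P' F) ℂ) :
    (split (F := F) P P').conjTranspose * kroneckerMap (fun s t => s * t) M M' =
      regionOp P M * regionOp P' M' * (split (F := F) P P').conjTranspose := by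
  rw [← split_conj_kroneckerMap hc, Matrix.mul_assoc, Matrix.mul_assoc, split_coisometry hc,
    Matrix.mul_one]

theorem split_conjTranspose_mul_ancilla (hc : ∀ k, P' k ↔ ¬ P k) (z : Reg (ZMod N × F)) :
    (split (F := F × Bool) P P').conjTranspose * kroneckerMap (fun s t => s * t)
      (ancilla P (restr P z)) (ancilla P' (restr P' z)) =
      fmat (ancillaMap z) * (split (F := F) P P').conjTranspose := by
  have h : split (F := F × Bool) P P' * fmat (ancillaMap z) = kroneckerMap (fun s t => s * t)
      (ancilla P (restr P z)) (ancilla P' (restr P' z)) * split (F := F) P P' := by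
    rw [ancilla_eq, ancilla_eq, kroneckerMap_fmat, split_eq, split_eq, fmat_mul_fmat, fmat_mul_fmat]
    rfl
  calc _ = (split (F := F × Bool) P P').conjTranspose * ((kroneckerMap (fun s t => s * t)
      (ancilla P (restr P z)) (ancilla P' (restr P' z)) * split (F := F) P P') *
        (split (F := F) P P').conjTranspose) := by
        rw [Matrix.mul_assoc, split_coisometry hc, Matrix.mul_one]
    _ = _ := by
        rw [← h, ← Matrix.mul_assoc, ← Matrix.mul_assoc, split_isometry hc, Matrix.one_mul]

theorem ancilla_conjTranspose_mul_split (hc : ∀ k, P' k ↔ ¬ P k) (z : Reg (ZMod N × F)) :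
    kroneckerMap (fun s t => s * t) (ancilla P (restr P z)).conjTranspose
      (ancilla P' (restr P' z)).conjTranspose * split (F := F × Bool) P P' =
      split (F := F) P P' * (fmat (ancillaMap z)).conjTranspose := by
  have h := congrArg conjTranspose (split_conjTranspose_mul_ancilla hc z)
  rwa [conjTranspose_mul, conjTranspose_mul, conjTranspose_conjTranspose,
    conjTranspose_conjTranspose, ← kroneckerMap_conjTranspose] at h

theorem ancilla_conj_onBoth (U : Matrix (Reg (ZMod N × F)) (Reg (ZMod N × F)) ℂ)
    (z : Reg (ZMod N × F)) [Decidable (z = 0)] :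
    (fmat (ancillaMap z)).conjTranspose *
      (onBoth U 1 * fmat (ancillaMap (0 : Reg (ZMod N × F)))) = if z = 0 then U else 0 := by
  ext x y
  rw [fmat_conjTranspose_mul_apply, mul_fmat_apply]
  change U x y * (1 : Matrix (Reg (ZMod N × F)) (Reg (ZMod N × F)) ℂ) z 0 = _
  split_ifs with hz
  · rw [hz, one_apply_eq, mul_one]
  · rw [one_apply_ne hz, mul_zero]
    rfl

/-- The exchange of the messages, on basis labels. -/
def exchangeMap {KA MA KB MB : Type} (x : (KA × MA) × (KB × MB)) : (KA × MB) × (KB × MA) :=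
  ((x.1.1, x.2.2), (x.2.1, x.1.2))

theorem exchange_eq {KA MA KB MB : Type} [Fintype KA] [DecidableEq KA] [Fintype MA] [DecidableEq MA]
    [Fintype KB] [DecidableEq KB] [Fintype MB] [DecidableEq MB]
    (σ : Matrix ((KA × MA) × (KB × MB)) ((KA × MA) × (KB × MB)) ℂ) :
    exchange σ = conjBy (fmat exchangeMap) σ := by
  have h : fmat (exchangeMap (KA := KA) (MA := MA) (KB := KB) (MB := MB)) =
      (fmat exchangeMap).conjTranspose :=
    (fmat_conjTranspose (fun _ => rfl) (fun _ => rfl)).symm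
  ext x y
  rw [conjBy, h, conjTranspose_conjTranspose, mul_fmat_apply, fmat_conjTranspose_mul_apply]
  rfl

/-- The exchange of the messages between two parties that hold `P` and `P'` and are to hold `Q` and
`Q'`. -/
def exchangeRegions (F : Type) (P P' Q Q' : ZMod N → Prop) :
    (RegionReg (fun k => P k ∧ Q k) F × RegionReg (fun k => P k ∧ Q' k) F) ×
      (RegionReg (fun k => P' k ∧ Q' k) F × RegionReg (fun k => P' k ∧ Q k) F) →
    (RegionReg (fun k => P k ∧ Q k) F × RegionReg (fun k => P' k ∧ Q k) F) ×
      (RegionReg (fun k => P' k ∧ Q' k) F × RegionReg (fun k => P k ∧ Q' k) F) :=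
  exchangeMap

/-- Separating two regions, exchanging the messages and assembling two other regions. -/
theorem parts_mul_exchange_mul_cut (hc : ∀ k, P' k ↔ ¬ P k) :
    kroneckerMap (fun s t => s * t) (fmat (partsMap (F := F) Q P P')).conjTranspose
      (fmat (partsMap (F := F) Q' P' P)).conjTranspose * (fmat (exchangeRegions F P P' Q Q') *
        kroneckerMap (fun s t => s * t) (cut (F := F) P Q Q') (cut (F := F) P' Q' Q)) =
      split (F := F) Q Q' * (split (F := F) P P').conjTranspose := by
  have hcP : ∀ k, P k ↔ ¬ P' k := fun k => by rw [hc, not_not]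
  rw [kroneckerMap_conjTranspose, kroneckerMap_fmat, cut_eq, cut_eq, kroneckerMap_fmat]
  have h : fmat (Prod.map (partsMap (F := F) Q P P') (partsMap (F := F) Q' P' P)) *
      split (F := F) Q Q' = fmat (exchangeRegions F P P' Q Q') * fmat (Prod.map (cutMap (F := F) P Q Q')
        (cutMap (F := F) P' Q' Q)) * split (F := F) P P' := by
    rw [split_eq, split_eq, fmat_mul_fmat, fmat_mul_fmat, fmat_mul_fmat]
    rfl
  have hi := fmat_isometry (Prod.map_injective.2
    ⟨(partsMap_bijective (F := F) (Q := Q) hc).1, (partsMap_bijective (F := F) (Q := Q') hcP).1⟩)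
  have hs := split_coisometry (F := F) hc
  calc _ = (fmat (Prod.map (partsMap (F := F) Q P P') (partsMap (F := F) Q' P' P))).conjTranspose *
      ((fmat (exchangeRegions F P P' Q Q') * fmat (Prod.map (cutMap (F := F) P Q Q')
        (cutMap (F := F) P' Q' Q)) * split (F := F) P P') * (split (F := F) P P').conjTranspose) := by
        rw [Matrix.mul_assoc _ (split (F := F) P P'), hs, Matrix.mul_one]
    _ = _ := by
        rw [← h, ← Matrix.mul_assoc, ← Matrix.mul_assoc, hi, Matrix.one_mul]

end Protocol

section Composition

variable {X Y Z W : Type} [Fintype X] [Fintype Y] [Fintype Z] [Fintype W]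

theorem mul_mul_eq_mul_mul {A : Matrix Z Y ℂ} {B : Matrix Y X ℂ} {C : Matrix Z W ℂ}
    {D : Matrix W X ℂ} (h : A * B = C * D) {V : Type} (M : Matrix X V ℂ) :
    A * (B * M) = C * (D * M) := by
  rw [← Matrix.mul_assoc, h, Matrix.mul_assoc]

theorem sum_conjTranspose_mul_comp [DecidableEq X] [DecidableEq Y] {κ κ' : Type} [Fintype κ]
    [Fintype κ'] {K : κ → Matrix Z Y ℂ} {L : κ' → Matrix Y X ℂ}
    (hK : ∑ k, (K k).conjTranspose * K k = 1) (hL : ∑ l, (L l).conjTranspose * L l = 1) :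
    ∑ k : κ × κ', (K k.1 * L k.2).conjTranspose * (K k.1 * L k.2) = 1 := by
  rw [Fintype.sum_prod_type, Finset.sum_comm, ← hL]
  refine Finset.sum_congr rfl fun l _ => ?_
  have : ∀ k, (K k * L l).conjTranspose * (K k * L l) =
      (L l).conjTranspose * (((K k).conjTranspose * K k) * L l) := fun k => by
    rw [conjTranspose_mul]
    simp only [Matrix.mul_assoc]
  simp only [this]
  rw [← Matrix.mul_sum, ← Matrix.sum_mul, hK, Matrix.one_mul]

theorem sum_conjTranspose_isometry_mul [DecidableEq X] [DecidableEq Y] {κ : Type} [Fintype κ]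
    {A : Matrix Z Y ℂ} {L : κ → Matrix Y X ℂ} (hA : A.conjTranspose * A = 1)
    (hL : ∑ l, (L l).conjTranspose * L l = 1) :
    ∑ l, (A * L l).conjTranspose * (A * L l) = 1 := by
  rw [← hL]
  refine Finset.sum_congr rfl fun l _ => ?_
  rw [conjTranspose_mul, Matrix.mul_assoc, ← Matrix.mul_assoc _ A, hA, Matrix.one_mul]

theorem isometry_mul [DecidableEq X] [DecidableEq Y] {A : Matrix Z Y ℂ} {B : Matrix Y X ℂ}
    (hA : A.conjTranspose * A = 1) (hB : B.conjTranspose * B = 1) :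
    (A * B).conjTranspose * (A * B) = 1 := by
  rw [conjTranspose_mul, Matrix.mul_assoc, ← Matrix.mul_assoc _ A, hA, Matrix.one_mul, hB]

end Composition

section Protocol

variable {N : ℕ} [NeZero N] {F : Type} [Fintype F] [DecidableEq F]
  {P P' Q Q' : ZMod N → Prop} [DecidablePred P] [DecidablePred P'] [DecidablePred Q]
  [DecidablePred Q']

/-- The Kraus operators of the first round. -/
noncomputable def firstOp (P K M : ZMod N → Prop) [DecidablePred P] [DecidablePred K] [DecidablePred M] {A ω : Type}
    (E : ω → Matrix (RegionReg P F) (A × RegionReg P F) ℂ)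
    (UP : Matrix (RegionReg P (F × Bool)) (RegionReg P (F × Bool)) ℂ) (w : ω) :
    Matrix (RegionReg (fun k => P k ∧ K k) (F × Bool) × RegionReg (fun k => P k ∧ M k) (F × Bool))
      (A × RegionReg P F) ℂ :=
  cut (F := F × Bool) P K M * (UP * (ancilla (F := F) P 0 * E w))

theorem firstRound_eq {A ω : Type} [Fintype A] [Fintype ω]
    (E : ω → Matrix (RegionReg P F) (A × RegionReg P F) ℂ)
    (UP : Matrix (RegionReg P (F × Bool)) (RegionReg P (F × Bool)) ℂ) :
    firstRound P Q Q' (krausMap E) UP = krausMap (firstOp P Q Q' E UP) := by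
  funext ρ
  rw [firstRound, conjBy_krausMap, conjBy_krausMap, conjBy_krausMap]
  rfl

theorem sum_firstOp (hc : ∀ k, Q' k ↔ ¬ Q k) {A ω : Type} [Fintype A] [DecidableEq A] [Fintype ω]
    {E : ω → Matrix (RegionReg P F) (A × RegionReg P F) ℂ}
    (hE : ∑ w, (E w).conjTranspose * E w = 1)
    {UP : Matrix (RegionReg P (F × Bool)) (RegionReg P (F × Bool)) ℂ}
    (hUP : UP ∈ unitaryGroup _ ℂ) :
    ∑ w, (firstOp P Q Q' E UP w).conjTranspose * firstOp P Q Q' E UP w = 1 := by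
  refine sum_conjTranspose_isometry_mul ?_ (sum_conjTranspose_isometry_mul
    (mem_unitaryGroup_iff'.1 hUP) (sum_conjTranspose_isometry_mul ?_ hE))
  · rw [cut_eq]
    exact fmat_isometry (cutMap_injective hc)
  · rw [ancilla_eq]
    exact fmat_isometry (ancillaMap_injective 0)

/-- The Kraus operators of the second round. -/
noncomputable def secondOp (K P P' : ZMod N → Prop) [DecidablePred K] [DecidablePred P] [DecidablePred P'] {A' δ : Type}
    (UK : Matrix (RegionReg K (F × Bool)) (RegionReg K (F × Bool)) ℂ)
    (D : δ → Matrix A' (RegionReg K F) ℂ) (k : δ × RegionReg K F) :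
    Matrix A' (RegionReg (fun k => P k ∧ K k) (F × Bool) ×
      RegionReg (fun k => P' k ∧ K k) (F × Bool)) ℂ :=
  D k.1 * ((ancilla K k.2).conjTranspose *
    (UK * (fmat (partsMap (F := F × Bool) K P P')).conjTranspose))

theorem secondRound_eq {A' δ : Type} [Fintype A'] [Fintype δ]
    (UQ : Matrix (RegionReg Q (F × Bool)) (RegionReg Q (F × Bool)) ℂ)
    (D : δ → Matrix A' (RegionReg Q F) ℂ) :
    secondRound Q P P' UQ (krausMap D) = krausMap (secondOp Q P P' UQ D) := by
  have h : (fun (x : RegionReg Q (F × Bool)) (a : RegionReg (fun k => P k ∧ Q k) (F × Bool) ×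
      RegionReg (fun k => P' k ∧ Q k) (F × Bool)) =>
        if a = (fun q => x (⟨q.1.1, q.1.2.2⟩, q.2), fun q => x (⟨q.1.1, q.1.2.2⟩, q.2))
          then (1 : ℂ) else 0) = (fmat (partsMap (F := F × Bool) Q P P')).conjTranspose := by
    funext x a
    rw [conjTranspose_apply, fmat_apply, apply_ite star, star_one, star_zero]
    rfl
  funext ρ
  rw [secondRound, h, conjBy_conjBy]
  change krausMap D (krausMap (fun z => (ancilla Q z).conjTranspose) (conjBy _ ρ)) = _
  rw [krausMap_conjBy, krausMap_krausMap]
  rfl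

theorem sum_secondOp (hc : ∀ k, P' k ↔ ¬ P k) {A' δ : Type} [Fintype A'] [Fintype δ]
    {D : δ → Matrix A' (RegionReg Q F) ℂ} (hD : ∑ d, (D d).conjTranspose * D d = 1)
    {UQ : Matrix (RegionReg Q (F × Bool)) (RegionReg Q (F × Bool)) ℂ}
    (hUQ : UQ ∈ unitaryGroup _ ℂ) :
    ∑ k, (secondOp Q P P' UQ D k).conjTranspose * secondOp Q P P' UQ D k = 1 := by
  have hY : (UQ * (fmat (partsMap (F := F × Bool) Q P P')).conjTranspose).conjTranspose *
      (UQ * (fmat (partsMap (F := F × Bool) Q P P')).conjTranspose) = 1 := by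
    refine isometry_mul (mem_unitaryGroup_iff'.1 hUQ) ?_
    rw [conjTranspose_conjTranspose]
    exact fmat_coisometry (partsMap_bijective hc)
  refine sum_conjTranspose_mul_comp hD (L := fun z : RegionReg Q F =>
    (ancilla Q z).conjTranspose * (UQ * (fmat (partsMap (F := F × Bool) Q P P')).conjTranspose)) ?_
  have : ∀ z : RegionReg Q F, ((ancilla Q z).conjTranspose * (UQ *
      (fmat (partsMap (F := F × Bool) Q P P')).conjTranspose)).conjTranspose *
        ((ancilla Q z).conjTranspose * (UQ *
          (fmat (partsMap (F := F × Bool) Q P P')).conjTranspose)) =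
      (UQ * (fmat (partsMap (F := F × Bool) Q P P')).conjTranspose).conjTranspose *
        ((ancilla Q z * (ancilla Q z).conjTranspose) *
          (UQ * (fmat (partsMap (F := F × Bool) Q P P')).conjTranspose)) := fun z => by
    rw [conjTranspose_mul, conjTranspose_conjTranspose]
    simp only [Matrix.mul_assoc]
  simp only [this]
  rw [← Matrix.mul_sum, ← Matrix.sum_mul, sum_ancilla, Matrix.one_mul, hY]

/-- A pair of Kraus operators of the two rounds, when the four local unitaries make up the dynamics
`U` on the system and the identity on the auxiliary system. -/
theorem secondOp_mul_exchange_mul_firstOp (hc : ∀ k, P' k ↔ ¬ P k) (hc' : ∀ k, Q' k ↔ ¬ Q k)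
    {A B A' B' ω ω' δ δ' : Type} [Fintype A] [Fintype B] [Fintype A'] [Fintype B']
    {U : Matrix (Reg (ZMod N × F)) (Reg (ZMod N × F)) ℂ}
    {UP : Matrix (RegionReg P (F × Bool)) (RegionReg P (F × Bool)) ℂ}
    {UP' : Matrix (RegionReg P' (F × Bool)) (RegionReg P' (F × Bool)) ℂ}
    {UQ : Matrix (RegionReg Q (F × Bool)) (RegionReg Q (F × Bool)) ℂ}
    {UQ' : Matrix (RegionReg Q' (F × Bool)) (RegionReg Q' (F × Bool)) ℂ}
    (hU : regionOp Q UQ * regionOp Q' UQ' * regionOp P UP * regionOp P' UP' = onBoth U 1)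
    (E : ω → Matrix (RegionReg P F) (A × RegionReg P F) ℂ)
    (E' : ω' → Matrix (RegionReg P' F) (B × RegionReg P' F) ℂ)
    (D : δ → Matrix A' (RegionReg Q F) ℂ) (D' : δ' → Matrix B' (RegionReg Q' F) ℂ)
    (d : δ) (d' : δ') (w : ω) (w' : ω') (z : RegionReg Q F × RegionReg Q' F)
    [Decidable (z = 0)]
    {V : Type} (M : Matrix ((A × RegionReg P F) × (B × RegionReg P' F)) V ℂ) :
    kroneckerMap (fun s t => s * t) (secondOp Q P P' UQ D (d, z.1)) (secondOp Q' P' P UQ' D' (d', z.2)) *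
      (fmat (exchangeRegions (F × Bool) P P' Q Q') *
        (kroneckerMap (fun s t => s * t) (firstOp P Q Q' E UP w) (firstOp P' Q' Q E' UP' w') * M)) =
      if z = 0 then kroneckerMap (fun s t => s * t) (D d) (D' d') * (split (F := F) Q Q' * (U *
        ((split (F := F) P P').conjTranspose *
          (kroneckerMap (fun s t => s * t) (E w) (E' w') * M)))) else 0 := by
  have hz : z = splitMap Q Q' (joinSplit hc' z) := (splitMap_joinSplit hc' z).symm
  have hz0 : joinSplit hc' z = 0 ↔ z = 0 := by
    constructor
    · intro h
      rw [hz, h]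
      rfl
    · intro h
      refine (splitMap_bijective hc').1 ?_
      rw [← hz, h]
      rfl
  rw [secondOp, secondOp, firstOp, firstOp]
  simp only [kroneckerMap_mul_kroneckerMap, Matrix.mul_assoc]
  have h1 := parts_mul_exchange_mul_cut (F := F × Bool) (Q := Q) (Q' := Q') hc
  have h2 := ancilla_conjTranspose_mul_split (F := F) hc' (joinSplit hc' z)
  rw [show restr Q (joinSplit hc' z) = z.1 from congrArg Prod.fst hz.symm,
    show restr Q' (joinSplit hc' z) = z.2 from congrArg Prod.snd hz.symm] at h2
  have h3 : ∀ {V : Type} (M : Matrix (RegionReg P (F × Bool) × RegionReg P' (F × Bool)) V ℂ),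
      kroneckerMap (fun s t => s * t) (fmat (partsMap (F := F × Bool) Q P P')).conjTranspose
        (fmat (partsMap (F := F × Bool) Q' P' P)).conjTranspose *
          (fmat (exchangeRegions (F × Bool) P P' Q Q') * (kroneckerMap (fun s t => s * t)
            (cut (F := F × Bool) P Q Q') (cut (F := F × Bool) P' Q' Q) * M)) =
        split (F := F × Bool) Q Q' * ((split (F := F × Bool) P P').conjTranspose * M) := by
    intro V M
    rw [← Matrix.mul_assoc (split (F := F × Bool) Q Q'), ← h1]
    simp only [Matrix.mul_assoc]
  have h5 := split_conjTranspose_mul_ancilla (F := F) hc 0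
  rw [show restr P (0 : Reg (ZMod N × F)) = 0 from rfl,
    show restr P' (0 : Reg (ZMod N × F)) = 0 from rfl] at h5
  rw [h3, mul_mul_eq_mul_mul (kroneckerMap_mul_split hc' UQ UQ'), mul_mul_eq_mul_mul h2,
    mul_mul_eq_mul_mul (split_conjTranspose_mul_kroneckerMap hc UP UP'),
    mul_mul_eq_mul_mul h5]
  have h4 : ∀ {V : Type} (M : Matrix (Reg (ZMod N × F)) V ℂ),
      (fmat (ancillaMap (joinSplit hc' z))).conjTranspose * (regionOp Q UQ * (regionOp Q' UQ' *
        (regionOp P UP * (regionOp P' UP' * (fmat (ancillaMap (0 : Reg (ZMod N × F))) * M))))) =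
        (if z = 0 then U else 0) * M := by
    intro V M
    have := ancilla_conj_onBoth U (joinSplit hc' z)
    rw [← hU] at this
    rw [if_congr hz0.symm rfl rfl, ← this]
    simp only [Matrix.mul_assoc]
  simp only [Matrix.mul_assoc]
  rw [h4]
  by_cases h : z = 0
  · rw [if_pos h, if_pos h]
  · rw [if_neg h, if_neg h, Matrix.zero_mul, Matrix.mul_zero, Matrix.mul_zero]

end Protocol

section Implementation

variable {N : ℕ} [NeZero N] {F T : Type} [Fintype F] [DecidableEq F] [Fintype T] [DecidableEq T]
  {P P' Q Q' : ZMod N → Prop} [DecidablePred P] [DecidablePred P'] [DecidablePred Q]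
  [DecidablePred Q'] {n : ℕ} {I J : Finset (Fin n)} {p q : Fin n → Reg (ZMod N × F)}
  {W₀ W₁ : Matrix (Reg (ZMod N × F)) (Reg (Fin n × T)) ℂ} {c : T}
  {G : Matrix (Reg (Fin n)) (Reg (Fin n)) ℂ} {U : Matrix (Reg (ZMod N × F)) (Reg (ZMod N × F)) ℂ}

theorem sum_norm_sq_split (hc : ∀ k, P' k ↔ ¬ P k) (hiso₀ : W₀.conjTranspose * W₀ = 1) :
    ∑ x, ‖((split (F := F) P P').mulVec fun x => W₀ x 0) x‖ ^ 2 = 1 := by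
  have h := congrFun (congrFun (isometry_mul (split_isometry (F := F) hc) hiso₀) 0) 0
  rw [one_apply_eq, mul_apply] at h
  refine Complex.ofReal_injective ?_
  rw [Complex.ofReal_one, ← h, Complex.ofReal_sum]
  refine Finset.sum_congr rfl fun x _ => ?_
  rw [Complex.ofReal_pow]
  exact (RCLike.conj_mul _).symm

theorem nlqcImplements (h₀ : IsLogical W₀ p fun i => (i, c)) (hI : SplitsOver p I P P')
    (hc : ∀ k, P' k ↔ ¬ P k) (h₁ : IsLogical W₁ q fun i => (i, c)) (hJ : SplitsOver q J Q Q')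
    (hc' : ∀ k, Q' k ↔ ¬ Q k) (hU : U * W₀ = W₁ * transversal (fun _ : T => G))
    (hiso₀ : W₀.conjTranspose * W₀ = 1) (hiso : W₁.conjTranspose * W₁ = 1)
    (hG : G ∈ unitaryGroup (Reg (Fin n)) ℂ)
    {UP : Matrix (RegionReg P (F × Bool)) (RegionReg P (F × Bool)) ℂ}
    {UP' : Matrix (RegionReg P' (F × Bool)) (RegionReg P' (F × Bool)) ℂ}
    {UQ : Matrix (RegionReg Q (F × Bool)) (RegionReg Q (F × Bool)) ℂ}
    {UQ' : Matrix (RegionReg Q' (F × Bool)) (RegionReg Q' (F × Bool)) ℂ}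
    (hUP : UP ∈ unitaryGroup _ ℂ) (hUP' : UP' ∈ unitaryGroup _ ℂ) (hUQ : UQ ∈ unitaryGroup _ ℂ)
    (hUQ' : UQ' ∈ unitaryGroup _ ℂ)
    (hloc : regionOp Q UQ * regionOp Q' UQ' * regionOp P UP * regionOp P' UP' = onBoth U 1) :
    NLQCImplements ((split (F := F) P P').mulVec fun x => W₀ x 0)
      (firstRound P Q Q'
        (krausMap (encOp (regFam P p (Subtype.val : {i // i ∈ I} → Fin n)))) UP)
      (firstRound P' Q' Q
        (krausMap (encOp (regFam P' p (Subtype.val : {i // i ∉ I} → Fin n)))) UP')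
      (secondRound Q P P' UQ
        (krausMap (decOp (regFam Q q (Subtype.val : {i // i ∈ J} → Fin n)))))
      (secondRound Q' P' P UQ'
        (krausMap (decOp (regFam Q' q (Subtype.val : {i // i ∉ J} → Fin n)))))
      (bipartite I J G) := by
  have hcP : ∀ k, P k ↔ ¬ P' k := fun k => by rw [hc, not_not]
  have hcQ : ∀ k, Q k ↔ ¬ Q' k := fun k => by rw [hc', not_not]
  rw [firstRound_eq, firstRound_eq, secondRound_eq, secondRound_eq]
  refine ⟨isChannel_krausMap (sum_firstOp hc' ?_ hUP), isChannel_krausMap (sum_firstOp hcQ ?_ hUP'),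
    isChannel_krausMap (sum_secondOp hc ?_ hUQ), isChannel_krausMap (sum_secondOp hcP ?_ hUQ'),
    ?_, fun ρ => ?_⟩
  · exact sum_encOp (h₀.orth.regFam Subtype.val_injective fun i => hI.mem i.1 i.2)
  · exact sum_encOp (h₀.orth.regFam Subtype.val_injective fun i => hI.notMem i.1 i.2)
  · exact sum_decOp (h₁.orth.regFam Subtype.val_injective fun i => hJ.mem i.1 i.2)
  · exact sum_decOp (h₁.orth.regFam Subtype.val_injective fun i => hJ.notMem i.1 i.2)
  · exact sum_norm_sq_split hc hiso₀
  · rw [withResource_eq, tensorMap_krausMap (firstOp _ _ _ _ UP), krausMap_conjBy]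
    have hex : ∀ σ, exchange σ = conjBy (fmat (exchangeRegions (F × Bool) P P' Q Q')) σ :=
      exchange_eq
    rw [hex, conjBy_krausMap, tensorMap_krausMap, krausMap_krausMap]
    refine krausMap_eq_conjBy (c := fun k => if (k.1.1.2, k.1.2.2) = 0 then
      krausCoeff W₁ c G (joinSplit hc' (k.1.1.1.1, k.1.2.1.1)) k.2.1 k.2.2 else 0)
      (fun k => ?_) ?_ ρ
    · have := secondOp_mul_exchange_mul_firstOp hc hc' hloc
        (encOp (regFam P p (Subtype.val : {i // i ∈ I} → Fin n)))
        (encOp (regFam P' p (Subtype.val : {i // i ∉ I} → Fin n)))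
        (decOp (regFam Q q (Subtype.val : {i // i ∈ J} → Fin n)))
        (decOp (regFam Q' q (Subtype.val : {i // i ∉ J} → Fin n)))
        k.1.1.1 k.1.2.1 k.2.1 k.2.2 (k.1.1.2, k.1.2.2)
        (resMat (A := Reg {i // i ∈ I}) (B := Reg {i // i ∉ I})
            ((split (F := F) P P').mulVec fun x => W₀ x 0))
      refine this.trans ?_
      by_cases hz : (k.1.1.2, k.1.2.2) = 0
      · rw [if_pos hz, if_pos hz]
        exact kraus_eq_smul h₀ hI hc h₁ hJ hc' hU _ _ _ _
      · rw [if_neg hz, if_neg hz, zero_smul]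
    · rw [← sum_krausCoeff (I := I) hiso hG h₁ hJ hc']
      symm
      rw [← Fintype.sum_prod_type']
      refine Finset.sum_of_injOn (fun k => (((k.1.1, 0), (k.1.2, 0)), k.2)) ?_
        (fun _ _ => Finset.mem_univ _) (fun k _ hk => ?_) fun k _ => ?_
      · rintro ⟨⟨d, d'⟩, w⟩ _ ⟨⟨e, e'⟩, w'⟩ _ h
        simp only [Prod.mk.injEq, and_true] at h
        rw [h.1.1, h.1.2, h.2]
      · rw [if_neg, zero_mul]
        intro h
        have h' := Prod.mk.inj h
        refine hk ⟨((k.1.1.1, k.1.2.1), k.2), Finset.mem_coe.2 (Finset.mem_univ _), ?_⟩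
        obtain ⟨⟨⟨d, z⟩, d', z'⟩, w⟩ := k
        rw [show z = 0 from h'.1, show z' = 0 from h'.2]
      · rw [if_pos]
        rfl

end Implementation

/-! ### Entanglement of stabilizer states -/

section Entropy

variable {ι κ : Type} [Fintype ι] [DecidableEq ι] [Fintype κ] [DecidableEq κ]

/-- The words of `C` that vanish on the second part. -/
def leftPart (C : Submodule (ZMod 2) (Reg ι × Reg κ)) : Submodule (ZMod 2) (Reg ι) :=
  C.comap (LinearMap.inl (ZMod 2) (Reg ι) (Reg κ))

/-- The words of `C` that vanish on the first part. -/
def rightPart (C : Submodule (ZMod 2) (Reg ι × Reg κ)) : Submodule (ZMod 2) (Reg κ) :=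
  C.comap (LinearMap.inr (ZMod 2) (Reg ι) (Reg κ))

/-- The eigenvalues of the reduced state are `0` and `c`. -/
theorem entanglementEntropy_of_mul_mul {RA RB : Type} [Fintype RA] [DecidableEq RA] [Fintype RB]
    {φ : RA × RB → ℂ} {c : ℝ} (hnorm : ∑ x, ‖φ x‖ ^ 2 = 1)
    (hM : (Matrix.of fun a b => φ (a, b) : Matrix RA RB ℂ) *
      ((Matrix.of fun a b => φ (a, b) : Matrix RA RB ℂ).conjTranspose *
        (Matrix.of fun a b => φ (a, b) : Matrix RA RB ℂ)) =
      (c : ℂ) • (Matrix.of fun a b => φ (a, b) : Matrix RA RB ℂ)) :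
    entanglementEntropy φ = - Real.log c := by
  set M : Matrix RA RB ℂ := Matrix.of fun a b => φ (a, b) with hMdef
  set hH := Matrix.isHermitian_mul_conjTranspose_self M
  have hPP : (M * M.conjTranspose) * (M * M.conjTranspose) = (c : ℂ) • (M * M.conjTranspose) := by
    rw [← Matrix.smul_mul, ← hM]
    simp only [Matrix.mul_assoc]
  have hsum : ∑ i, hH.eigenvalues i = 1 := by
    have h := hH.trace_eq_sum_eigenvalues
    have htr : (M * M.conjTranspose).trace = ((∑ x, ‖φ x‖ ^ 2 : ℝ) : ℂ) := by
      rw [Matrix.trace, Fintype.sum_prod_type, Complex.ofReal_sum]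
      refine Finset.sum_congr rfl fun a _ => ?_
      rw [Complex.ofReal_sum, Matrix.diag_apply, mul_apply]
      refine Finset.sum_congr rfl fun b _ => ?_
      rw [Complex.ofReal_pow]
      exact RCLike.mul_conj _
    rw [htr, hnorm] at h
    have h' : ((∑ i, hH.eigenvalues i : ℝ) : ℂ) = ((1 : ℝ) : ℂ) := by
      rw [h, Complex.ofReal_sum]
      rfl
    exact Complex.ofReal_injective h'
  have heig : ∀ i, hH.eigenvalues i * hH.eigenvalues i = c * hH.eigenvalues i := by
    intro i
    have hv := hH.mulVec_eigenvectorBasis i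
    have h2 := congrArg (fun A => A.mulVec (hH.eigenvectorBasis i : RA → ℂ)) hPP
    dsimp only at h2
    rw [← Matrix.mulVec_mulVec, Matrix.smul_mulVec, hv, Matrix.mulVec_smul, hv] at h2
    have hne : (hH.eigenvectorBasis i : RA → ℂ) ≠ 0 := by
      intro h0
      refine hH.eigenvectorBasis.orthonormal.ne_zero i ?_
      ext a
      exact congrFun h0 a
    obtain ⟨a, ha⟩ := Function.ne_iff.1 hne
    have h3 := congrFun h2 a
    simp only [Pi.smul_apply, Complex.real_smul, smul_eq_mul] at h3
    rw [← mul_assoc, ← mul_assoc] at h3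
    exact_mod_cast mul_right_cancel₀ ha h3
  have hneg : ∀ i, Real.negMulLog (hH.eigenvalues i) = hH.eigenvalues i * (- Real.log c) := by
    intro i
    rcases eq_or_ne (hH.eigenvalues i) 0 with h0 | h0
    · rw [h0, Real.negMulLog_zero, zero_mul]
    · rw [mul_right_cancel₀ h0 (heig i), Real.negMulLog]
      ring
  change ∑ i, Real.negMulLog (hH.eigenvalues i) = _
  simp only [hneg]
  rw [← Finset.sum_mul, hsum, one_mul]

open Classical in
theorem entanglementEntropy_eq {C : Submodule (ZMod 2) (Reg ι × Reg κ)} {φ : Reg ι × Reg κ → ℂ}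
    {r : ℂ} (hφ : ∀ x, φ x = if x ∈ C then r else 0) (hnorm : ∑ x, ‖φ x‖ ^ 2 = 1) :
    entanglementEntropy φ = Real.log (Fintype.card C) -
      (Real.log (Fintype.card (leftPart C)) + Real.log (Fintype.card (rightPart C))) := by
  have hr : ‖r‖ ^ 2 * Fintype.card C = 1 := by
    rw [← hnorm, Fintype.card_subtype, mul_comm, ← nsmul_eq_mul, ← Finset.sum_const,
      Finset.sum_filter]
    refine Finset.sum_congr rfl fun x _ => ?_
    rw [hφ]
    split_ifs
    · rfl
    · rw [norm_zero, zero_pow two_ne_zero]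
  have hC0 : (Fintype.card C : ℝ) ≠ 0 := Nat.cast_ne_zero.2 Fintype.card_ne_zero
  have hA0 : (Fintype.card (leftPart C) : ℝ) ≠ 0 := Nat.cast_ne_zero.2 Fintype.card_ne_zero
  have hB0 : (Fintype.card (rightPart C) : ℝ) ≠ 0 := Nat.cast_ne_zero.2 Fintype.card_ne_zero
  have hrc : star r * r = ((1 / Fintype.card C : ℝ) : ℂ) := by
    rw [eq_one_div_of_mul_eq_one_left hr |>.symm, Complex.ofReal_pow]
    exact RCLike.conj_mul r
  rw [entanglementEntropy_of_mul_mul (c := Fintype.card (leftPart C) * Fintype.card (rightPart C) / Fintype.card C) hnorm,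
    Real.log_div (mul_ne_zero hA0 hB0) hC0, Real.log_mul hA0 hB0]
  · ring
  · ext a b
    rw [mul_apply, Matrix.smul_apply]
    simp only [mul_apply, Finset.mul_sum, conjTranspose_apply, of_apply]
    by_cases hab : (a, b) ∈ C
    · have hl : ∀ u, u ∈ leftPart C ↔ (a + u, b) ∈ C := fun u => by
        have := C.add_mem_iff_right hab (y := (u, 0))
        rw [Prod.mk_add_mk, add_zero] at this
        exact this.symm
      have hr' : ∀ v, v ∈ rightPart C ↔ (a, b + v) ∈ C := fun v => by
        have := C.add_mem_iff_right hab (y := (0, v))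
        rw [Prod.mk_add_mk, add_zero] at this
        exact this.symm
      have hlr : ∀ u v, u ∈ leftPart C → v ∈ rightPart C → (a + u, b + v) ∈ C := fun u v hu hv => by
        have := C.add_mem ((hl u).1 hu) (show ((0 : Reg ι), v) ∈ C from hv)
        rwa [Prod.mk_add_mk, add_zero] at this
      have key : ∀ v u, φ (a, b + v) * (star (φ (a + u, b + v)) * φ (a + u, b)) =
          (if v ∈ rightPart C then 1 else 0) * ((if u ∈ leftPart C then 1 else 0) *
            (star r * r * r)) := by
        intro v u
        rw [hφ, hφ, hφ, if_congr (hr' v).symm rfl rfl, if_congr (hl u).symm rfl rfl]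
        by_cases hv : v ∈ rightPart C
        · by_cases hu : u ∈ leftPart C
          · rw [if_pos hv, if_pos hu, if_pos (hlr u v hu hv), if_pos hv, if_pos hu]
            ring
          · rw [if_neg hu, if_neg hu, mul_zero, mul_zero, zero_mul, mul_zero]
        · rw [if_neg hv, if_neg hv, zero_mul, zero_mul]
      rw [← Equiv.sum_comp (Equiv.addLeft b), Finset.sum_congr rfl fun v _ =>
        (Equiv.sum_comp (Equiv.addLeft a) _).symm]
      simp only [Equiv.coe_addLeft, key]
      rw [← Finset.sum_mul_sum, ← Finset.sum_mul, Finset.sum_boole, Finset.sum_boole, hφ,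
        if_pos hab, hrc, Fintype.card_subtype, Fintype.card_subtype, Fintype.card_subtype, smul_eq_mul]
      push_cast
      ring
    · rw [hφ (a, b), if_neg hab, smul_zero]
      refine Finset.sum_eq_zero fun b' _ => Finset.sum_eq_zero fun a' _ => ?_
      rw [hφ, hφ, hφ]
      by_cases h1 : (a, b') ∈ C
      · by_cases h2 : (a', b') ∈ C
        · rw [if_neg (c := (a', b) ∈ C), mul_zero, mul_zero]
          intro h3
          refine hab ?_
          have := C.add_mem (C.sub_mem h1 h2) h3
          rwa [Prod.mk_sub_mk, Prod.mk_add_mk, sub_add_cancel, sub_self, zero_add] at this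
        · rw [if_neg h2, star_zero, zero_mul, mul_zero]
      · rw [if_neg h1, zero_mul]

open Classical in
theorem entanglementEntropy_le {C : Submodule (ZMod 2) (Reg ι × Reg κ)} {φ : Reg ι × Reg κ → ℂ}
    {r : ℂ} (hφ : ∀ x, φ x = if x ∈ C then r else 0) (hnorm : ∑ x, ‖φ x‖ ^ 2 = 1) :
    entanglementEntropy φ ≤ (Fintype.card ι + Fintype.card κ : ℕ) * Real.log 2 := by
  rw [entanglementEntropy_eq hφ hnorm]
  have h1 : Real.log (Fintype.card C) ≤ (Fintype.card ι + Fintype.card κ : ℕ) * Real.log 2 := by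
    rw [← Real.log_pow]
    refine Real.log_le_log (Nat.cast_pos.2 Fintype.card_pos) ?_
    have : Fintype.card C ≤ 2 ^ (Fintype.card ι + Fintype.card κ) := by
      refine (Fintype.card_subtype_le _).trans ?_
      rw [Fintype.card_prod, Fintype.card_fun, Fintype.card_fun, ZMod.card, pow_add]
    exact_mod_cast this
  have h2 := Real.log_natCast_nonneg (Fintype.card (leftPart C))
  have h3 := Real.log_natCast_nonneg (Fintype.card (rightPart C))
  linarith

open Classical in
/-- Pairs of words of an isotropic space with dual restrictions to the first part bound the
entropy from below. -/
theorem le_entanglementEntropy {C : Submodule (ZMod 2) (Reg ι × Reg κ)} {φ : Reg ι × Reg κ → ℂ}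
    {r : ℂ} (hφ : ∀ x, φ x = if x ∈ C then r else 0) (hnorm : ∑ x, ‖φ x‖ ^ 2 = 1)
    (hC : ∀ x ∈ C, ∀ y ∈ C, x.1 ⬝ᵥ y.1 + x.2 ⬝ᵥ y.2 = 0) {n : ℕ} {y y' : Fin n → Reg ι × Reg κ}
    (hy : ∀ i, y i ∈ C) (hy' : ∀ i, y' i ∈ C)
    (hdual : ∀ i j, (y i).1 ⬝ᵥ (y' j).1 = if i = j then 1 else 0) :
    Real.log 2 * n ≤ entanglementEntropy φ := by
  rw [entanglementEntropy_eq hφ hnorm]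
  have hA0 : (Fintype.card (leftPart C) : ℝ) ≠ 0 := Nat.cast_ne_zero.2 Fintype.card_ne_zero
  have hB0 : (Fintype.card (rightPart C) : ℝ) ≠ 0 := Nat.cast_ne_zero.2 Fintype.card_ne_zero
  let f : Reg (Fin n) × (leftPart C × rightPart C) → C := fun p =>
    ⟨∑ i, p.1 i • y i + (p.2.1.1, p.2.2.1), by
      refine C.add_mem (C.sum_mem fun i _ => C.smul_mem _ (hy i)) ?_
      have := C.add_mem (show (p.2.1.1, (0 : Reg κ)) ∈ C from p.2.1.2)
        (show ((0 : Reg ι), p.2.2.1) ∈ C from p.2.2.2)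
      rwa [Prod.mk_add_mk, add_zero, zero_add] at this⟩
  have hf : Function.Injective f := by
    rintro ⟨v, a, b⟩ ⟨w, a', b'⟩ h
    have h := congrArg Subtype.val h
    change ∑ i, v i • y i + (a.1, b.1) = ∑ i, w i • y i + (a'.1, b'.1) at h
    have hpair : ∀ (v : Reg (Fin n)) (a : leftPart C) (b : rightPart C) j,
        (∑ i, v i • y i + (a.1, b.1)).1 ⬝ᵥ (y' j).1 = v j := by
      intro v a b j
      have h0 : a.1 ⬝ᵥ (y' j).1 = 0 := by
        have := hC _ (show (a.1, (0 : Reg κ)) ∈ C from a.2) _ (hy' j)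
        rwa [zero_dotProduct, add_zero] at this
      rw [Prod.fst_add, add_dotProduct, h0, add_zero, Prod.fst_sum, sum_dotProduct,
        Finset.sum_eq_single j]
      · rw [Prod.smul_fst, smul_dotProduct, hdual, if_pos rfl, smul_eq_mul, mul_one]
      · intro i _ hi
        rw [Prod.smul_fst, smul_dotProduct, hdual, if_neg hi, smul_zero]
      · simp
    have hv : v = w := funext fun j => by rw [← hpair v a b j, h, hpair]
    rw [hv, add_right_inj, Prod.mk.injEq] at h
    rw [hv, Subtype.ext h.1, Subtype.ext h.2]
  have hcard := Fintype.card_le_of_injective f hf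
  rw [Fintype.card_prod, Fintype.card_prod, Fintype.card_fun, ZMod.card, Fintype.card_fin] at hcard
  have h : Real.log (2 ^ n * (Fintype.card (leftPart C) * Fintype.card (rightPart C))) ≤
      Real.log (Fintype.card C) := by
    refine Real.log_le_log (by positivity) ?_
    exact_mod_cast hcard
  rw [Real.log_mul (by positivity) (mul_ne_zero hA0 hB0), Real.log_mul hA0 hB0, Real.log_pow] at h
  linarith

end Entropy

/-! ### Self-dual codes placed on the circle -/

section Placed

variable {N n R : ℕ} [NeZero N] {p : Slot n R → ZMod N}

/-- A word of the stack as a word of the many-body system. -/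
def placeWord (p : Slot n R → ZMod N) : Reg (Slot n R) →ₗ[ZMod 2] Reg (ZMod N × Slot n R) where
  toFun y := fun q => if q.1 = p q.2 then y q.2 else 0
  map_add' x y := by
    funext q
    change (if q.1 = p q.2 then x q.2 + y q.2 else 0) = _
    split_ifs with h
    · exact (congrArg₂ (· + ·) (if_pos h) (if_pos h)).symm
    · exact ((congrArg₂ (· + ·) (if_neg h) (if_neg h)).trans (add_zero _)).symm
  map_smul' c x := by
    funext q
    change (if q.1 = p q.2 then c * x q.2 else 0) = c * (if q.1 = p q.2 then x q.2 else 0)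
    rw [mul_ite, mul_zero]

theorem placeWord_apply (y : Reg (Slot n R)) (q : ZMod N × Slot n R) :
    placeWord p y q = if q.1 = p q.2 then y q.2 else 0 := rfl

theorem place_eq : place p = fmat (placeWord p) := by
  ext x y
  rw [fmat_apply]
  rfl

theorem placeWord_injective : Function.Injective (placeWord p) := by
  intro x y h
  funext s
  have := congrFun h (p s, s)
  rwa [placeWord_apply, placeWord_apply, if_pos rfl, if_pos rfl] at this

theorem restr_dotProduct_restr {F : Type} [Fintype F] (P : ZMod N → Prop) [DecidablePred P]
    (x y : Reg (ZMod N × F)) :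
    restr P x ⬝ᵥ restr P y = ∑ q, if P q.1 then x q * y q else 0 := by
  refine Finset.sum_of_injOn (fun q : {k // P k} × F => (q.1.1, q.2)) ?_
    (fun _ _ => Finset.mem_univ _) (fun q _ hq => ?_) fun q _ => (if_pos q.1.2).symm
  · rintro ⟨⟨k, hk⟩, f⟩ _ ⟨⟨k', hk'⟩, f'⟩ _ h
    simp only [Prod.mk.injEq] at h
    obtain ⟨rfl, rfl⟩ := h
    rfl
  · rw [if_neg]
    exact fun h => hq ⟨(⟨q.1, h⟩, q.2), Finset.mem_coe.2 (Finset.mem_univ _), rfl⟩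

theorem restr_placeWord_dotProduct (P : ZMod N → Prop) [DecidablePred P] (x y : Reg (Slot n R)) :
    restr P (placeWord p x) ⬝ᵥ restr P (placeWord p y) =
      ∑ s, if P (p s) then x s * y s else 0 := by
  rw [restr_dotProduct_restr, Fintype.sum_prod_type_right]
  refine Finset.sum_congr rfl fun s _ => ?_
  rw [Finset.sum_eq_single (p s)]
  · rw [placeWord_apply, placeWord_apply, if_pos rfl, if_pos rfl]
  · intro k _ hk
    rw [placeWord_apply, if_neg hk, zero_mul, ite_self]
  · simp

theorem placeWord_dotProduct (x y : Reg (Slot n R)) :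
    placeWord p x ⬝ᵥ placeWord p y = x ⬝ᵥ y := by
  have h := restr_placeWord_dotProduct (p := p) (fun _ => True) x y
  rw [restr_dotProduct_restr] at h
  rw [Finset.sum_congr rfl fun q _ => if_pos trivial, Finset.sum_congr rfl fun q _ => if_pos trivial] at h
  exact h

/-- The word `w` in the `i`-th copy. -/
def inCopy {ι : Type} (i : Fin n) (w : Reg ι) : Reg (Fin n × ι) :=
  fun s => if s.1 = i then w s.2 else 0

theorem copy_inCopy_self {ι : Type} (i : Fin n) (w : Reg ι) : copy (inCopy i w) i = w :=
  funext fun _ => if_pos rfl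

theorem copy_inCopy_of_ne {ι : Type} {i j : Fin n} (h : j ≠ i) (w : Reg ι) :
    copy (inCopy i w) j = 0 := funext fun _ => if_neg h

theorem dotProduct_eq_sum_copy {ι : Type} [Fintype ι] (x y : Reg (Fin n × ι)) :
    x ⬝ᵥ y = ∑ i, copy x i ⬝ᵥ copy y i := Fintype.sum_prod_type _

theorem inCopy_dotProduct {ι : Type} [Fintype ι] (i : Fin n) (w : Reg ι) (y : Reg (Fin n × ι)) :
    inCopy i w ⬝ᵥ y = w ⬝ᵥ copy y i := by
  rw [dotProduct_eq_sum_copy, Finset.sum_eq_single i]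
  · rw [copy_inCopy_self]
  · intro j _ hj
    rw [copy_inCopy_of_ne hj, zero_dotProduct]
  · simp

variable {T : Type} [Fintype T] [DecidableEq T] {V : Matrix (Reg (Leg R)) (Reg T) ℂ}
  {L : Submodule (ZMod 2) (Reg (Leg R) × Reg T)} {κ : ℂ} {c : T}

theorem place_mul_stack_placeWord (y : Reg (Slot n R)) (b : Reg (Fin n × T)) :
    (place p * stack n V) (placeWord p y) b = stack n V y b := by
  rw [place_eq, fmat_mul_apply_of_injective placeWord_injective]

theorem place_mul_stack_of_notMem_range {x : Reg (ZMod N × Slot n R)}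
    (hx : ∀ y, x ≠ placeWord p y) (b : Reg (Fin n × T)) : (place p * stack n V) x b = 0 := by
  rw [place_eq, mul_apply]
  exact Finset.sum_eq_zero fun y _ => by rw [fmat_apply, if_neg (hx y), zero_mul]

theorem place_mul_stack_isometry (hV : V.conjTranspose * V = 1) :
    (place p * stack n V).conjTranspose * (place p * stack n V) = 1 := by
  rw [place_eq]
  exact isometry_mul (fmat_isometry placeWord_injective) (stack_isometry hV)

theorem IsSelfDualCode.mem_of_stack_ne_zero (hL : IsSelfDualCode L V κ) {y : Reg (Slot n R)}
    {b : Reg (Fin n × T)} (h : stack n V y b ≠ 0) (i : Fin n) : (copy y i, copy b i) ∈ L := by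
  by_contra hn
  exact h (Finset.prod_eq_zero (Finset.mem_univ i) (hL.apply_not_mem _ _ hn))

/-- The placed words of a self-dual code that represent a logical Pauli operator of one tile of
every copy. -/
theorem IsSelfDualCode.isLogical (hL : IsSelfDualCode L V κ) {w : Fin n → Reg (Leg R)}
    (hw : ∀ i, (w i, Pi.single c 1) ∈ L) :
    IsLogical (place p * stack n V) (fun i => placeWord p (inCopy i (w i))) fun i => (i, c) where
  orth i j := by
    have h := (hL.dual _).1 (hw j) _ (hw j)
    rw [single_one_dotProduct] at h
    change _ + (Pi.single c 1 : Reg T) c = 0 at h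
    rw [Pi.single_eq_same] at h
    rw [placeWord_dotProduct, inCopy_dotProduct]
    by_cases hij : i = j
    · subst hij
      rw [copy_inCopy_self, if_pos rfl]
      exact CharTwo.add_eq_zero.1 h
    · rw [copy_inCopy_of_ne hij, dotProduct_zero, if_neg hij]
  inj i j h := congrArg Prod.fst h
  shift i x b := by
    classical
    by_cases hx : ∃ y, x = placeWord p y
    · obtain ⟨y, rfl⟩ := hx
      rw [← map_add, place_mul_stack_placeWord, place_mul_stack_placeWord, hL.stack_apply,
        hL.stack_apply]
      congr 1
      refine propext (forall_congr' fun j => ?_)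
      by_cases hj : j = i
      · subst hj
        have h := L.add_mem_iff_left (x := (copy y j, copy b j)) (hw j)
        rw [Prod.mk_add_mk] at h
        have h1 : copy (y + inCopy j (w j)) j = copy y j + w j :=
          congrArg (copy y j + ·) (copy_inCopy_self j (w j))
        have h2 : copy (b + Pi.single (j, c) 1) j = copy b j + Pi.single c 1 :=
          funext fun τ => congrArg (b (j, τ) + ·) (by
            rw [Pi.single_apply, Pi.single_apply]
            exact if_congr (by simp) rfl rfl)
        rwa [h1, h2]
      · have h1 : copy (y + inCopy i (w i)) j = copy y j :=
          (congrArg (copy y j + ·) (copy_inCopy_of_ne hj (w i))).trans (add_zero _)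
        have h2 : copy (b + Pi.single (i, c) 1) j = copy b j := funext fun τ =>
          (congrArg (b (j, τ) + ·) (by
            rw [Pi.single_apply, if_neg]
            exact fun h => hj (congrArg Prod.fst h))).trans (add_zero _)
        rw [h1, h2]
    · push Not at hx
      rw [place_mul_stack_of_notMem_range hx, place_mul_stack_of_notMem_range]
      intro y hy
      refine hx (y + inCopy i (w i)) ?_
      rw [map_add, ← hy, reg_add_cancel]
  eig i x b hW := by
    by_cases hx : ∃ y, x = placeWord p y
    · obtain ⟨y, rfl⟩ := hx
      rw [place_mul_stack_placeWord] at hW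
      have h := (hL.dual _).1 (hL.mem_of_stack_ne_zero hW i) _ (hw i)
      rw [single_one_dotProduct] at h
      rw [placeWord_dotProduct, inCopy_dotProduct]
      exact CharTwo.add_eq_zero.1 h
    · push Not at hx
      exact absurd (place_mul_stack_of_notMem_range hx b) hW

theorem splitsOver_placeWord {w : Fin n → Reg (Leg R)} {I : Finset (Fin n)} {P P' : ZMod N → Prop}
    (h : ∀ i ∈ I, ∀ e, w i e ≠ 0 → P (p (i, e))) (h' : ∀ i ∉ I, ∀ e, w i e ≠ 0 → P' (p (i, e))) :
    SplitsOver (fun i => placeWord p (inCopy i (w i))) I P P' := by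
  have key : ∀ i q, placeWord p (inCopy i (w i)) q ≠ 0 →
      ∃ e, w i e ≠ 0 ∧ q.1 = p (i, e) := by
    rintro i ⟨k, j, e⟩ hq
    rw [placeWord_apply] at hq
    dsimp only at hq
    by_cases hk : k = p (j, e)
    · rw [if_pos hk, inCopy] at hq
      by_cases hj : j = i
      · subst hj
        exact ⟨e, by rwa [if_pos rfl] at hq, hk⟩
      · exact absurd (if_neg hj) hq
    · exact absurd (if_neg hk) hq
  refine ⟨fun i hi q hq => ?_, fun i hi q hq => ?_⟩
  · obtain ⟨e, he, hk⟩ := key i q hq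
    exact hk ▸ h i hi e he
  · obtain ⟨e, he, hk⟩ := key i q hq
    exact hk ▸ h' i hi e he

/-- The words of the stack with all bulk qubits `0`, split over two regions. -/
def splitCode (L : Submodule (ZMod 2) (Reg (Leg R) × Reg T)) (p : Slot n R → ZMod N)
    (P P' : ZMod N → Prop) :
    Submodule (ZMod 2) (RegionReg P (Slot n R) × RegionReg P' (Slot n R)) where
  carrier := {a | ∃ y : Reg (Slot n R), (∀ i, (copy y i, (0 : Reg T)) ∈ L) ∧
    splitMap P P' (placeWord p y) = a}
  add_mem' := by
    rintro _ _ ⟨y, hy, rfl⟩ ⟨z, hz, rfl⟩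
    refine ⟨y + z, fun i => ?_, ?_⟩
    · have := L.add_mem (hy i) (hz i)
      rwa [Prod.mk_add_mk, add_zero] at this
    · rw [map_add]
      rfl
  zero_mem' := ⟨0, fun i => L.zero_mem, by rw [map_zero]; rfl⟩
  smul_mem' := by
    rintro a _ ⟨y, hy, rfl⟩
    refine ⟨a • y, fun i => ?_, ?_⟩
    · have := L.smul_mem a (hy i)
      rwa [Prod.smul_mk, smul_zero] at this
    · rw [map_smul]
      rfl

variable {P P' : ZMod N → Prop} [DecidablePred P] [DecidablePred P']

open Classical in
theorem IsSelfDualCode.split_mulVec_apply (hL : IsSelfDualCode L V κ) (hc : ∀ k, P' k ↔ ¬ P k)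
    (a : RegionReg P (Slot n R) × RegionReg P' (Slot n R)) :
    ((split (F := Slot n R) P P').mulVec fun x => (place p * stack n V) x 0) a =
      if a ∈ splitCode L p P P' then κ ^ n else 0 := by
  obtain ⟨x, rfl⟩ := (splitMap_bijective hc).2 a
  rw [split_eq, fmat_mulVec_apply_of_injective (splitMap_bijective hc).1]
  by_cases hx : ∃ y, x = placeWord p y
  · obtain ⟨y, rfl⟩ := hx
    rw [place_mul_stack_placeWord, hL.stack_apply]
    refine if_congr ⟨fun h => ⟨y, h, rfl⟩, ?_⟩ rfl rfl
    rintro ⟨z, hz, h⟩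
    rw [placeWord_injective ((splitMap_bijective hc).1 h)] at hz
    exact hz
  · push Not at hx
    rw [place_mul_stack_of_notMem_range hx, if_neg]
    rintro ⟨z, -, h⟩
    exact hx z ((splitMap_bijective hc).1 h).symm

theorem sum_region_add (hc : ∀ k, P' k ↔ ¬ P k) (f : Slot n R → ZMod 2) :
    (∑ s, if P (p s) then f s else 0) + (∑ s, if P' (p s) then f s else 0) = ∑ s, f s := by
  rw [← Finset.sum_add_distrib]
  refine Finset.sum_congr rfl fun s _ => ?_
  by_cases h : P (p s)
  · rw [if_pos h, if_neg fun h' => (hc _).1 h' h, add_zero]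
  · rw [if_neg h, if_pos ((hc _).2 h), zero_add]

/-- The entanglement between two complementary regions is linear in the number of copies. -/
theorem IsSelfDualCode.entropy_bounds (hL : IsSelfDualCode L V κ) (hc : ∀ k, P' k ↔ ¬ P k)
    {w w' : Reg (Leg R)} (hw : (w, 0) ∈ L) (hw' : (w', 0) ∈ L)
    (hww' : ∀ i, (∑ e, if P (p (i, e)) then w e * w' e else 0) = 1) :
    Real.log 2 * n ≤ entanglementEntropy
        ((split (F := Slot n R) P P').mulVec fun x => (place p * stack n V) x 0) ∧
      entanglementEntropy
        ((split (F := Slot n R) P P').mulVec fun x => (place p * stack n V) x 0) ≤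
          2 * N * Fintype.card (Leg R) * Real.log 2 * n := by
  have hφ := hL.split_mulVec_apply (p := p) (n := n) hc
  have hnorm := sum_norm_sq_split (n := n) hc (place_mul_stack_isometry (p := p) hL.isometry)
  constructor
  · have hmem : ∀ (w : Reg (Leg R)) (i : Fin n), (w, 0) ∈ L →
        splitMap P P' (placeWord p (inCopy i w)) ∈ splitCode L p P P' := by
      intro w i hw
      refine ⟨inCopy i w, fun j => ?_, rfl⟩
      by_cases hj : j = i
      · subst hj
        rwa [copy_inCopy_self]
      · rw [copy_inCopy_of_ne hj]
        exact L.zero_mem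
    refine le_entanglementEntropy hφ hnorm ?_ (fun i => hmem w i hw) (fun i => hmem w' i hw') ?_
    · rintro _ ⟨x, hx, rfl⟩ _ ⟨y, hy, rfl⟩
      change restr P _ ⬝ᵥ restr P _ + restr P' _ ⬝ᵥ restr P' _ = 0
      rw [restr_placeWord_dotProduct, restr_placeWord_dotProduct, sum_region_add hc]
      change x ⬝ᵥ y = 0
      rw [dotProduct_eq_sum_copy]
      refine Finset.sum_eq_zero fun i _ => ?_
      have := (hL.dual _).1 (hy i) _ (hx i)
      rwa [dotProduct_zero, add_zero] at this
    · intro i j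
      change restr P _ ⬝ᵥ restr P _ = _
      rw [restr_placeWord_dotProduct, Fintype.sum_prod_type, Finset.sum_eq_single i]
      · by_cases hij : i = j
        · subst hij
          rw [if_pos rfl, ← hww' i]
          simp only [inCopy, if_true]
        · rw [if_neg hij]
          refine Finset.sum_eq_zero fun e _ => ?_
          simp only [inCopy, if_neg hij, mul_zero, ite_self]
      · intro k _ hk
        refine Finset.sum_eq_zero fun e _ => ?_
        simp only [inCopy, if_neg hk, zero_mul, ite_self]
      · simp
  · refine (entanglementEntropy_le hφ hnorm).trans ?_
    have hcard : ∀ (P : ZMod N → Prop) [DecidablePred P],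
        Fintype.card ({k // P k} × Slot n R) ≤ N * (n * Fintype.card (Leg R)) := by
      intro P _
      rw [Fintype.card_prod, Fintype.card_prod, Fintype.card_fin]
      refine Nat.mul_le_mul_right _ ((Fintype.card_subtype_le _).trans ?_)
      rw [ZMod.card]
    have h := add_le_add (hcard P) (hcard P')
    have h' : ((Fintype.card ({k // P k} × Slot n R) + Fintype.card ({k // P' k} × Slot n R) : ℕ) : ℝ) ≤
        2 * N * Fintype.card (Leg R) * n := by
      refine (Nat.cast_le.2 h).trans (le_of_eq ?_)
      push_cast
      ring
    calc _ ≤ 2 * N * Fintype.card (Leg R) * n * Real.log 2 :=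
          mul_le_mul_of_nonneg_right h' (Real.log_nonneg one_le_two)
      _ = _ := by ring

end Placed

/-! ### Sites of the lattice -/

section Sites

theorem east_iff_not_west {N : ℕ} (k : ZMod N) : east k ↔ ¬ west k := by
  unfold east west
  omega

theorem south_iff_not_north {N : ℕ} (k : ZMod N) : south k ↔ ¬ north k := by
  unfold south north
  omega

theorem val_eq_emod {j k : ZMod 1024} {m : ℤ} (h : j = k + (m : ZMod 1024)) :
    (j.val : ℤ) = (k.val + m) % 1024 := by
  have : j = ((k.val + m : ℤ) : ZMod 1024) := by
    rw [h, Int.cast_add, Int.cast_natCast, ZMod.natCast_zmod_val]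
  rw [this, ZMod.val_intCast]
  rfl

theorem angDist_lt_iff (j k : ZMod 1024) :
    angDist j k < 2 * Real.pi / 16 ↔ |(j - k).valMinAbs| < 64 := by
  have hpi := Real.pi_pos
  unfold angDist
  rw [show (2 * Real.pi / (1024 : ℕ) * |((j - k).valMinAbs : ℝ)| < 2 * Real.pi / 16) ↔
    |((j - k).valMinAbs : ℝ)| < 64 from ?_]
  · exact_mod_cast Iff.rfl
  · have h : (2 * Real.pi / 16 : ℝ) = 2 * Real.pi / (1024 : ℕ) * 64 := by
      push_cast
      ring
    rw [h]
    exact mul_lt_mul_iff_right₀ (by positivity)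

/-- Every light cone of radius `2π/16` is contained in one of the four half circles. -/
theorem conePart_cover (k : ZMod 1024) :
    conePart north k ∨ conePart south k ∨ conePart west k ∨ conePart east k := by
  have hk := ZMod.val_lt k
  have key : ∀ P : ZMod 1024 → Prop, (∀ (j : ZMod 1024) (m : ℤ), |m| < 64 →
      (j.val : ℤ) = (k.val + m) % 1024 → P j) → conePart P k := by
    intro P hP j hj
    refine hP j _ ((angDist_lt_iff j k).1 hj) (val_eq_emod ?_)
    rw [ZMod.coe_valMinAbs, add_sub_cancel]
  by_cases h1 : k.val ≤ 192 ∨ 832 ≤ k.val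
  · refine Or.inl (key _ fun j m hm hj => ?_)
    rw [abs_lt] at hm
    unfold north
    omega
  by_cases h2 : 320 ≤ k.val ∧ k.val ≤ 704
  · refine Or.inr (Or.inl (key _ fun j m hm hj => ?_))
    rw [abs_lt] at hm
    unfold south
    omega
  by_cases h3 : 576 ≤ k.val
  · refine Or.inr (Or.inr (Or.inl (key _ fun j m hm hj => ?_)))
    rw [abs_lt] at hm
    unfold west
    omega
  · refine Or.inr (Or.inr (Or.inr (key _ fun j m hm hj => ?_)))
    rw [abs_lt] at hm
    unfold east
    omega

theorem val_siteOf (z : ℂ) :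
    ((siteOf 1024 z).val : ℤ) = ⌊(1024 : ℕ) * (Complex.arg z / (2 * Real.pi))⌋ % 1024 := by
  rw [siteOf, ZMod.val_intCast]
  rfl

theorem scaled_lt {x y : ℝ} (h : x < y * (2 * Real.pi)) : (1024 : ℕ) * (x / (2 * Real.pi)) < 1024 * y := by
  have : x / (2 * Real.pi) < y := (div_lt_iff₀ Real.two_pi_pos).2 h
  push_cast
  linarith

theorem le_scaled {x y : ℝ} (h : y * (2 * Real.pi) ≤ x) : 1024 * y ≤ (1024 : ℕ) * (x / (2 * Real.pi)) := by
  have : y ≤ x / (2 * Real.pi) := (le_div_iff₀ Real.two_pi_pos).2 h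
  push_cast
  linarith

theorem west_siteOf {z : ℂ} (h : z.im < 0) : west (siteOf 1024 z) := by
  have h1 := scaled_lt (x := Complex.arg z) (y := 0) (by rw [zero_mul]; exact Complex.arg_neg_iff.2 h)
  have h2 := le_scaled (x := Complex.arg z) (y := -1/2) (by linarith [Complex.neg_pi_lt_arg z])
  have hv := val_siteOf z
  have h3 : ⌊(1024 : ℕ) * (Complex.arg z / (2 * Real.pi))⌋ < 0 := Int.floor_lt.2 (by push_cast at h1 ⊢; linarith)
  have h4 : -512 ≤ ⌊(1024 : ℕ) * (Complex.arg z / (2 * Real.pi))⌋ := Int.le_floor.2 (by push_cast at h2 ⊢; linarith)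
  unfold west
  omega

theorem east_siteOf {z : ℂ} (h : 0 < z.im) : east (siteOf 1024 z) := by
  have h1 := scaled_lt (x := Complex.arg z) (y := 1/2) (by
    have : Complex.arg z ≠ Real.pi := fun h' => h.ne' (Complex.arg_eq_pi_iff.1 h').2
    have := lt_of_le_of_ne (Complex.arg_le_pi z) this
    linarith)
  have h2 := le_scaled (x := Complex.arg z) (y := 0) (by rw [zero_mul]; exact Complex.arg_nonneg_iff.2 h.le)
  have hv := val_siteOf z
  have h3 : ⌊(1024 : ℕ) * (Complex.arg z / (2 * Real.pi))⌋ < 512 := Int.floor_lt.2 (by push_cast at h1 ⊢; linarith)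
  have h4 : 0 ≤ ⌊(1024 : ℕ) * (Complex.arg z / (2 * Real.pi))⌋ := Int.le_floor.2 (by push_cast at h2 ⊢; linarith)
  unfold east
  omega

theorem north_siteOf {z : ℂ} (h : 0 < z.re) : north (siteOf 1024 z) := by
  have ha := abs_lt.1 (Complex.abs_arg_lt_pi_div_two_iff.2 (Or.inl h))
  have h1 := scaled_lt (x := Complex.arg z) (y := 1/4) (by linarith [ha.2])
  have h2 := le_scaled (x := Complex.arg z) (y := -1/4) (by linarith [ha.1])
  have hv := val_siteOf z
  have h3 : ⌊(1024 : ℕ) * (Complex.arg z / (2 * Real.pi))⌋ < 256 := Int.floor_lt.2 (by push_cast at h1 ⊢; linarith)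
  have h4 : -256 ≤ ⌊(1024 : ℕ) * (Complex.arg z / (2 * Real.pi))⌋ := Int.le_floor.2 (by push_cast at h2 ⊢; linarith)
  unfold north
  omega

theorem south_siteOf {z : ℂ} (h : z.re < 0) : south (siteOf 1024 z) := by
  have ha := not_le.1 fun h' => absurd (Complex.abs_arg_le_pi_div_two_iff.1 h') (not_le.2 h)
  have hv := val_siteOf z
  unfold south
  rcases lt_abs.1 ha with ha | ha
  · have h1 := scaled_lt (x := Complex.arg z) (y := 3/4) (by linarith [Complex.arg_le_pi z, Real.pi_pos])
    have h2 := le_scaled (x := Complex.arg z) (y := 1/4) (by linarith)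
    have h3 : ⌊(1024 : ℕ) * (Complex.arg z / (2 * Real.pi))⌋ < 768 := Int.floor_lt.2 (by push_cast at h1 ⊢; linarith)
    have h4 : 256 ≤ ⌊(1024 : ℕ) * (Complex.arg z / (2 * Real.pi))⌋ := Int.le_floor.2 (by push_cast at h2 ⊢; linarith)
    omega
  · have h1 := scaled_lt (x := Complex.arg z) (y := -1/4) (by linarith)
    have h2 := le_scaled (x := Complex.arg z) (y := -1/2) (by linarith [Complex.neg_pi_lt_arg z])
    have h3 : ⌊(1024 : ℕ) * (Complex.arg z / (2 * Real.pi))⌋ < -256 := Int.floor_lt.2 (by push_cast at h1 ⊢; linarith)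
    have h4 : -512 ≤ ⌊(1024 : ℕ) * (Complex.arg z / (2 * Real.pi))⌋ := Int.le_floor.2 (by push_cast at h2 ⊢; linarith)
    omega

theorem abs_arg_one_add_le {u : ℂ} {x : ℝ} (hx : x < Real.pi / 2) (hx0 : 0 ≤ x)
    (hu : ‖u‖ ≤ Real.sin x) (hs : Real.sin x < 1) : |Complex.arg (1 + u)| ≤ x := by
  have hre : 0 < (1 + u).re := by
    have := Complex.abs_re_le_norm u
    have := (abs_le.1 this).1
    rw [Complex.add_re, Complex.one_re]
    linarith
  have hne : 1 + u ≠ 0 := fun h => by rw [h] at hre; exact lt_irrefl _ hre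
  have hn : 0 < ‖1 + u‖ := norm_pos_iff.2 hne
  rw [Complex.arg_of_re_nonneg hre.le]
  have hs0 : 0 ≤ Real.sin x := (norm_nonneg u).trans hu
  have key : |(1 + u).im / ‖1 + u‖| ≤ Real.sin x := by
    rw [abs_div, abs_of_pos hn, div_le_iff₀ hn]
    refine abs_le_of_sq_le_sq ?_ (by positivity)
    rw [mul_pow, ← Complex.normSq_eq_norm_sq, Complex.normSq_apply]
    have h1 : u.re * u.re + u.im * u.im ≤ Real.sin x ^ 2 := by
      rw [← Complex.normSq_apply, Complex.normSq_eq_norm_sq]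
      exact pow_le_pow_left₀ (norm_nonneg u) hu 2
    rw [Complex.add_im, Complex.one_im, zero_add, Complex.add_re, Complex.one_re]
    have hs1 : 0 ≤ 1 - Real.sin x ^ 2 := by nlinarith
    nlinarith [sq_nonneg (u.re + Real.sin x ^ 2), mul_nonneg hs1 (sub_nonneg.2 h1)]
  have hk := abs_le.1 key
  rw [abs_le]
  constructor
  · rw [← Real.arcsin_sin (x := x) (by linarith) hx.le, ← Real.arcsin_neg]
    exact Real.arcsin_le_arcsin hk.1
  · rw [← Real.arcsin_sin (x := x) (by linarith) hx.le, Real.arcsin_sin (by linarith) hx.le]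
    calc _ ≤ Real.arcsin (Real.sin x) := Real.arcsin_le_arcsin hk.2
      _ = x := Real.arcsin_sin (by linarith) hx.le

theorem natAbs_valMinAbs_le_of_intCast {j k : ZMod 1024} {m : ℤ} (h : j - k = (m : ZMod 1024))
    (hm : |m| < 64) : |(j - k).valMinAbs| < 64 := by
  have : (j - k).valMinAbs = m := by
    rw [ZMod.valMinAbs_spec]
    rw [abs_lt] at hm
    exact ⟨h, by constructor <;> push_cast <;> omega⟩
  rwa [this]

/-- Moving a point of the annulus that contains the legs by `4/25` moves its site by less than a
sixteenth of the circle. -/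
theorem angDist_siteOf_discTranslate {w z : ℂ} (hw : ‖w‖ ≤ 4 / 25) (hz : 59 / 100 ≤ ‖z‖)
    (hz' : ‖z‖ ≤ 67 / 100) :
    angDist (siteOf 1024 (discTranslate w z)) (siteOf 1024 z) < 2 * Real.pi / 16 := by
  have hz0 : z ≠ 0 := norm_pos_iff.1 (by linarith)
  have hpi := Real.pi_gt_d2
  have h1 : |Complex.arg (1 + w / z)| ≤ 553 / 2000 := by
    refine abs_arg_one_add_le (by linarith) (by norm_num) ?_ ((Real.sin_lt (by norm_num)).trans (by norm_num))
    have := Real.sin_gt_sub_cube (x := 553 / 2000) (by norm_num)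
    rw [norm_div]
    calc ‖w‖ / ‖z‖ ≤ (4 / 25) / (59 / 100) := by gcongr
      _ ≤ _ := le_trans (by norm_num) this.le
  have h2 : |Complex.arg (1 + star w * z)| ≤ 269 / 2500 := by
    refine abs_arg_one_add_le (by linarith) (by norm_num) ?_ ((Real.sin_lt (by norm_num)).trans (by norm_num))
    have := Real.sin_gt_sub_cube (x := 269 / 2500) (by norm_num)
    rw [norm_mul, norm_star]
    calc ‖w‖ * ‖z‖ ≤ (4 / 25) * (67 / 100) := by gcongr
      _ ≤ _ := le_trans (by norm_num) this.le
  have hA : 1 + w / z ≠ 0 := by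
    intro h
    rw [h, Complex.arg_zero, abs_zero] at h1
    have hwz : w / z = -1 := by linear_combination h
    have := congrArg norm hwz
    rw [norm_div, norm_neg, norm_one, div_eq_one_iff_eq (by linarith)] at this
    linarith
  have hB : 1 + star w * z ≠ 0 := by
    intro h
    have hwz : star w * z = -1 := by linear_combination h
    have := congrArg norm hwz
    rw [norm_mul, norm_star, norm_neg, norm_one] at this
    nlinarith [norm_nonneg w, norm_nonneg z]
  have hd : discTranslate w z = z * ((1 + w / z) / (1 + star w * z)) := by
    unfold discTranslate
    field_simp
  have hang : ((Complex.arg (discTranslate w z) : ℝ) : Real.Angle) =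
      ((Complex.arg z + (Complex.arg (1 + w / z) - Complex.arg (1 + star w * z)) : ℝ) : Real.Angle) := by
    rw [hd, Complex.arg_mul_coe_angle hz0 (div_ne_zero hA hB), Complex.arg_div_coe_angle hA hB]
    rfl
  obtain ⟨k, hk⟩ := Real.Angle.angle_eq_iff_two_pi_dvd_sub.1 hang
  set α := Complex.arg (1 + w / z) - Complex.arg (1 + star w * z) with hα
  have hαle : |α| ≤ 3841 / 10000 := by
    refine (abs_sub _ _).trans ?_
    linarith
  set x := ((1024 : ℕ) : ℝ) * (Complex.arg z / (2 * Real.pi)) with hx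
  set x' := ((1024 : ℕ) : ℝ) * (Complex.arg (discTranslate w z) / (2 * Real.pi)) with hx'
  have hdiff : x' - x - 1024 * k = 1024 * α / (2 * Real.pi) := by
    have : Complex.arg (discTranslate w z) = Complex.arg z + α + 2 * Real.pi * k := by linarith
    rw [hx', hx, this]
    have := Real.pi_ne_zero
    push_cast
    field_simp
    ring
  have hsmall : |x' - x - 1024 * k| < 63 := by
    rw [hdiff, abs_div, abs_of_pos Real.two_pi_pos, div_lt_iff₀ Real.two_pi_pos, abs_mul,
      abs_of_pos (by norm_num : (0 : ℝ) < 1024)]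
    linarith
  rw [angDist_lt_iff]
  refine natAbs_valMinAbs_le_of_intCast (m := ⌊x'⌋ - ⌊x⌋ - 1024 * k) ?_ ?_
  · have h1024 : ((1024 : ℤ) : ZMod 1024) = 0 := rfl
    rw [Int.cast_sub, Int.cast_mul, h1024, zero_mul, sub_zero, Int.cast_sub]
    rfl
  · have e1 := Int.floor_le x
    have e2 := Int.lt_floor_add_one x
    have e3 := Int.floor_le x'
    have e4 := Int.lt_floor_add_one x'
    have e5 := abs_lt.1 hsmall
    have : |((⌊x'⌋ - ⌊x⌋ - 1024 * k : ℤ) : ℝ)| < 64 := by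
      push_cast
      rw [abs_lt]
      constructor <;> linarith [e5.1, e5.2]
    exact_mod_cast this

end Sites

/-! ### The sides of the first layer of tiles -/

section Numerics

/-- The seventh roots of unity. -/
noncomputable def root : AddChar (ZMod 7) ℂ := ZMod.stdAddChar

theorem root_eq_exp (k : ZMod 7) : root k = Complex.exp (2 * Real.pi * Complex.I * (k.val : ℂ) / 7) := by
  rw [root, ZMod.stdAddChar_apply, ZMod.toCircle_apply]
  rfl

theorem norm_root (k : ZMod 7) : ‖root k‖ = 1 := Circle.norm_coe _

theorem star_root_mul_root (k : ZMod 7) : star (root k) * root k = 1 := by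
  have := Complex.conj_mul' (root k)
  rw [norm_root, Complex.ofReal_one, one_pow] at this
  exact this

theorem root_neg (k : ZMod 7) : root (-k) = star (root k) := by
  have h : root (-k) * root k = 1 := by rw [← AddChar.map_add_eq_mul, neg_add_cancel, AddChar.map_zero_eq_one]
  have h' := star_root_mul_root k
  exact mul_right_cancel₀ (fun h0 => by rw [h0, mul_zero] at h; exact zero_ne_one h) (h.trans h'.symm)

/-- Twice the sine of half the angle of a heptagon's side, as seen from the centre. -/
noncomputable def chord : ℝ := 2 * Real.sin (Real.pi / 7)

theorem cos_bounds : 6234895 / 10000000 < Real.cos (2 * Real.pi / 7) ∧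
    Real.cos (2 * Real.pi / 7) < 6234899 / 10000000 := by
  set c := Real.cos (2 * Real.pi / 7) with hc
  have hpi := Real.pi_pos
  have h34 : Real.cos (3 * (2 * Real.pi / 7)) = Real.cos (2 * (2 * (2 * Real.pi / 7))) := by
    rw [← Real.cos_two_pi_sub]
    congr 1
    ring
  rw [Real.cos_three_mul, Real.cos_two_mul, Real.cos_two_mul, ← hc] at h34
  have h1 : c < 1 := by
    rw [hc, ← Real.cos_zero]
    exact Real.cos_lt_cos_of_nonneg_of_le_pi le_rfl (by linarith) (by positivity)
  have h2 : 1 / 2 < c := by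
    rw [hc, ← Real.cos_pi_div_three]
    exact Real.cos_lt_cos_of_nonneg_of_le_pi (by positivity) (by linarith) (by linarith)
  have hp : 8 * c ^ 3 + 4 * c ^ 2 - 4 * c - 1 = 0 := by
    have : (c - 1) * (8 * c ^ 3 + 4 * c ^ 2 - 4 * c - 1) = 0 := by linear_combination -h34
    exact (mul_eq_zero.1 this).resolve_left (by linarith)
  constructor
  · by_contra h
    nlinarith [mul_nonneg (sub_nonneg.2 (not_lt.1 h)) (sub_nonneg.2 h2.le), mul_nonneg (mul_nonneg (sub_nonneg.2 (not_lt.1 h)) (sub_nonneg.2 h2.le)) (sub_nonneg.2 h2.le)]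
  · by_contra h
    nlinarith [mul_nonneg (sub_nonneg.2 (not_lt.1 h)) (sub_nonneg.2 h2.le), mul_nonneg (mul_nonneg (sub_nonneg.2 (not_lt.1 h)) (sub_nonneg.2 h2.le)) (sub_nonneg.2 h2.le)]

theorem sin_bounds : 781831 / 1000000 < Real.sin (2 * Real.pi / 7) ∧
    Real.sin (2 * Real.pi / 7) < 781832 / 1000000 := by
  have hs : 0 < Real.sin (2 * Real.pi / 7) := Real.sin_pos_of_pos_of_lt_pi (by positivity) (by linarith [Real.pi_pos])
  have h := Real.sin_sq_add_cos_sq (2 * Real.pi / 7)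
  obtain ⟨h1, h2⟩ := cos_bounds
  constructor <;> nlinarith

theorem chord_sq : chord ^ 2 = 2 - 2 * Real.cos (2 * Real.pi / 7) := by
  have h := Real.sin_sq_eq_half_sub (Real.pi / 7)
  rw [chord, mul_pow, h, mul_div_assoc]
  ring

theorem chord_bounds : 867766 / 1000000 < chord ∧ chord < 867769 / 1000000 := by
  have hs : 0 < chord := mul_pos two_pos (Real.sin_pos_of_pos_of_lt_pi (by positivity) (by linarith [Real.pi_pos]))
  have h := chord_sq
  obtain ⟨h1, h2⟩ := cos_bounds
  constructor <;> nlinarith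

theorem sideRadius_eq : sideRadius = Real.sqrt ((1 - chord) / (1 + chord)) := rfl

theorem sideRadius_sq : sideRadius ^ 2 = (1 - chord) / (1 + chord) := by
  obtain ⟨h1, h2⟩ := chord_bounds
  rw [sideRadius_eq, Real.sq_sqrt]
  exact div_nonneg (by linarith) (by linarith)

theorem sideRadius_sq_mul : sideRadius ^ 2 * (1 + chord) = 1 - chord := by
  rw [sideRadius_sq, div_mul_cancel₀]
  linarith [chord_bounds.1]

theorem sideRadius_bounds : 266075 / 1000000 < sideRadius ∧ sideRadius < 266079 / 1000000 := by
  have hs : 0 ≤ sideRadius := Real.sqrt_nonneg _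
  have h := sideRadius_sq_mul
  obtain ⟨h1, h2⟩ := chord_bounds
  constructor <;> nlinarith

theorem norm_mk_le {a b r : ℝ} (hr : 0 ≤ r) (h : a * a + b * b ≤ r ^ 2) : ‖(⟨a, b⟩ : ℂ)‖ ≤ r := by
  refine abs_le_of_sq_le_sq' ?_ hr |>.2
  rwa [← Complex.normSq_eq_norm_sq, Complex.normSq_apply]

/-- Approximations of the seventh roots of unity, in units of `10⁻⁶`. -/
def rootTable : ZMod 7 → ℤ × ℤ :=
  (![(1000000, 0), (623490, 781831), (-222521, 974928), (-900969, 433884), (-900969, -433884),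
    (-222521, -974928), (623490, -781831)] : Fin 7 → ℤ × ℤ)

/-- Approximations of the midpoints of sides of the tile in direction `0`, in units of `10⁻⁵`. -/
def sideTable : Fin 6 → ℤ × ℤ :=
  ![(26608, 0), (38152, -18373), (56301, -18148), (66182, -6923), (66182, 6923), (56301, 18148)]

/-- The complex number with the given coordinates in units of `1 / S`. -/
noncomputable def scaled (S : ℕ) (p : ℤ × ℤ) : ℂ := ⟨p.1 / S, p.2 / S⟩

theorem norm_root_one_sub : ‖root 1 - scaled 1000000 (623490, 781831)‖ ≤ 12 / 10000000 := by
  have h : root 1 = ⟨Real.cos (2 * Real.pi / 7), Real.sin (2 * Real.pi / 7)⟩ := by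
    rw [root_eq_exp, show (1 : ZMod 7).val = 1 from rfl, Nat.cast_one,
      show 2 * (Real.pi : ℂ) * Complex.I * 1 / 7 = ((2 * Real.pi / 7 : ℝ) : ℂ) * Complex.I by
        push_cast; ring]
    apply Complex.ext
    · exact Complex.exp_ofReal_mul_I_re _
    · exact Complex.exp_ofReal_mul_I_im _
  rw [h]
  obtain ⟨h1, h2⟩ := cos_bounds
  obtain ⟨h3, h4⟩ := sin_bounds
  refine norm_mk_le (by norm_num) ?_
  simp only [scaled]
  push_cast
  nlinarith

theorem norm_mul_sub_le {z w z' w' v : ℂ} {δ ε η : ℝ} (hz : ‖z‖ = 1) (hw' : ‖w'‖ ≤ 101 / 100) (h : ‖w - w'‖ ≤ δ)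
    (h' : ‖z - z'‖ ≤ ε) (hv : ‖z' * w' - v‖ ≤ η) : ‖z * w - v‖ ≤ δ + 101 / 100 * ε + η := by
  have : z * w - v = z * (w - w') + w' * (z - z') + (z' * w' - v) := by ring
  rw [this]
  refine norm_add₃_le.trans ?_
  rw [norm_mul, norm_mul, hz, one_mul]
  have := mul_le_mul hw' h' (norm_nonneg _) (by norm_num)
  linarith

theorem scaled_mul_sub (S : ℕ) (hS : S ≠ 0) (p q r : ℤ × ℤ) :
    scaled S p * scaled S q - scaled S r =
      ⟨(p.1 * q.1 - p.2 * q.2 - S * r.1) / S ^ 2, (p.1 * q.2 + p.2 * q.1 - S * r.2) / S ^ 2⟩ := by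
  have : (S : ℝ) ≠ 0 := Nat.cast_ne_zero.2 hS
  apply Complex.ext
  · simp only [scaled, Complex.sub_re, Complex.mul_re]
    field_simp
  · simp only [scaled, Complex.sub_im, Complex.mul_im]
    field_simp

theorem norm_root_sub (k : ZMod 7) : ‖root k - scaled 1000000 (rootTable k)‖ ≤ 1 / 100000 := by
  have h1 := norm_root_one_sub
  have h2 : ‖root 2 - scaled 1000000 (-222521, 974928)‖ ≤ 37 / 10000000 := by
    rw [show (2 : ZMod 7) = 1 + 1 from rfl, AddChar.map_add_eq_mul]
    refine (norm_mul_sub_le (η := 12 / 10000000) (norm_root 1) ?_ h1 h1 ?_).trans (by norm_num)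
    · exact norm_mk_le (by norm_num) (by norm_num)
    · rw [scaled_mul_sub _ (by norm_num)]
      exact norm_mk_le (by norm_num) (by norm_num)
  have h3 : ‖root 3 - scaled 1000000 (-900969, 433884)‖ ≤ 1 / 100000 := by
    rw [show (3 : ZMod 7) = 1 + 2 from rfl, AddChar.map_add_eq_mul]
    refine (norm_mul_sub_le (η := 2 / 1000000) (norm_root 1) ?_ h2 h1 ?_).trans (by norm_num)
    · exact norm_mk_le (by norm_num) (by norm_num)
    · rw [scaled_mul_sub _ (by norm_num)]
      exact norm_mk_le (by norm_num) (by norm_num)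
  have hneg : ∀ (k : ZMod 7) (a b : ℤ) (r : ℝ), ‖root k - scaled 1000000 (a, b)‖ ≤ r →
      ‖root (-k) - scaled 1000000 (a, -b)‖ ≤ r := by
    intro k a b r h
    have : root (-k) - scaled 1000000 (a, -b) = star (root k - scaled 1000000 (a, b)) := by
      rw [root_neg, star_sub]
      congr 1
      apply Complex.ext
      · simp [scaled]
      · simp [scaled, neg_div]
    rwa [this, norm_star]
  have h0 : ‖root 0 - scaled 1000000 (1000000, 0)‖ ≤ 1 / 100000 := by
    rw [AddChar.map_zero_eq_one]
    have : (1 : ℂ) - scaled 1000000 (1000000, 0) = 0 := by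
      apply Complex.ext <;> simp [scaled]
    rw [this, norm_zero]
    norm_num
  fin_cases k
  · exact h0
  · exact h1.trans (by norm_num)
  · exact h2.trans (by norm_num)
  · exact h3
  · exact hneg 3 _ _ _ h3
  · exact (hneg 2 _ _ _ h2).trans (by norm_num)
  · exact (hneg 1 _ _ _ h1).trans (by norm_num)

/-- The midpoint of a side of the tile in direction `0`, in terms of the direction of the midpoint
of the corresponding side of the central tile. -/
noncomputable def ringSide (z : ℂ) : ℂ :=
  sideRadius * (1 + chord - z) / (1 - (1 - chord) * z)

theorem chord_le_norm {z : ℂ} (hz : ‖z‖ = 1) : chord ≤ ‖1 - (1 - chord) * z‖ := by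
  have h := norm_sub_norm_le (1 : ℂ) ((1 - chord) * z)
  have h1 : ‖((1 : ℂ) - chord) * z‖ = 1 - chord := by
    rw [norm_mul, hz, mul_one, show (1 : ℂ) - chord = ((1 - chord : ℝ) : ℂ) by push_cast; rfl,
      Complex.norm_real, Real.norm_of_nonneg]
    linarith [chord_bounds.2]
  rw [h1, norm_one] at h
  linarith

theorem norm_ringSide_sub {z z₀ H : ℂ} (hz : ‖z‖ = 1) (hz₀ : ‖z - z₀‖ ≤ 1 / 100000) (hH : ‖H‖ ≤ 1)
    (h : ‖(266077 / 1000000 : ℝ) * (1 + (867767 / 1000000 : ℝ) - z₀) -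
      H * (1 - (1 - (867767 / 1000000 : ℝ)) * z₀)‖ ≤ 1 / 100000) :
    ‖ringSide z - H‖ ≤ 1 / 10000 := by
  obtain ⟨ht1, ht2⟩ := chord_bounds
  obtain ⟨hs1, hs2⟩ := sideRadius_bounds
  have hd := chord_le_norm hz
  have hd0 : 1 - (1 - (chord : ℂ)) * z ≠ 0 := norm_pos_iff.1 (by linarith)
  set s₀ : ℝ := 266077 / 1000000
  set t₀ : ℝ := 867767 / 1000000
  have hs : ‖((sideRadius : ℂ) - s₀)‖ ≤ 2 / 1000000 := by
    rw [← Complex.ofReal_sub, Complex.norm_real, Real.norm_eq_abs, abs_le]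
    constructor <;> simp only [s₀] <;> linarith
  have ht : ‖((chord : ℂ) - t₀)‖ ≤ 2 / 1000000 := by
    rw [← Complex.ofReal_sub, Complex.norm_real, Real.norm_eq_abs, abs_le]
    constructor <;> simp only [t₀] <;> linarith
  have hnum : ‖sideRadius * (1 + chord - z) - H * (1 - (1 - chord) * z)‖ ≤ 4 / 100000 := by
    have : sideRadius * (1 + chord - z) - H * (1 - (1 - chord) * z) =
      (sideRadius - s₀) * (1 + chord - z) + s₀ * ((chord - t₀) - (z - z₀)) +
        -H * ((chord - t₀) * z - (1 - t₀) * (z - z₀)) +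
      (s₀ * (1 + t₀ - z₀) - H * (1 - (1 - t₀) * z₀)) := by ring
    rw [this]
    have e1 : ‖((sideRadius : ℂ) - s₀) * (1 + chord - z)‖ ≤ 2 / 1000000 * 3 := by
      rw [norm_mul]
      refine mul_le_mul hs ?_ (norm_nonneg _) (by norm_num)
      refine (norm_sub_le _ _).trans ?_
      rw [hz, ← Complex.ofReal_one, ← Complex.ofReal_add, Complex.norm_real, Real.norm_of_nonneg (by linarith)]
      linarith
    have e2 : ‖(s₀ : ℂ) * ((chord - t₀) - (z - z₀))‖ ≤ 1 / 2 * (2 / 1000000 + 1 / 100000) := by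
      rw [norm_mul]
      refine mul_le_mul ?_ ((norm_sub_le _ _).trans (add_le_add ht hz₀)) (norm_nonneg _) (by norm_num)
      rw [Complex.norm_real, Real.norm_of_nonneg] <;> norm_num [s₀]
    have e3 : ‖-H * (((chord : ℂ) - t₀) * z - (1 - t₀) * (z - z₀))‖ ≤
        1 * (2 / 1000000 + 1 / 2 * (1 / 100000)) := by
      rw [norm_mul, norm_neg]
      refine mul_le_mul hH ((norm_sub_le _ _).trans (add_le_add ?_ ?_)) (norm_nonneg _) (by norm_num)
      · rw [norm_mul, hz, mul_one]
        exact ht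
      · rw [norm_mul]
        refine mul_le_mul ?_ hz₀ (norm_nonneg _) (by norm_num)
        rw [← Complex.ofReal_one, ← Complex.ofReal_sub, Complex.norm_real, Real.norm_of_nonneg] <;> norm_num [t₀]
    refine (norm_add_le _ _).trans ?_
    have := norm_add₃_le (a := ((sideRadius : ℂ) - s₀) * (1 + chord - z)) (b := (s₀ : ℂ) * ((chord - t₀) - (z - z₀)))
      (c := -H * (((chord : ℂ) - t₀) * z - (1 - t₀) * (z - z₀)))
    linarith
  have : ringSide z - H = (sideRadius * (1 + chord - z) - H * (1 - (1 - chord) * z)) / (1 - (1 - chord) * z) := by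
    rw [ringSide, sub_div, mul_div_cancel_right₀ _ hd0]
  rw [this, norm_div, div_le_iff₀ (by linarith)]
  linarith

theorem norm_approx_le (S S' : ℕ) (p q : ℤ × ℤ) (s t r : ℝ) (hr : 0 ≤ r)
    (h : (s * (1 + t - p.1 / S) - (q.1 / S' * (1 - (1 - t) * (p.1 / S)) +
        q.2 / S' * ((1 - t) * (p.2 / S)))) ^ 2 +
      (s * (p.2 / S) + (q.2 / S' * (1 - (1 - t) * (p.1 / S)) -
        q.1 / S' * ((1 - t) * (p.2 / S)))) ^ 2 ≤ r ^ 2) :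
    ‖(s : ℂ) * (1 + t - scaled S p) - scaled S' q * (1 - (1 - t) * scaled S p)‖ ≤ r := by
  refine abs_le_of_sq_le_sq' ?_ hr |>.2
  refine le_trans (le_of_eq ?_) h
  rw [← Complex.normSq_eq_norm_sq, Complex.normSq_apply]
  simp [scaled]
  ring

theorem norm_ringSide_root_sub (o : Fin 6) :
    ‖ringSide (root (o.val : ZMod 7)) - scaled 100000 (sideTable o)‖ ≤ 1 / 10000 := by
  refine norm_ringSide_sub (norm_root _) (norm_root_sub _) ?_ ?_
  · fin_cases o <;> exact norm_mk_le (by norm_num) (by norm_num [sideTable])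
  · refine norm_approx_le _ _ _ _ _ _ _ (by norm_num) ?_
    have h : rootTable (o.val : ZMod 7) = (![(1000000, 0), (623490, 781831), (-222521, 974928),
        (-900969, 433884), (-900969, -433884), (-222521, -974928)] : Fin 6 → ℤ × ℤ) o := by
      revert o
      decide
    rw [h]
    fin_cases o <;> norm_num [sideTable]

end Numerics

section Geometry

/-- The half-turn about a side midpoint of the central tile, up to a rotation. -/
theorem halfTurn_sideRadius {z : ℂ} (hz : ‖z‖ = 1) :
    halfTurn sideRadius (sideRadius * z) = ringSide z := by
  obtain ⟨ht1, ht2⟩ := chord_bounds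
  obtain ⟨hs1, hs2⟩ := sideRadius_bounds
  have hstar : star (sideRadius : ℂ) = sideRadius := Complex.conj_ofReal _
  have hsq : (sideRadius : ℂ) ^ 2 * (1 + chord) = 1 - chord := by
    have := congrArg (fun x : ℝ => (x : ℂ)) sideRadius_sq_mul
    push_cast at this
    exact this
  have h1 : 1 - (sideRadius : ℂ) * (sideRadius * z) ≠ 0 := by
    intro h
    have h' : (sideRadius : ℂ) * (sideRadius * z) = 1 := by linear_combination -h
    have := congrArg norm h'
    rw [norm_mul, norm_mul, hz, Complex.norm_real, Real.norm_of_nonneg (by linarith), norm_one] at this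
    nlinarith
  have hd0 : 1 - (1 - (chord : ℂ)) * z ≠ 0 := norm_pos_iff.1 (by linarith [chord_le_norm hz])
  have ht0 : (1 + (chord : ℂ)) ≠ 0 := by
    rw [← Complex.ofReal_one, ← Complex.ofReal_add]
    exact Complex.ofReal_ne_zero.2 (by linarith)
  have e1 : discTranslate (-sideRadius) (sideRadius * z) =
      (sideRadius * z - sideRadius) / (1 - sideRadius * (sideRadius * z)) := by
    rw [discTranslate, star_neg, hstar]
    ring
  have h2 : 1 + (sideRadius : ℂ) * -((sideRadius * z - sideRadius) / (1 - sideRadius * (sideRadius * z))) =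
      2 * (1 - (1 - chord) * z) / ((1 + chord) * (1 - sideRadius * (sideRadius * z))) := by
    rw [eq_div_iff (mul_ne_zero ht0 h1)]
    have : (1 + (sideRadius : ℂ) * -((sideRadius * z - sideRadius) /
        (1 - sideRadius * (sideRadius * z)))) * ((1 + chord) * (1 - sideRadius * (sideRadius * z))) =
        (1 + chord) * ((1 - sideRadius * (sideRadius * z)) - sideRadius * (sideRadius * z - sideRadius)) := by
      generalize 1 - (sideRadius : ℂ) * (sideRadius * z) = D at h1
      field_simp
      ring
    rw [this]
    linear_combination (1 - 2 * z) * hsq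
  have h3 : -((sideRadius * z - sideRadius) / (1 - sideRadius * (sideRadius * z))) + (sideRadius : ℂ) =
      2 * (sideRadius * (1 + chord - z)) / ((1 + chord) * (1 - sideRadius * (sideRadius * z))) := by
    rw [eq_div_iff (mul_ne_zero ht0 h1)]
    have : (-((sideRadius * z - sideRadius) / (1 - sideRadius * (sideRadius * z))) + (sideRadius : ℂ)) *
        ((1 + chord) * (1 - sideRadius * (sideRadius * z))) =
        (1 + chord) * (-(sideRadius * z - sideRadius) + sideRadius * (1 - sideRadius * (sideRadius * z))) := by
      generalize 1 - (sideRadius : ℂ) * (sideRadius * z) = D at h1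
      field_simp
    rw [this]
    linear_combination (-sideRadius * z) * hsq
  rw [halfTurn, e1, discTranslate, hstar, h2, h3, ringSide]
  have := mul_ne_zero ht0 h1
  rw [div_div_div_cancel_right₀ this, mul_div_mul_left _ _ two_ne_zero]

theorem discTranslate_mul {r : ℂ} (hr : star r * r = 1) (e z : ℂ) :
    discTranslate (r * e) (r * z) = r * discTranslate e z := by
  rw [discTranslate, discTranslate, star_mul', show star r * star e * (r * z) = star e * z by
    linear_combination (star e * z) * hr]
  ring

theorem halfTurn_mul {r : ℂ} (hr : star r * r = 1) (e z : ℂ) :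
    halfTurn (r * e) (r * z) = r * halfTurn e z := by
  rw [halfTurn, halfTurn, ← mul_neg, discTranslate_mul hr, ← mul_neg, discTranslate_mul hr]

theorem ringSide_one : ringSide 1 = sideRadius := by
  have h : (chord : ℂ) ≠ 0 := Complex.ofReal_ne_zero.2 (by linarith [chord_bounds.1])
  rw [ringSide, show (1 : ℂ) + chord - 1 = chord by ring, show (1 : ℂ) - (1 - chord) * 1 = chord by ring,
    mul_div_cancel_right₀ _ h]

theorem root_one_add_star : root 1 + star (root 1) = 2 - (chord : ℂ) ^ 2 := by
  have h : root 1 = Complex.exp (((2 * Real.pi / 7 : ℝ) : ℂ) * Complex.I) := by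
    rw [root_eq_exp, show (1 : ZMod 7).val = 1 from rfl, Nat.cast_one]
    congr 1
    push_cast
    ring
  have h2 : root 1 + star (root 1) = ((2 * Real.cos (2 * Real.pi / 7) : ℝ) : ℂ) := by
    rw [← Complex.exp_ofReal_mul_I_re, ← h]
    exact Complex.add_conj _
  rw [h2, ← Complex.ofReal_pow, chord_sq]
  push_cast
  ring

/-- The last side of a tile of the first layer before the common side with the next one. -/
theorem root_one_mul_ringSide : root 1 * ringSide (root 1) = ringSide (root (-1)) := by
  have h1 := norm_pos_iff.1 ((by linarith [chord_bounds.1] : (0 : ℝ) < chord).trans_le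
    (chord_le_norm (norm_root 1)))
  have h2 := norm_pos_iff.1 ((by linarith [chord_bounds.1] : (0 : ℝ) < chord).trans_le
    (chord_le_norm (norm_root (-1))))
  rw [root_neg] at h2 ⊢
  have h3 := root_one_add_star
  have h4 := star_root_mul_root 1
  rw [ringSide, ringSide, ← mul_div_assoc, div_eq_div_iff h1 h2]
  linear_combination (sideRadius : ℂ) * (1 - (1 - (chord : ℂ) ^ 2) + (1 - chord) * root 1 - (1 - chord)) * h4 +
    (sideRadius : ℂ) * (1 - root 1) * h3

/-- Sides within the first layer: the side `(k, 0)` is the common side of the central tile and the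
tile in direction `k`, and the sides `(k, 0), …, (k, 5), (k + 1, 1)` are the sides of the latter in
counterclockwise order. -/
abbrev SideIdx : Type := ZMod 7 × Fin 6

/-- The midpoint of a side. -/
noncomputable def pos (q : SideIdx) : ℂ := root q.1 * ringSide (root (q.2.val : ZMod 7))

/-- Approximate midpoints of the sides, in units of `10⁻¹¹`. -/
def posTable (q : SideIdx) : ℤ × ℤ :=
  ((rootTable q.1).1 * (sideTable q.2).1 - (rootTable q.1).2 * (sideTable q.2).2,
    (rootTable q.1).1 * (sideTable q.2).2 + (rootTable q.1).2 * (sideTable q.2).1)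

theorem norm_pos_sub (q : SideIdx) :
    ‖pos q - scaled 100000000000 (posTable q)‖ ≤ 12 / 100000 := by
  have h1 := norm_root_sub q.1
  have h2 := norm_ringSide_root_sub q.2
  have h3 : ‖scaled 100000 (sideTable q.2)‖ ≤ 1 := by
    generalize q.2 = o
    fin_cases o <;> exact norm_mk_le (by norm_num) (by norm_num [sideTable])
  have : pos q - scaled 100000000000 (posTable q) =
      root q.1 * (ringSide (root (q.2.val : ZMod 7)) - scaled 100000 (sideTable q.2)) +
        scaled 100000 (sideTable q.2) * (root q.1 - scaled 1000000 (rootTable q.1)) := by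
    have h : scaled 100000000000 (posTable q) =
        scaled 1000000 (rootTable q.1) * scaled 100000 (sideTable q.2) := by
      apply Complex.ext
      · simp only [scaled, posTable, Complex.mul_re]
        push_cast
        ring
      · simp only [scaled, posTable, Complex.mul_im]
        push_cast
        ring
    rw [h, pos]
    ring
  rw [this]
  refine (norm_add_le _ _).trans ?_
  rw [norm_mul, norm_mul, norm_root, one_mul]
  have := mul_le_mul h3 h1 (norm_nonneg _) zero_le_one
  linarith

theorem posTable_injective : ∀ q q' : SideIdx,
    |(posTable q).1 - (posTable q').1| ≤ 24000000 → |(posTable q).2 - (posTable q').2| ≤ 24000000 →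
      q = q' := by
  decide +kernel

theorem pos_injective : Function.Injective pos := by
  intro q q' h
  have h1 := norm_pos_sub q
  have h2 := norm_pos_sub q'
  rw [← h] at h2
  have h3 : ‖scaled 100000000000 (posTable q) - scaled 100000000000 (posTable q')‖ ≤ 24 / 100000 := by
    have : scaled 100000000000 (posTable q) - scaled 100000000000 (posTable q') =
      (pos q - scaled 100000000000 (posTable q')) - (pos q - scaled 100000000000 (posTable q)) := by ring
    rw [this]
    exact (norm_sub_le _ _).trans (by linarith)
  have key : ∀ a b : ℤ, |(a / (100000000000 : ℕ) - b / (100000000000 : ℕ) : ℝ)| ≤ 24 / 100000 →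
      |a - b| ≤ 24000000 := by
    intro a b hab
    rw [← sub_div, abs_div, div_le_iff₀ (by norm_num)] at hab
    have : (|a - b| : ℝ) ≤ 24000000 := hab.trans (by norm_num)
    exact_mod_cast this
  exact posTable_injective q q' (key _ _ ((Complex.abs_re_le_norm _).trans h3))
    (key _ _ ((Complex.abs_im_le_norm _).trans h3))

/-- The sides of the tile in direction `k`, in counterclockwise order. -/
def ringIdx (k m : ZMod 7) : SideIdx := if h : m.val < 6 then (k, ⟨m.val, h⟩) else (k + 1, 1)

theorem pos_ringIdx (k m : ZMod 7) : pos (ringIdx k m) = root k * ringSide (root m) := by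
  unfold ringIdx
  split_ifs with h
  · rw [pos, ZMod.natCast_zmod_val]
  · have hm : m = -1 := by
      revert m
      decide
    rw [pos, hm, ← root_one_mul_ringSide, AddChar.map_add_eq_mul, mul_assoc]
    rfl

/-- The sides of the tiles within the first layer: the central tile and the tiles in the
directions `k`. -/
def frameIdx : Option (ZMod 7) → ZMod 7 → SideIdx
  | none => fun j => (j, 0)
  | some k => fun j => ringIdx k (j - k)

theorem centralFrame_apply (k : ZMod 7) : centralFrame k = root k * sideRadius := by
  rw [centralFrame, root_eq_exp, mul_comm]

theorem pos_frameIdx_none : (fun j => pos (frameIdx none j)) = centralFrame := by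
  funext j
  rw [frameIdx, pos, centralFrame_apply]
  dsimp only
  rw [show (((0 : Fin 6).val : ℕ) : ZMod 7) = 0 from rfl, AddChar.map_zero_eq_one, ringSide_one]

theorem pos_frameIdx_some (k : ZMod 7) :
    (fun j => pos (frameIdx (some k) j)) = fun j => halfTurn (centralFrame k) (centralFrame j) := by
  funext j
  rw [frameIdx, pos_ringIdx, centralFrame_apply, centralFrame_apply,
    show root j * (sideRadius : ℂ) = root k * (sideRadius * root (j - k)) by
      rw [mul_left_comm, ← AddChar.map_add_eq_mul, add_sub_cancel, mul_comm],
    halfTurn_mul (star_root_mul_root k), halfTurn_sideRadius (norm_root _)]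

theorem mem_frames_one {f : ZMod 7 → ℂ} :
    f ∈ frames 1 ↔ ∃ o, (fun j => pos (frameIdx o j)) = f := by
  rw [frames, frames, Finset.mem_union, Finset.mem_biUnion, Option.exists, pos_frameIdx_none]
  simp only [pos_frameIdx_some, Finset.mem_singleton, Finset.mem_image, Finset.mem_univ, true_and]
  constructor
  · rintro (h | ⟨f', rfl, k, h⟩)
    · exact Or.inl h.symm
    · exact Or.inr ⟨k, h⟩
  · rintro (h | ⟨k, h⟩)
    · exact Or.inl h.symm
    · exact Or.inr ⟨_, rfl, k, h⟩

end Geometry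

/-! ### The combinatorics of the first layer -/

section Combinatorics

/-- The sides that belong to one tile only. -/
abbrev LegIdx : Type := {q : SideIdx // 2 ≤ q.2.val}

theorem frameIdx_image_injective : ∀ o o' : Option (ZMod 7),
    Finset.univ.image (frameIdx o) = Finset.univ.image (frameIdx o') → o = o' := by
  decide +kernel

theorem card_frameIdx_mem : ∀ q : SideIdx,
    (Finset.univ.filter fun o => ∃ j, frameIdx o j = q).card = 1 ↔ 2 ≤ q.2.val := by
  decide +kernel

theorem card_frameIdx_eq : ∀ q : SideIdx,
    ((Finset.univ.filter fun p : Option (ZMod 7) × ZMod 7 => frameIdx p.1 p.2 = q).card : ZMod 2) =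
      if 2 ≤ q.2.val then 1 else 0 := by
  decide +kernel

theorem exists_frameIdx_eq : ∀ q : SideIdx, ∃ o j, frameIdx o j = q := by
  decide +kernel

theorem tileOf_pos (o : Option (ZMod 7)) :
    tileOf (fun j => pos (frameIdx o j)) = (Finset.univ.image (frameIdx o)).image pos := by
  rw [tileOf, Finset.image_image]
  rfl

theorem tileOf_pos_injective {o o' : Option (ZMod 7)}
    (h : tileOf (fun j => pos (frameIdx o j)) = tileOf fun j => pos (frameIdx o' j)) : o = o' := by
  rw [tileOf_pos, tileOf_pos] at h
  exact frameIdx_image_injective o o' (Finset.image_injective pos_injective h)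

theorem mem_tiles_one {t : Finset ℂ} :
    t ∈ tiles 1 ↔ ∃ o, tileOf (fun j => pos (frameIdx o j)) = t := by
  rw [tiles, Finset.mem_image]
  simp only [mem_frames_one]
  constructor
  · rintro ⟨_, ⟨o, rfl⟩, h⟩
    exact ⟨o, h⟩
  · rintro ⟨o, h⟩
    exact ⟨_, ⟨o, rfl⟩, h⟩

theorem mem_sides_one {e : ℂ} : e ∈ sides 1 ↔ ∃ q, pos q = e := by
  rw [sides, Finset.mem_biUnion]
  constructor
  · rintro ⟨t, ht, he⟩
    obtain ⟨o, rfl⟩ := mem_tiles_one.1 ht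
    obtain ⟨j, -, hj⟩ := Finset.mem_image.1 he
    exact ⟨_, hj⟩
  · rintro ⟨q, rfl⟩
    obtain ⟨o, j, rfl⟩ := exists_frameIdx_eq q
    exact ⟨_, mem_tiles_one.2 ⟨o, rfl⟩, Finset.mem_image_of_mem _ (Finset.mem_univ j)⟩

theorem pos_mem_tileOf {q : SideIdx} {o : Option (ZMod 7)} :
    pos q ∈ tileOf (fun j => pos (frameIdx o j)) ↔ ∃ j, frameIdx o j = q := by
  simp only [tileOf, Finset.mem_image, Finset.mem_univ, true_and, pos_injective.eq_iff]

theorem pos_mem_outerSides {q : SideIdx} : pos q ∈ outerSides 1 ↔ 2 ≤ q.2.val := by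
  rw [outerSides, Finset.mem_filter, ← card_frameIdx_mem q]
  have h : (tiles 1).filter (fun t => pos q ∈ t) =
      (Finset.univ.filter fun o => ∃ j, frameIdx o j = q).image
        fun o => tileOf fun j => pos (frameIdx o j) := by
    ext t
    simp only [Finset.mem_filter, Finset.mem_image, Finset.mem_univ, true_and, mem_tiles_one]
    constructor
    · rintro ⟨⟨o, rfl⟩, h⟩
      exact ⟨o, pos_mem_tileOf.1 h, rfl⟩
    · rintro ⟨o, h, rfl⟩
      exact ⟨⟨o, rfl⟩, pos_mem_tileOf.2 h⟩
  rw [h, Finset.card_image_of_injective _ fun o o' h => tileOf_pos_injective h]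
  exact and_iff_right (mem_sides_one.2 ⟨q, rfl⟩)

/-- The tiles. -/
noncomputable def tileEquiv : Option (ZMod 7) ≃ Tile 1 :=
  Equiv.ofBijective (fun o => ⟨tileOf fun j => pos (frameIdx o j), mem_tiles_one.2 ⟨o, rfl⟩⟩)
    ⟨fun _ _ h => tileOf_pos_injective (congrArg Subtype.val h), fun t => by
      obtain ⟨o, h⟩ := mem_tiles_one.1 t.2
      exact ⟨o, Subtype.ext h⟩⟩

/-- The frames, one for each tile. -/
noncomputable def frameEquiv : Option (ZMod 7) ≃ {f : ZMod 7 → ℂ // f ∈ frames 1} :=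
  Equiv.ofBijective (fun o => ⟨fun j => pos (frameIdx o j), mem_frames_one.2 ⟨o, rfl⟩⟩)
    ⟨fun _ _ h => tileOf_pos_injective (congrArg tileOf (congrArg Subtype.val h)), fun f => by
      obtain ⟨o, h⟩ := mem_frames_one.1 f.2
      exact ⟨o, Subtype.ext h⟩⟩

/-- The sides. -/
noncomputable def sideEquiv : SideIdx ≃ Side 1 :=
  Equiv.ofBijective (fun q => ⟨pos q, mem_sides_one.2 ⟨q, rfl⟩⟩)
    ⟨fun _ _ h => pos_injective (congrArg Subtype.val h), fun e => by
      obtain ⟨q, h⟩ := mem_sides_one.1 e.2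
      exact ⟨q, Subtype.ext h⟩⟩

/-- The legs. -/
noncomputable def legEquiv : LegIdx ≃ Leg 1 :=
  Equiv.ofBijective (fun q => ⟨pos q.1, pos_mem_outerSides.2 q.2⟩)
    ⟨fun _ _ h => Subtype.ext (pos_injective (congrArg Subtype.val h)), fun e => by
      obtain ⟨q, h⟩ := mem_sides_one.1 (Finset.mem_filter.1 e.2).1
      exact ⟨⟨q, pos_mem_outerSides.1 (h.symm ▸ e.2)⟩, Subtype.ext h⟩⟩

theorem isCentral_iff (o : Option (ZMod 7)) : IsCentral (tileEquiv o) ↔ o = none := by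
  unfold IsCentral
  rw [← pos_frameIdx_none]
  exact ⟨tileOf_pos_injective, fun h => h ▸ rfl⟩

theorem network_one (x : Reg (Leg 1)) (b : Reg (Tile 1)) :
    network 1 x b = ∑ y : Reg SideIdx, if ∀ l : LegIdx, y l.1 = x (legEquiv l) then
      ∏ o, steane (b (tileEquiv o)) (fun j => y (frameIdx o j)) else 0 := by
  unfold network
  rw [← (Equiv.arrowCongr sideEquiv (Equiv.refl (ZMod 2))).sum_comp]
  refine Finset.sum_congr rfl fun y _ => ?_
  have h1 : (∀ (e : Leg 1) (s : Side 1), s.1 = e.1 →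
      (Equiv.arrowCongr sideEquiv (Equiv.refl (ZMod 2))) y s = x e) ↔
        ∀ l : LegIdx, y l.1 = x (legEquiv l) := by
    constructor
    · intro h l
      rw [← h (legEquiv l) (sideEquiv l.1) rfl]
      exact congrArg y (sideEquiv.symm_apply_apply _).symm
    · intro h e s hs
      obtain ⟨l, rfl⟩ := legEquiv.surjective e
      obtain ⟨q, rfl⟩ := sideEquiv.surjective s
      have hq : q = l.1 := pos_injective hs
      rw [← h l, ← hq]
      exact congrArg y (sideEquiv.symm_apply_apply _)
  rw [if_congr h1 rfl rfl, ← frameEquiv.prod_comp]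
  refine if_congr Iff.rfl (Finset.prod_congr rfl fun o _ => ?_) rfl
  refine congrArg₂ steane rfl (funext fun j => ?_)
  exact congrArg y (sideEquiv.symm_apply_apply _)

end Combinatorics

/-! ### The code is self-dual -/

section SelfDualCriteria

variable {Λ T : Type} [Fintype Λ] [DecidableEq Λ] [Fintype T] [DecidableEq T]

/-- The standard pairing on pairs of words. -/
def pairing (Λ T : Type) [Fintype Λ] [Fintype T] :
    LinearMap.BilinForm (ZMod 2) (Reg Λ × Reg T) :=
  LinearMap.mk₂ (ZMod 2) (fun w z => w.1 ⬝ᵥ z.1 + w.2 ⬝ᵥ z.2)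
    (fun w w' z => by simp only [Prod.fst_add, Prod.snd_add, add_dotProduct]; ring)
    (fun c w z => by simp only [Prod.smul_fst, Prod.smul_snd, smul_dotProduct, smul_add])
    (fun w z z' => by simp only [Prod.fst_add, Prod.snd_add, dotProduct_add]; ring)
    (fun c w z => by simp only [Prod.smul_fst, Prod.smul_snd, dotProduct_smul, smul_add])

theorem pairing_apply (w z : Reg Λ × Reg T) : pairing Λ T w z = w.1 ⬝ᵥ z.1 + w.2 ⬝ᵥ z.2 := rfl

theorem pairing_isSymm : (pairing Λ T).IsSymm := ⟨fun w z => by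
  simp only [pairing_apply]
  rw [dotProduct_comm w.1, dotProduct_comm w.2]⟩

theorem pairing_nondegenerate : (pairing Λ T).Nondegenerate := by
  refine (LinearMap.IsRefl.nondegenerate_iff_separatingLeft pairing_isSymm.isRefl).2 fun w h => ?_
  have h1 : w.1 = 0 := dotProduct_eq_zero _ fun v => by
    have := h (v, 0)
    rwa [pairing_apply, dotProduct_zero, add_zero] at this
  have h2 : w.2 = 0 := dotProduct_eq_zero _ fun v => by
    have := h (0, v)
    rwa [pairing_apply, dotProduct_zero, zero_add] at this
  exact Prod.ext h1 h2

theorem mem_iff_of_isotropic {L : Submodule (ZMod 2) (Reg Λ × Reg T)}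
    (hL : ∀ z ∈ L, ∀ w ∈ L, w.1 ⬝ᵥ z.1 + w.2 ⬝ᵥ z.2 = 0)
    (hdim : Fintype.card Λ + Fintype.card T ≤ 2 * Module.finrank (ZMod 2) L)
    (z : Reg Λ × Reg T) : z ∈ L ↔ ∀ w ∈ L, w.1 ⬝ᵥ z.1 + w.2 ⬝ᵥ z.2 = 0 := by
  refine ⟨hL z, fun hz => ?_⟩
  have h : L = (pairing Λ T).orthogonal L := by
    refine Submodule.eq_of_le_of_finrank_le (fun z hz w hw => hL z hz w hw) ?_
    rw [LinearMap.BilinForm.finrank_orthogonal pairing_nondegenerate, Module.finrank_prod,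
      Module.finrank_pi, Module.finrank_pi]
    omega
  rw [h]
  exact hz

/-- The projection of a self-dual code without purely logical words to the logical part is onto. -/
theorem exists_mem_of_dual {L : Submodule (ZMod 2) (Reg Λ × Reg T)}
    (dual : ∀ z, z ∈ L ↔ ∀ w ∈ L, w.1 ⬝ᵥ z.1 + w.2 ⬝ᵥ z.2 = 0)
    (inj : ∀ b, ((0 : Reg Λ), b) ∈ L → b = 0) (b : Reg T) : ∃ x, (x, b) ∈ L := by
  have h : L.map (LinearMap.snd (ZMod 2) (Reg Λ) (Reg T)) = ⊤ := by
    by_contra hne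
    obtain ⟨f, hf, hle⟩ := Submodule.exists_le_ker_of_lt_top _ (lt_top_iff_ne_top.2 hne)
    have hfe : ∀ v, f v = v ⬝ᵥ fun i => f (Pi.single i 1) := fun v => by
      conv_lhs => rw [pi_eq_sum_univ' v, map_sum]
      exact Finset.sum_congr rfl fun i _ => by
        rw [map_smul, smul_eq_mul]
    refine hf (LinearMap.ext fun v => ?_)
    have h0 : (fun i => f (Pi.single i 1)) = 0 := inj _ ((dual _).2 fun w hw => by
      rw [dotProduct_zero, zero_add, ← hfe]
      exact hle (Submodule.mem_map_of_mem (f := LinearMap.snd (ZMod 2) (Reg Λ) (Reg T)) hw))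
    rw [hfe, h0, dotProduct_zero, LinearMap.zero_apply]
  obtain ⟨⟨x, b'⟩, hw, rfl⟩ := Submodule.mem_map.1 (h ▸ Submodule.mem_top : b ∈ _)
  exact ⟨x, hw⟩

open Classical in
/-- A self-dual code without purely logical words defines an isometry. -/
theorem isSelfDualCode_of_dual {L : Submodule (ZMod 2) (Reg Λ × Reg T)}
    {V : Matrix (Reg Λ) (Reg T) ℂ} {κ : ℂ}
    (hV : ∀ x b, V x b = if (x, b) ∈ L then κ else 0)
    (dual : ∀ z, z ∈ L ↔ ∀ w ∈ L, w.1 ⬝ᵥ z.1 + w.2 ⬝ᵥ z.2 = 0)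
    (inj : ∀ b, ((0 : Reg Λ), b) ∈ L → b = 0) (hκ : ∑ x, star (V x 0) * V x 0 = 1) :
    IsSelfDualCode L V κ where
  apply_mem x b h := by rw [hV, if_pos h]
  apply_not_mem x b h := by rw [hV, if_neg h]
  dual := dual
  inj := inj
  isometry := by
    ext b b'
    rw [Matrix.mul_apply, Matrix.one_apply]
    simp only [Matrix.conjTranspose_apply]
    split_ifs with h
    · subst h
      obtain ⟨x₀, hx₀⟩ := exists_mem_of_dual dual inj b
      rw [← hκ, ← Equiv.sum_comp (Equiv.addRight x₀)]
      refine Finset.sum_congr rfl fun x _ => ?_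
      have : V (x + x₀) b = V x 0 := by
        rw [hV, hV]
        refine if_congr ?_ rfl rfl
        have := L.add_mem_iff_left (x := (x, 0)) hx₀
        rwa [Prod.mk_add_mk, zero_add] at this
      exact congrArg₂ (fun u v => star u * v) this this
    · refine Finset.sum_eq_zero fun x _ => ?_
      rw [hV, hV]
      split_ifs with h1 h2
      · refine absurd (sub_eq_zero.1 (inj _ ?_)) h
        have := L.sub_mem h1 h2
        rwa [Prod.mk_sub_mk, sub_self] at this
      all_goals simp

end SelfDualCriteria

section HolographicCode

/-- The words of the cyclic Hamming code. -/
abbrev IsHamming (x : Reg (ZMod 7)) : Prop := ∀ j, x j + x (j + 1) + x (j + 2) + x (j + 4) = 0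

theorem isHamming_of_three : ∀ x : Reg (ZMod 7),
    (∀ r : Fin 3, x (r.val : ZMod 7) + x (r.val + 1) + x (r.val + 2) + x (r.val + 4) = 0) →
      IsHamming x := by
  decide +kernel

theorem IsHamming.dotProduct_eq : ∀ x : Reg (ZMod 7), IsHamming x → ∀ x', IsHamming x' →
    ∑ j, x j * x' j = (∑ j, x j) * ∑ j, x' j := by
  decide +kernel

theorem IsHamming.eq_zero : ∀ x : Reg (ZMod 7), IsHamming x → x 2 = 0 → x 3 = 0 → x 4 = 0 →
    x 5 = 0 → x 0 = 0 ∧ x 1 = 0 := by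
  decide +kernel

/-- The values on the sides of the tile `o`. -/
abbrev onTile (y : Reg SideIdx) (o : Option (ZMod 7)) : Reg (ZMod 7) := fun j => y (frameIdx o j)

/-- Three parity checks for each tile. -/
def checks : Reg SideIdx →ₗ[ZMod 2] Reg (Option (ZMod 7) × Fin 3) where
  toFun y p := onTile y p.1 p.2.val + onTile y p.1 (p.2.val + 1) + onTile y p.1 (p.2.val + 2) +
    onTile y p.1 (p.2.val + 4)
  map_add' y y' := funext fun p => by simp only [onTile, Pi.add_apply]; ring
  map_smul' c y := funext fun p => by
    simp only [onTile, Pi.smul_apply, smul_eq_mul, RingHom.id_apply]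
    ring

theorem mem_ker_checks {y : Reg SideIdx} :
    y ∈ LinearMap.ker checks ↔ ∀ o, IsHamming (onTile y o) := by
  rw [LinearMap.mem_ker]
  constructor
  · exact fun h o => isHamming_of_three _ fun r => congrFun h (o, r)
  · exact fun h => funext fun p => h p.1 p.2.val

/-- The boundary and bulk values of an assignment of values to all sides. -/
noncomputable def boundaryBulk : Reg SideIdx →ₗ[ZMod 2] Reg (Leg 1) × Reg (Tile 1) :=
  LinearMap.prod (LinearMap.funLeft (ZMod 2) (ZMod 2) fun e => (legEquiv.symm e).1)
    (LinearMap.pi fun t => ∑ j, LinearMap.proj (frameIdx (tileEquiv.symm t) j))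

theorem boundaryBulk_fst (y : Reg SideIdx) (l : LegIdx) :
    (boundaryBulk y).1 (legEquiv l) = y l.1 := by
  change y (legEquiv.symm (legEquiv l)).1 = _
  rw [Equiv.symm_apply_apply]

theorem boundaryBulk_snd (y : Reg SideIdx) (o : Option (ZMod 7)) :
    (boundaryBulk y).2 (tileEquiv o) = ∑ j, onTile y o j := by
  change (∑ j, LinearMap.proj (R := ZMod 2) (φ := fun _ : SideIdx => ZMod 2)
    (frameIdx (tileEquiv.symm (tileEquiv o)) j)) y = _
  rw [Equiv.symm_apply_apply, LinearMap.sum_apply]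
  rfl

theorem boundaryBulk_eq_iff {y : Reg SideIdx} {x : Reg (Leg 1)} {b : Reg (Tile 1)} :
    boundaryBulk y = (x, b) ↔
      (∀ l : LegIdx, y l.1 = x (legEquiv l)) ∧ ∀ o, ∑ j, onTile y o j = b (tileEquiv o) := by
  simp only [← boundaryBulk_fst, ← boundaryBulk_snd]
  constructor
  · rintro h
    rw [h]
    exact ⟨fun _ => rfl, fun _ => rfl⟩
  · exact fun h => Prod.ext (funext fun e => by simpa using h.1 (legEquiv.symm e))
      (funext fun t => by simpa using h.2 (tileEquiv.symm t))

/-- The words of the code: compatible values of the boundary and bulk qubits. -/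
noncomputable def holoWords : Submodule (ZMod 2) (Reg (Leg 1) × Reg (Tile 1)) :=
  (LinearMap.ker checks).map boundaryBulk

theorem eq_zero_of_boundary {y : Reg SideIdx} (hy : y ∈ LinearMap.ker checks)
    (h : ∀ l : LegIdx, y l.1 = 0) : y = 0 := by
  rw [mem_ker_checks] at hy
  have h1 : ∀ k, IsHamming fun m => y (ringIdx k m) := fun k m => by
    have := hy (some k) (m + k)
    simp only [onTile, frameIdx] at this
    convert this using 5 <;> ring_nf
  have h2 : ∀ k, y (k, 0) = 0 ∧ y (k, 1) = 0 := fun k =>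
    IsHamming.eq_zero _ (h1 k) (h ⟨(k, 2), le_refl _⟩) (h ⟨(k, 3), Nat.le_of_ble_eq_true rfl⟩)
      (h ⟨(k, 4), Nat.le_of_ble_eq_true rfl⟩) (h ⟨(k, 5), Nat.le_of_ble_eq_true rfl⟩)
  funext q
  obtain ⟨k, m⟩ := q
  by_cases hm : 2 ≤ m.val
  · exact h ⟨(k, m), hm⟩
  · have : m = 0 ∨ m = 1 := by omega
    rcases this with rfl | rfl
    · exact (h2 k).1
    · exact (h2 k).2

theorem boundaryBulk_injOn : ∀ y ∈ LinearMap.ker checks, (boundaryBulk y).1 = 0 → y = 0 :=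
  fun y hy h => eq_zero_of_boundary hy fun l => (boundaryBulk_fst y l).symm.trans (congrFun h _)

theorem holoWords_inj (b : Reg (Tile 1)) (h : ((0 : Reg (Leg 1)), b) ∈ holoWords) : b = 0 := by
  obtain ⟨y, hy, hb⟩ := h
  have h0 := boundaryBulk_injOn y hy (congrArg Prod.fst hb)
  rw [h0, map_zero] at hb
  exact (congrArg Prod.snd hb).symm

theorem sum_legs_eq_sum_tiles (f : SideIdx → ZMod 2) :
    ∑ l : LegIdx, f l.1 = ∑ o, ∑ j, f (frameIdx o j) := by
  have h1 : ∑ l : LegIdx, f l.1 = ∑ q : SideIdx, if 2 ≤ q.2.val then f q else 0 := by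
    rw [← Finset.sum_filter]
    exact (Finset.sum_subtype (Finset.univ.filter fun q : SideIdx => 2 ≤ q.2.val)
      (fun q => by rw [Finset.mem_filter, and_iff_right (Finset.mem_univ q)]) f).symm
  rw [h1, ← Fintype.sum_prod_type' (fun o j => f (frameIdx o j)),
    ← Finset.sum_fiberwise (s := Finset.univ)
      (g := fun p : Option (ZMod 7) × ZMod 7 => frameIdx p.1 p.2)]
  refine Finset.sum_congr rfl fun q _ => ?_
  rw [Finset.sum_congr rfl fun p hp => congrArg f (Finset.mem_filter.1 hp).2, Finset.sum_const,
    nsmul_eq_mul, card_frameIdx_eq, ite_mul, one_mul, zero_mul]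

theorem holoWords_isotropic : ∀ z ∈ holoWords, ∀ w ∈ holoWords,
    w.1 ⬝ᵥ z.1 + w.2 ⬝ᵥ z.2 = 0 := by
  rintro _ ⟨y, hy, rfl⟩ _ ⟨y', hy', rfl⟩
  rw [SetLike.mem_coe, mem_ker_checks] at hy hy'
  have h1 : (boundaryBulk y').1 ⬝ᵥ (boundaryBulk y).1 = ∑ l : LegIdx, y' l.1 * y l.1 := by
    rw [dotProduct, ← legEquiv.sum_comp]
    simp only [boundaryBulk_fst]
  have h2 : (boundaryBulk y').2 ⬝ᵥ (boundaryBulk y).2 =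
      ∑ o, (∑ j, onTile y' o j) * ∑ j, onTile y o j := by
    rw [dotProduct, ← tileEquiv.sum_comp]
    simp only [boundaryBulk_snd]
  rw [h1, h2, sum_legs_eq_sum_tiles fun q => y' q * y q, ← Finset.sum_add_distrib]
  refine Finset.sum_eq_zero fun o _ => ?_
  rw [← IsHamming.dotProduct_eq _ (hy' o) _ (hy o)]
  exact CharTwo.add_self_eq_zero _

theorem card_leg_one : Fintype.card (Leg 1) = 28 := by
  rw [← Fintype.card_congr legEquiv]
  decide +kernel

theorem card_tile_one : Fintype.card (Tile 1) = 8 := by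
  rw [← Fintype.card_congr tileEquiv]
  decide +kernel

theorem le_finrank_holoWords : 18 ≤ Module.finrank (ZMod 2) holoWords := by
  have h1 : Module.finrank (ZMod 2) holoWords = Module.finrank (ZMod 2) (LinearMap.ker checks) := by
    rw [holoWords, ← LinearMap.range_domRestrict]
    refine LinearMap.finrank_range_of_inj ((injective_iff_map_eq_zero _).2 fun y hy => ?_)
    exact Subtype.ext (boundaryBulk_injOn y.1 y.2 (congrArg Prod.fst hy))
  have h2 := LinearMap.finrank_range_add_finrank_ker checks
  have h3 := Submodule.finrank_le (LinearMap.range checks)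
  have h4 : Fintype.card (Option (ZMod 7) × Fin 3) = 24 := by decide +kernel
  have h5 : Fintype.card SideIdx = 42 := by decide +kernel
  rw [Module.finrank_pi, h4] at h3
  rw [Module.finrank_pi, h5] at h2
  omega

theorem holoWords_dual (z : Reg (Leg 1) × Reg (Tile 1)) :
    z ∈ holoWords ↔ ∀ w ∈ holoWords, w.1 ⬝ᵥ z.1 + w.2 ⬝ᵥ z.2 = 0 := by
  refine mem_iff_of_isotropic holoWords_isotropic ?_ z
  rw [card_leg_one, card_tile_one]
  have := le_finrank_holoWords
  omega

open Classical in
theorem network_eq (x : Reg (Leg 1)) (b : Reg (Tile 1)) :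
    network 1 x b = if (x, b) ∈ holoWords then 1 else 0 := by
  have h : ∀ y : Reg SideIdx, (if ∀ l : LegIdx, y l.1 = x (legEquiv l) then
      ∏ o, steane (b (tileEquiv o)) (fun j => y (frameIdx o j)) else 0 : ℂ) =
        if y ∈ LinearMap.ker checks ∧ boundaryBulk y = (x, b) then 1 else 0 := fun y => by
    simp only [boundaryBulk_eq_iff, mem_ker_checks]
    by_cases h1 : ∀ l : LegIdx, y l.1 = x (legEquiv l)
    · rw [if_pos h1]
      by_cases h2 : ∀ o, IsHamming (onTile y o) ∧ ∑ j, onTile y o j = b (tileEquiv o)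
      · rw [if_pos ⟨fun o => (h2 o).1, h1, fun o => (h2 o).2⟩]
        exact Finset.prod_eq_one fun o _ => if_pos (h2 o)
      · rw [if_neg fun h3 => h2 fun o => ⟨h3.1 o, h3.2.2 o⟩]
        obtain ⟨o, ho⟩ := not_forall.1 h2
        exact Finset.prod_eq_zero (Finset.mem_univ o) (if_neg ho)
    · rw [if_neg h1, if_neg fun h2 => h1 h2.2.1]
  rw [network_one, Finset.sum_congr rfl fun y _ => h y]
  split_ifs with hx
  · obtain ⟨y, hy, hyx⟩ := hx
    rw [Finset.sum_eq_single y, if_pos ⟨hy, hyx⟩]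
    · refine fun y' _ hne => if_neg fun h' => hne (sub_eq_zero.1 ?_)
      refine boundaryBulk_injOn _ (Submodule.sub_mem _ h'.1 hy) ?_
      rw [map_sub, h'.2, hyx, sub_self]
      rfl
    · exact fun h => absurd (Finset.mem_univ _) h
  · exact Finset.sum_eq_zero fun y _ => if_neg fun h' => hx ⟨y, h'⟩

theorem exists_isSelfDualCode : ∃ κ, IsSelfDualCode holoWords (codeMap 1) κ := by
  classical
  set s : ℝ := ∑ x', ‖network 1 x' 0‖ ^ 2 with hs
  have hpos : 0 < s := by
    refine Finset.sum_pos' (fun _ _ => by positivity) ⟨0, Finset.mem_univ _, ?_⟩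
    rw [network_eq, if_pos (show ((0 : Reg (Leg 1)), (0 : Reg (Tile 1))) ∈ holoWords from holoWords.zero_mem)]
    norm_num
  refine ⟨1 / (Real.sqrt s : ℂ), isSelfDualCode_of_dual (fun x b => ?_) holoWords_dual holoWords_inj ?_⟩
  · rw [codeMap, network_eq]
    split_ifs
    · rfl
    · exact zero_div _
  · have h : ∀ x, star (codeMap 1 x 0) * codeMap 1 x 0 = ((‖network 1 x 0‖ ^ 2 / s : ℝ) : ℂ) := fun x => by
      rw [mul_comm, Complex.star_def, Complex.mul_conj, Complex.normSq_eq_norm_sq]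
      rw [codeMap, norm_div, Complex.norm_real, div_pow, Real.norm_of_nonneg (Real.sqrt_nonneg _),
        Real.sq_sqrt hpos.le]
    rw [Finset.sum_congr rfl fun x _ => h x, ← Complex.ofReal_sum, ← Finset.sum_div, ← hs,
      div_self hpos.ne', Complex.ofReal_one]

end HolographicCode

/-! ### The positions of the legs -/

section Positions

theorem re_star_mul_discTranslate {w z : ℂ} (hD : 1 + star w * z ≠ 0) :
    (star w * discTranslate w z).re * Complex.normSq (1 + star w * z) =
      (1 + Complex.normSq w) * (star w * z).re + Complex.normSq w * (1 + Complex.normSq z) := by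
  have h : (star w * discTranslate w z) * Complex.normSq (1 + star w * z) =
      star w * (z + w) * star (1 + star w * z) := by
    rw [← Complex.mul_conj, discTranslate]
    change _ * (_ * star _) = _
    field_simp
  have h2 := congrArg Complex.re h
  rw [Complex.re_mul_ofReal] at h2
  rw [h2]
  simp only [Complex.star_def, Complex.normSq_apply, Complex.mul_re, Complex.mul_im,
    Complex.add_re, Complex.add_im, Complex.conj_re, Complex.conj_im, Complex.one_re,
    Complex.one_im]
  ring

theorem one_add_star_mul_ne_zero {w z : ℂ} (hw : ‖w‖ < 1) (hz : ‖z‖ < 1) : 1 + star w * z ≠ 0 := by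
  intro h
  have h1 := congrArg norm (eq_neg_of_add_eq_zero_right h)
  rw [norm_mul, norm_star, norm_neg, norm_one] at h1
  nlinarith [norm_nonneg w, norm_nonneg z]

/-- The translation in the direction `u` by `4/25`. -/
noncomputable def shift (u : ℤ × ℤ) : ℂ := ⟨4 / 25 * u.1, 4 / 25 * u.2⟩

/-- The sign of the component of the translated side `q` in the direction `u` is read off from this
number. -/
def leaning (u : ℤ × ℤ) (q : SideIdx) : ℤ :=
  641 * (u.1 * (posTable q).1 + u.2 * (posTable q).2) * 100000000000 +
    100 * (100000000000 ^ 2 + (posTable q).1 ^ 2 + (posTable q).2 ^ 2)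

theorem posTable_bounds : ∀ q : SideIdx, 2 ≤ q.2.val →
    5902 ^ 2 * 10000000 ^ 2 ≤ (posTable q).1 ^ 2 + (posTable q).2 ^ 2 ∧
      (posTable q).1 ^ 2 + (posTable q).2 ^ 2 ≤ 6698 ^ 2 * 10000000 ^ 2 := by
  decide +kernel

theorem norm_pos_bounds (l : LegIdx) : 59 / 100 ≤ ‖pos l.1‖ ∧ ‖pos l.1‖ ≤ 67 / 100 := by
  obtain ⟨h1, h2⟩ := posTable_bounds l.1 l.2
  have h3 := norm_pos_sub l.1
  set p := posTable l.1
  have h4 : ‖scaled 100000000000 p‖ ^ 2 = ((p.1 ^ 2 + p.2 ^ 2 : ℤ) : ℝ) / 100000000000 ^ 2 := by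
    rw [← Complex.normSq_eq_norm_sq, Complex.normSq_apply, scaled]
    push_cast
    ring
  have h5 : 5902 / 10000 ≤ ‖scaled 100000000000 p‖ := by
    refine (sq_le_sq₀ (by norm_num) (norm_nonneg _)).1 ?_
    rw [h4]
    have : ((5902 ^ 2 * 10000000 ^ 2 : ℤ) : ℝ) ≤ _ := Int.cast_le.2 h1
    rw [le_div_iff₀ (by norm_num)]
    refine le_trans ?_ this
    norm_num
  have h6 : ‖scaled 100000000000 p‖ ≤ 6698 / 10000 := by
    refine (sq_le_sq₀ (norm_nonneg _) (by norm_num)).1 ?_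
    rw [h4]
    have : _ ≤ ((6698 ^ 2 * 10000000 ^ 2 : ℤ) : ℝ) := Int.cast_le.2 h2
    rw [div_le_iff₀ (by norm_num)]
    refine this.trans ?_
    norm_num
  have h7 := abs_le.1 ((abs_norm_sub_norm_le _ _).trans h3)
  constructor <;> linarith [h7.1, h7.2]

theorem abs_leaning_sub_le {u : ℤ × ℤ} (hu : |u.1| ≤ 1 ∧ |u.2| ≤ 1) (l : LegIdx) :
    |641 * (u.1 * (pos l.1).re + u.2 * (pos l.1).im) + 100 * (1 + Complex.normSq (pos l.1)) -
      leaning u l.1 / 100000000000 ^ 2| ≤ 1 / 4 := by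
  have h1 := (norm_pos_bounds l).2
  have h2 := norm_pos_sub l.1
  have hu1 : |(u.1 : ℝ)| ≤ 1 := by exact_mod_cast hu.1
  have hu2 : |(u.2 : ℝ)| ≤ 1 := by exact_mod_cast hu.2
  have hx := (Complex.abs_re_le_norm _).trans h2
  have hy := (Complex.abs_im_le_norm _).trans h2
  have hx1 := (Complex.abs_re_le_norm _).trans h1
  have hy1 := (Complex.abs_im_le_norm _).trans h1
  rw [Complex.sub_re] at hx
  rw [Complex.sub_im] at hy
  have hl : (leaning u l.1 : ℝ) / 100000000000 ^ 2 =
      641 * (u.1 * (scaled 100000000000 (posTable l.1)).re +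
        u.2 * (scaled 100000000000 (posTable l.1)).im) +
      100 * (1 + (scaled 100000000000 (posTable l.1)).re ^ 2 +
        (scaled 100000000000 (posTable l.1)).im ^ 2) := by
    simp only [leaning, scaled]
    push_cast
    field_simp
    norm_num
  rw [hl, Complex.normSq_apply]
  generalize (scaled 100000000000 (posTable l.1)).re = X at *
  generalize (scaled 100000000000 (posTable l.1)).im = Y at *
  generalize (pos l.1).re = x at *
  generalize (pos l.1).im = y at *
  have e : 641 * (u.1 * x + u.2 * y) + 100 * (1 + (x * x + y * y)) -
      (641 * (u.1 * X + u.2 * Y) + 100 * (1 + X ^ 2 + Y ^ 2)) =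
      (641 * u.1 + 200 * x - 100 * (x - X)) * (x - X) +
        (641 * u.2 + 200 * y - 100 * (y - Y)) * (y - Y) := by ring
  have key : ∀ v x d : ℝ, |v| ≤ 1 → |x| ≤ 67 / 100 → |d| ≤ 12 / 100000 →
      |(641 * v + 200 * x - 100 * d) * d| ≤ 1 / 8 := fun v x d hv hx hd => by
    rw [abs_mul]
    have : |641 * v + 200 * x - 100 * d| ≤ 900 := by
      rw [abs_le] at *
      constructor <;> linarith [hv.1, hv.2, hx.1, hx.2, hd.1, hd.2]
    nlinarith [abs_nonneg d, abs_nonneg (641 * v + 200 * x - 100 * d)]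
  rw [e]
  refine (abs_add_le _ _).trans ?_
  linarith [key _ x _ hu1 hx1 hx, key _ y _ hu2 hy1 hy]

theorem discTranslate_shift_pos {u : ℤ × ℤ} (hu : u.1 ^ 2 + u.2 ^ 2 = 1) (l : LegIdx) :
    (100000000000 ^ 2 < leaning u l.1 → 0 < u.1 * (discTranslate (shift u) (pos l.1)).re +
      u.2 * (discTranslate (shift u) (pos l.1)).im) ∧
    (leaning u l.1 < -100000000000 ^ 2 → u.1 * (discTranslate (shift u) (pos l.1)).re +
      u.2 * (discTranslate (shift u) (pos l.1)).im < 0) := by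
  have hu' : |u.1| ≤ 1 ∧ |u.2| ≤ 1 := by
    constructor <;> rw [← sq_le_one_iff_abs_le_one] <;> nlinarith
  have huR : (u.1 : ℝ) ^ 2 + (u.2 : ℝ) ^ 2 = 1 := by exact_mod_cast hu
  have hn : Complex.normSq (shift u) = 16 / 625 := by
    rw [Complex.normSq_apply, shift]
    linear_combination 16 / 625 * huR
  have hw : ‖shift u‖ < 1 := by
    rw [← sq_lt_one_iff₀ (norm_nonneg _), ← Complex.normSq_eq_norm_sq, hn]
    norm_num
  have hD := one_add_star_mul_ne_zero hw ((norm_pos_bounds l).2.trans_lt (by norm_num))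
  have h1 := re_star_mul_discTranslate hD
  have h2 := abs_le.1 (abs_leaning_sub_le hu' l)
  have h3 : ∀ v : ℂ, (star (shift u) * v).re = 4 / 25 * (u.1 * v.re + u.2 * v.im) := fun v => by
    simp only [shift, Complex.star_def, Complex.mul_re, Complex.conj_re, Complex.conj_im]
    ring
  rw [h3, h3, hn] at h1
  have hD' := Complex.normSq_pos.2 hD
  constructor
  · intro h
    have h' : (100000000000 ^ 2 : ℝ) < leaning u l.1 := by exact_mod_cast h
    rw [← one_lt_div (by norm_num)] at h'
    by_contra hc
    have := mul_nonneg (neg_nonneg.2 (not_lt.1 hc))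
      (by positivity : 0 ≤ 4 / 25 * Complex.normSq (1 + star (shift u) * pos l.1))
    nlinarith [h2.1, h2.2]
  · intro h
    have h' : (leaning u l.1 : ℝ) < -100000000000 ^ 2 := by exact_mod_cast h
    have h'' : (leaning u l.1 : ℝ) / 100000000000 ^ 2 < -1 := by
      rw [div_lt_iff₀ (by norm_num)]
      linarith
    by_contra hc
    have := mul_nonneg (not_lt.1 hc) (by positivity : 0 ≤ 4 / 25 * Complex.normSq (1 + star (shift u) * pos l.1))
    nlinarith [h2.1, h2.2]

theorem legSite_zero (l : LegIdx) (w : ℂ) :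
    legSite 1024 0 w (legEquiv l) = siteOf 1024 (discTranslate w (pos l.1)) := by
  rw [legSite, Complex.ofReal_zero, zero_mul, Complex.exp_zero, one_mul]
  rfl

theorem angDist_legSite {w : ℂ} (hw : ‖w‖ ≤ 4 / 25) (e : Leg 1) :
    angDist (legSite 1024 0 w e) (legSite 1024 0 0 e) < 2 * Real.pi / 16 := by
  obtain ⟨l, rfl⟩ := legEquiv.surjective e
  rw [legSite_zero, legSite_zero]
  have : discTranslate 0 (pos l.1) = pos l.1 := by
    rw [discTranslate, star_zero, zero_mul, add_zero, add_zero, div_one]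
  rw [this]
  exact angDist_siteOf_discTranslate hw (norm_pos_bounds l).1 (norm_pos_bounds l).2

theorem shift_west : -(((4 / 25 : ℝ) : ℂ) * Complex.I) = shift (0, -1) := by
  apply Complex.ext <;> simp [shift]

theorem shift_east : ((4 / 25 : ℝ) : ℂ) * Complex.I = shift (0, 1) := by
  apply Complex.ext <;> simp [shift]

theorem shift_north : ((4 / 25 : ℝ) : ℂ) = shift (1, 0) := by
  apply Complex.ext <;> simp [shift]

theorem shift_south : -((4 / 25 : ℝ) : ℂ) = shift (-1, 0) := by
  apply Complex.ext <;> simp [shift]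

theorem norm_shift_le {u : ℤ × ℤ} (hu : u.1 ^ 2 + u.2 ^ 2 = 1) : ‖shift u‖ ≤ 4 / 25 := by
  have huR : (u.1 : ℝ) ^ 2 + (u.2 : ℝ) ^ 2 = 1 := by exact_mod_cast hu
  rw [← sq_le_sq₀ (norm_nonneg _) (by norm_num), ← Complex.normSq_eq_norm_sq, Complex.normSq_apply,
    shift]
  linarith

theorem west_legSite {l : LegIdx} (h : 100000000000 ^ 2 < leaning (0, -1) l.1) :
    west (legSite 1024 0 (shift (0, -1)) (legEquiv l)) := by
  rw [legSite_zero]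
  refine west_siteOf ?_
  simpa using (discTranslate_shift_pos (u := (0, -1)) (by norm_num) l).1 h

theorem east_legSite {l : LegIdx} (h : 100000000000 ^ 2 < leaning (0, 1) l.1) :
    east (legSite 1024 0 (shift (0, 1)) (legEquiv l)) := by
  rw [legSite_zero]
  refine east_siteOf ?_
  simpa using (discTranslate_shift_pos (u := (0, 1)) (by norm_num) l).1 h

theorem north_legSite {l : LegIdx} (h : 100000000000 ^ 2 < leaning (1, 0) l.1) :
    north (legSite 1024 0 (shift (1, 0)) (legEquiv l)) := by
  rw [legSite_zero]
  refine north_siteOf ?_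
  simpa using (discTranslate_shift_pos (u := (1, 0)) (by norm_num) l).1 h

theorem south_legSite {l : LegIdx} (h : 100000000000 ^ 2 < leaning (-1, 0) l.1) :
    south (legSite 1024 0 (shift (-1, 0)) (legEquiv l)) := by
  rw [legSite_zero]
  refine south_siteOf ?_
  simpa using (discTranslate_shift_pos (u := (-1, 0)) (by norm_num) l).1 h

theorem west_legSite_shift_east {l : LegIdx} (h : leaning (0, 1) l.1 < -100000000000 ^ 2) :
    west (legSite 1024 0 (shift (0, 1)) (legEquiv l)) := by
  rw [legSite_zero]
  refine west_siteOf ?_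
  simpa using (discTranslate_shift_pos (u := (0, 1)) (by norm_num) l).2 h

theorem east_legSite_shift_west {l : LegIdx} (h : leaning (0, -1) l.1 < -100000000000 ^ 2) :
    east (legSite 1024 0 (shift (0, -1)) (legEquiv l)) := by
  rw [legSite_zero]
  refine east_siteOf ?_
  simpa using (discTranslate_shift_pos (u := (0, -1)) (by norm_num) l).2 h

/-! ### Words of the code -/

/-- The indicator function of a set of sides. -/
def sideWord (s : Finset SideIdx) : Reg SideIdx := fun q => if q ∈ s then 1 else 0

/-- The boundary part of a word. -/
noncomputable def legWord (s : Finset SideIdx) : Reg (Leg 1) := (boundaryBulk (sideWord s)).1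

theorem legWord_apply (s : Finset SideIdx) (l : LegIdx) :
    legWord s (legEquiv l) = if l.1 ∈ s then 1 else 0 := boundaryBulk_fst _ _

theorem mem_of_legWord_ne_zero {s : Finset SideIdx} {l : LegIdx} (h : legWord s (legEquiv l) ≠ 0) :
    l.1 ∈ s := by
  by_contra hl
  exact h ((legWord_apply s l).trans (if_neg hl))

theorem legWord_mem {s : Finset SideIdx} {c : ZMod 2}
    (h : ∀ o, IsHamming (onTile (sideWord s) o) ∧
      ∑ j, onTile (sideWord s) o j = if o = none then c else 0) :
    (legWord s, Pi.single (tileEquiv none) c) ∈ holoWords := by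
  refine ⟨sideWord s, mem_ker_checks.2 fun o => (h o).1, Prod.ext rfl (funext fun t => ?_)⟩
  obtain ⟨o, rfl⟩ := tileEquiv.surjective t
  rw [boundaryBulk_snd, (h o).2]
  change _ = (Pi.single (tileEquiv none) c : Reg (Tile 1)) (tileEquiv o)
  rw [Pi.single_apply]
  exact if_congr tileEquiv.injective.eq_iff.symm rfl rfl

/-- A word that acts on the central bulk qubit from the west. -/
def westWord : Finset SideIdx :=
  {(0, 0), (0, 1), (0, 2), (0, 4), (4, 0), (4, 2), (4, 5), (5, 1), (5, 4), (5, 5), (6, 0), (6, 1),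
    (6, 3)}

/-- A word that acts on the central bulk qubit from the east. -/
def eastWord : Finset SideIdx :=
  {(0, 0), (0, 3), (0, 4), (0, 5), (2, 0), (2, 2), (2, 5), (3, 0), (3, 1), (3, 2), (3, 4)}

/-- A word that acts on the central bulk qubit from the north. -/
def northWord : Finset SideIdx :=
  {(1, 0), (1, 2), (1, 5), (2, 0), (2, 1), (2, 2), (2, 4), (6, 0), (6, 3), (6, 4), (6, 5)}

/-- A word that acts on the central bulk qubit from the south. -/
def southWord : Finset SideIdx :=
  {(2, 0), (2, 3), (2, 4), (2, 5), (4, 0), (4, 2), (4, 5), (5, 0), (5, 1), (5, 2), (5, 4)}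

/-- A stabilizer word, with odd overlap with `stabWord'` in the west. -/
def stabWord : Finset SideIdx :=
  {(1, 0), (1, 2), (1, 5), (2, 0), (2, 1), (2, 3), (3, 0), (3, 1), (3, 3), (4, 1), (4, 4), (4, 5),
    (5, 0), (5, 1), (5, 2), (5, 4)}

/-- A stabilizer word, with odd overlap with `stabWord` in the west. -/
def stabWord' : Finset SideIdx :=
  {(0, 0), (0, 1), (0, 3), (1, 0), (1, 1), (1, 3), (2, 0), (2, 1), (2, 3), (3, 1), (3, 4), (3, 5),
    (4, 0), (4, 1), (4, 3), (5, 1), (5, 4), (5, 5), (6, 1), (6, 4), (6, 5)}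

theorem westWord_mem : (legWord westWord, Pi.single (tileEquiv none) 1) ∈ holoWords :=
  legWord_mem (by decide +kernel)

theorem eastWord_mem : (legWord eastWord, Pi.single (tileEquiv none) 1) ∈ holoWords :=
  legWord_mem (by decide +kernel)

theorem northWord_mem : (legWord northWord, Pi.single (tileEquiv none) 1) ∈ holoWords :=
  legWord_mem (by decide +kernel)

theorem southWord_mem : (legWord southWord, Pi.single (tileEquiv none) 1) ∈ holoWords :=
  legWord_mem (by decide +kernel)

theorem stabWord_mem : (legWord stabWord, 0) ∈ holoWords := by
  rw [← Pi.single_zero (tileEquiv none)]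
  exact legWord_mem (by decide +kernel)

theorem stabWord'_mem : (legWord stabWord', 0) ∈ holoWords := by
  rw [← Pi.single_zero (tileEquiv none)]
  exact legWord_mem (by decide +kernel)

theorem leaning_westWord : ∀ q ∈ westWord, 2 ≤ q.2.val → 100000000000 ^ 2 < leaning (0, -1) q := by
  decide +kernel

theorem leaning_eastWord : ∀ q ∈ eastWord, 2 ≤ q.2.val → 100000000000 ^ 2 < leaning (0, 1) q := by
  decide +kernel

theorem leaning_northWord : ∀ q ∈ northWord, 2 ≤ q.2.val → 100000000000 ^ 2 < leaning (1, 0) q := by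
  decide +kernel

theorem leaning_southWord :
    ∀ q ∈ southWord, 2 ≤ q.2.val → 100000000000 ^ 2 < leaning (-1, 0) q := by
  decide +kernel

theorem west_of_westWord (e : Leg 1) (h : legWord westWord e ≠ 0) :
    west (legSite 1024 0 (shift (0, -1)) e) := by
  obtain ⟨l, rfl⟩ := legEquiv.surjective e
  exact west_legSite (leaning_westWord _ (mem_of_legWord_ne_zero h) l.2)

theorem east_of_eastWord (e : Leg 1) (h : legWord eastWord e ≠ 0) :
    east (legSite 1024 0 (shift (0, 1)) e) := by
  obtain ⟨l, rfl⟩ := legEquiv.surjective e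
  exact east_legSite (leaning_eastWord _ (mem_of_legWord_ne_zero h) l.2)

theorem north_of_northWord (e : Leg 1) (h : legWord northWord e ≠ 0) :
    north (legSite 1024 0 (shift (1, 0)) e) := by
  obtain ⟨l, rfl⟩ := legEquiv.surjective e
  exact north_legSite (leaning_northWord _ (mem_of_legWord_ne_zero h) l.2)

theorem south_of_southWord (e : Leg 1) (h : legWord southWord e ≠ 0) :
    south (legSite 1024 0 (shift (-1, 0)) e) := by
  obtain ⟨l, rfl⟩ := legEquiv.surjective e
  exact south_legSite (leaning_southWord _ (mem_of_legWord_ne_zero h) l.2)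

theorem mem_stabWords : ∀ q : SideIdx, 2 ≤ q.2.val → q ∈ stabWord → q ∈ stabWord' →
    q = (2, 3) ∨ q = (5, 4) := by
  decide +kernel

theorem leaning_stabWords : leaning (0, -1) (2, 3) < -100000000000 ^ 2 ∧
    100000000000 ^ 2 < leaning (0, 1) (2, 3) ∧ 100000000000 ^ 2 < leaning (0, -1) (5, 4) ∧
      leaning (0, 1) (5, 4) < -100000000000 ^ 2 := by
  decide +kernel

/-- The overlap of the two stabilizer words in a region that separates their common legs. -/
theorem sum_stabWords {P : Leg 1 → Prop} [DecidablePred P]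
    (h : ¬ P (legEquiv ⟨(2, 3), Nat.le_of_ble_eq_true rfl⟩))
    (h' : P (legEquiv ⟨(5, 4), Nat.le_of_ble_eq_true rfl⟩)) :
    (∑ e, if P e then legWord stabWord e * legWord stabWord' e else 0) = 1 := by
  rw [← legEquiv.sum_comp, Finset.sum_eq_single ⟨(5, 4), Nat.le_of_ble_eq_true rfl⟩]
  · rw [if_pos h', legWord_apply, legWord_apply, if_pos (by decide), if_pos (by decide), one_mul]
  · intro l _ hl
    split_ifs with hP
    · rw [legWord_apply, legWord_apply]
      split_ifs with h1 h2
      · rcases mem_stabWords l.1 l.2 h1 h2 with h3 | h3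
        · exact absurd hP (by
            have : l = ⟨(2, 3), Nat.le_of_ble_eq_true rfl⟩ := Subtype.ext h3
            rwa [this])
        · exact absurd (Subtype.ext h3) hl
      all_goals simp
    · rfl
  · exact fun h => absurd (Finset.mem_univ _) h

end Positions

/-! ### The theorem

The dynamics factorise exactly into unitaries on the four halves of the circle, so that no dynamics on
the auxiliary system have to be undone. -/

section Conclusion

variable {n : ℕ}

/-- The words of the copies of the code to the left and to the right. -/
noncomputable def leftRightWord (I : Finset (Fin n)) (i : Fin n) : Reg (Leg 1) :=
  legWord (if i ∈ I then westWord else eastWord)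

/-- The words of the copies of the code moved up and down. -/
noncomputable def upDownWord (J : Finset (Fin n)) (i : Fin n) : Reg (Leg 1) :=
  legWord (if i ∈ J then northWord else southWord)

theorem leftRightWord_mem (I : Finset (Fin n)) (i : Fin n) :
    (leftRightWord I i, Pi.single (tileEquiv none) 1) ∈ holoWords := by
  unfold leftRightWord
  split_ifs
  exacts [westWord_mem, eastWord_mem]

theorem upDownWord_mem (J : Finset (Fin n)) (i : Fin n) :
    (upDownWord J i, Pi.single (tileEquiv none) 1) ∈ holoWords := by
  unfold upDownWord
  split_ifs
  exacts [northWord_mem, southWord_mem]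

theorem leftRight_of_mem {I : Finset (Fin n)} {i : Fin n} (hi : i ∈ I) (e : Leg 1) :
    leftRight 1024 1 0 (4 / 25) I (i, e) = legSite 1024 0 (shift (0, -1)) e := by
  rw [← shift_west]
  exact if_pos hi

theorem leftRight_of_notMem {I : Finset (Fin n)} {i : Fin n} (hi : i ∉ I) (e : Leg 1) :
    leftRight 1024 1 0 (4 / 25) I (i, e) = legSite 1024 0 (shift (0, 1)) e := by
  rw [← shift_east]
  exact if_neg hi

theorem upDown_of_mem {J : Finset (Fin n)} {i : Fin n} (hi : i ∈ J) (e : Leg 1) :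
    upDown 1024 1 0 (4 / 25) J (i, e) = legSite 1024 0 (shift (1, 0)) e := by
  rw [← shift_north]
  exact if_pos hi

theorem upDown_of_notMem {J : Finset (Fin n)} {i : Fin n} (hi : i ∉ J) (e : Leg 1) :
    upDown 1024 1 0 (4 / 25) J (i, e) = legSite 1024 0 (shift (-1, 0)) e := by
  rw [← shift_south]
  exact if_neg hi

theorem splitsOver_leftRight (I : Finset (Fin n)) :
    SplitsOver (fun i => placeWord (leftRight 1024 1 0 (4 / 25) I) (inCopy i (leftRightWord I i)))
      I west east := by
  refine splitsOver_placeWord (fun i hi e he => ?_) fun i hi e he => ?_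
  · rw [leftRightWord, if_pos hi] at he
    rw [leftRight_of_mem hi]
    exact west_of_westWord e he
  · rw [leftRightWord, if_neg hi] at he
    rw [leftRight_of_notMem hi]
    exact east_of_eastWord e he

theorem splitsOver_upDown (J : Finset (Fin n)) :
    SplitsOver (fun i => placeWord (upDown 1024 1 0 (4 / 25) J) (inCopy i (upDownWord J i)))
      J north south := by
  refine splitsOver_placeWord (fun i hi e he => ?_) fun i hi e he => ?_
  · rw [upDownWord, if_pos hi] at he
    rw [upDown_of_mem hi]
    exact north_of_northWord e he
  · rw [upDownWord, if_neg hi] at he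
    rw [upDown_of_notMem hi]
    exact south_of_southWord e he

theorem angDist_leftRight (I : Finset (Fin n)) (t : Slot n 1) :
    angDist (leftRight 1024 1 0 (4 / 25) I t) (centred 1024 n 1 0 t) < 2 * Real.pi / 16 := by
  by_cases h : t.1 ∈ I
  · exact (leftRight_of_mem h t.2).symm ▸ angDist_legSite (norm_shift_le (by norm_num)) t.2
  · exact (leftRight_of_notMem h t.2).symm ▸ angDist_legSite (norm_shift_le (by norm_num)) t.2

theorem angDist_upDown (J : Finset (Fin n)) (t : Slot n 1) :
    angDist (centred 1024 n 1 0 t) (upDown 1024 1 0 (4 / 25) J t) < 2 * Real.pi / 16 := by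
  rw [angDist_comm]
  by_cases h : t.1 ∈ J
  · exact (upDown_of_mem h t.2).symm ▸ angDist_legSite (norm_shift_le (by norm_num)) t.2
  · exact (upDown_of_notMem h t.2).symm ▸ angDist_legSite (norm_shift_le (by norm_num)) t.2

theorem sum_stabWords_leftRight (I : Finset (Fin n)) (i : Fin n) :
    (∑ e, if west (leftRight 1024 1 0 (4 / 25) I (i, e)) then
      legWord stabWord e * legWord stabWord' e else 0) = 1 := by
  obtain ⟨h1, h2, h3, h4⟩ := leaning_stabWords
  by_cases hi : i ∈ I
  · refine sum_stabWords ?_ ?_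
    · rw [leftRight_of_mem hi, ← east_iff_not_west]
      exact east_legSite_shift_west h1
    · rw [leftRight_of_mem hi]
      exact west_legSite h3
  · refine sum_stabWords ?_ ?_
    · rw [leftRight_of_notMem hi, ← east_iff_not_west]
      exact east_legSite h2
    · rw [leftRight_of_notMem hi]
      exact west_legSite_shift_east h4

/-- A transversal gate of the code, applied in the centre, acts on the moved code. -/
theorem moveGate_mul_code {N R : ℕ} [NeZero N] {θ : ℝ} {T : Type} [Fintype T] [DecidableEq T]
    {V : Matrix (Reg (Leg R)) (Reg T) ℂ} (p q : Slot n R → ZMod N)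
    {u : Leg R → Matrix (Reg (Fin n)) (Reg (Fin n)) ℂ}
    {g : Matrix (Reg (Fin n × T)) (Reg (Fin n × T)) ℂ}
    (h : transversal u * stack n V = stack n V * g) :
    moveGate θ p q u * (place p * stack n V) = place q * stack n V * g := by
  rw [← Matrix.mul_assoc, moveGate_mul_place, Matrix.mul_assoc, h, Matrix.mul_assoc]

variable {N : ℕ} [NeZero N] {F : Type} [Fintype F] [DecidableEq F]
  {W : Matrix (Reg (ZMod N × F)) (Reg (Fin n × Tile 1)) ℂ} {p : Fin n → Reg (ZMod N × F)}
  {I : Finset (Fin n)} {P P' : ZMod N → Prop}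

/-- The central bulk qubits are recoverable on the two regions. -/
theorem IsLogical.recoverable_central (h : IsLogical W p fun i => (i, tileEquiv none))
    (hI : SplitsOver p I P P') :
    Recoverable W (fun b => b.1 ∈ I ∧ IsCentral b.2) (fun q => P q.1) ∧
      Recoverable W (fun b => b.1 ∉ I ∧ IsCentral b.2) (fun q => P' q.1) := by
  have key : ∀ s : Fin n → Prop, ∀ b : Fin n × Tile 1, s b.1 ∧ IsCentral b.2 →
      b ∈ Set.range ((fun i => (i, tileEquiv none)) ∘ (Subtype.val : {i // s i} → Fin n)) := by
    rintro s ⟨i, t⟩ ⟨hi, ht⟩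
    obtain ⟨o, rfl⟩ := tileEquiv.surjective t
    obtain rfl := (isCentral_iff o).1 ht
    exact ⟨⟨i, hi⟩, rfl⟩
  exact ⟨(h.comp (f := (Subtype.val : {i // i ∈ I} → Fin n)) Subtype.val_injective).recoverable
      (key _) fun i s => hI.mem i.1 i.2 s,
    (h.comp (f := (Subtype.val : {i // i ∉ I} → Fin n)) Subtype.val_injective).recoverable
      (key fun i => i ∉ I) fun i s => hI.notMem i.1 i.2 s⟩

end Conclusion

theorem mainTheorem6 :
    ∃ (R N : ℕ) (_ : NeZero N) (θ a c₁ c₂ : ℝ),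
      1 ≤ R ∧ 0 < a ∧ a < 1 ∧ 0 < c₁ ∧ 0 < c₂ ∧
      -- the code is an isometry
      (codeMap R).conjTranspose * codeMap R = 1 ∧
      ∀ (n : ℕ) (I J : Finset (Fin n)),
        -- the translations spread by less than a sixteenth of the circle
        HasSpread (swapLegs (leftRight N R θ a I) (centred N n R θ)) (2 * Real.pi / 16) ∧
        HasSpread (swapLegs (centred N n R θ) (upDown N R θ a J)) (2 * Real.pi / 16) ∧
        -- the central bulk qubits are recoverable on the respective halves
        Recoverable (initialCode N R θ a I) (fun b => b.1 ∈ I ∧ IsCentral b.2)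
          (fun q => west q.1) ∧
        Recoverable (initialCode N R θ a I) (fun b => b.1 ∉ I ∧ IsCentral b.2)
          (fun q => east q.1) ∧
        Recoverable (finalCode N R θ a J) (fun b => b.1 ∈ J ∧ IsCentral b.2)
          (fun q => north q.1) ∧
        Recoverable (finalCode N R θ a J) (fun b => b.1 ∉ J ∧ IsCentral b.2)
          (fun q => south q.1) ∧
        -- the entanglement is linear in `n`
        c₁ * n ≤ entanglementEntropy ((split west east).mulVec (resource N R θ a I)) ∧
        entanglementEntropy ((split west east).mulVec (resource N R θ a I)) ≤ c₂ * n ∧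
        -- encoding and decoding channels, the same for all gates
        ∃ (encA : Super (Reg {i // i ∈ I} × RegionReg (west (N := N)) (Slot n R))
              (RegionReg (west (N := N)) (Slot n R)))
          (encB : Super (Reg {i // i ∉ I} × RegionReg (east (N := N)) (Slot n R))
              (RegionReg (east (N := N)) (Slot n R)))
          (decA : Super (RegionReg (north (N := N)) (Slot n R)) (Reg {i // i ∈ J}))
          (decB : Super (RegionReg (south (N := N)) (Slot n R)) (Reg {i // i ∉ J})),
          IsChannel encA ∧ IsChannel encB ∧ IsChannel decA ∧ IsChannel decB ∧
        ∀ G : Matrix (Reg (Fin n)) (Reg (Fin n)) ℂ, IsClifford G →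
          -- a transversal gate of the code that is `G` on the central bulk qubits
          ∃ (u : Leg R → Matrix (Reg (Fin n)) (Reg (Fin n)) ℂ)
            (g : Tile R → Matrix (Reg (Fin n)) (Reg (Fin n)) ℂ),
            (∀ e, IsClifford (u e)) ∧ (∀ t, IsClifford (g t)) ∧ (∀ t, IsCentral t → g t = G) ∧
            transversal u * stack n (codeMap R) = stack n (codeMap R) * transversal g ∧
            -- the dynamics implement it in the bulk, with spread below an eighth of the circle
            dynamics N θ a I J u ∈ Matrix.unitaryGroup (Reg (ZMod N × Slot n R)) ℂ ∧
            HasSpread (dynamics N θ a I J u) (2 * Real.pi / 8) ∧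
            dynamics N θ a I J u * initialCode N R θ a I = finalCode N R θ a J * transversal g ∧
            -- the pseudo-bulk dynamics are `G`
            (∀ ρ, pseudoBulk (dynamics N θ a I J u) (resource N R θ a I) encA encB decA decB ρ =
                conjBy (bipartite I J G) ρ) ∧
              -- the dynamics decompose, and the many-body protocol implements `G` non-locally
              ∃ (UW : Matrix (RegionReg (west (N := N)) (Slot n R × Bool))
                    (RegionReg (west (N := N)) (Slot n R × Bool)) ℂ)
                (UE : Matrix (RegionReg (east (N := N)) (Slot n R × Bool))
                    (RegionReg (east (N := N)) (Slot n R × Bool)) ℂ)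
                (UN : Matrix (RegionReg (north (N := N)) (Slot n R × Bool))
                    (RegionReg (north (N := N)) (Slot n R × Bool)) ℂ)
                (US : Matrix (RegionReg (south (N := N)) (Slot n R × Bool))
                    (RegionReg (south (N := N)) (Slot n R × Bool)) ℂ)
                (U' : Matrix (Reg (ZMod N × Slot n R)) (Reg (ZMod N × Slot n R)) ℂ),
                UW ∈ Matrix.unitaryGroup _ ℂ ∧ UE ∈ Matrix.unitaryGroup _ ℂ ∧
                UN ∈ Matrix.unitaryGroup _ ℂ ∧ US ∈ Matrix.unitaryGroup _ ℂ ∧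
                U' ∈ Matrix.unitaryGroup _ ℂ ∧
                regionOp north UN * regionOp south US * regionOp west UW * regionOp east UE =
                  onBoth (dynamics N θ a I J u) U' ∧
                NLQCImplements ((split west east).mulVec (resource N R θ a I))
                  (firstRound west north south encA UW) (firstRound east south north encB UE)
                  (secondRound north west east UN decA) (secondRound south east west US decB)
                  (bipartite I J G) := by
  obtain ⟨κ, hL⟩ := exists_isSelfDualCode
  have : Nonempty (Leg 1) := ⟨legEquiv ⟨(0, 2), le_refl _⟩⟩
  have hcard : (0 : ℝ) < Fintype.card (Leg 1) := Nat.cast_pos.2 Fintype.card_pos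
  have hlog : 0 < Real.log 2 := Real.log_pos one_lt_two
  refine ⟨1, 1024, inferInstance, 0, 4 / 25, Real.log 2,
    2 * (1024 : ℕ) * Fintype.card (Leg 1) * Real.log 2, le_refl _, by norm_num, by norm_num, hlog,
    by positivity, hL.isometry, fun n I J => ?_⟩
  have h₀ : IsLogical (initialCode 1024 1 0 (4 / 25) I) _ _ := hL.isLogical (leftRightWord_mem I)
  have h₁ : IsLogical (finalCode 1024 1 0 (4 / 25) J) _ _ := hL.isLogical (upDownWord_mem J)
  have hI := splitsOver_leftRight I
  have hJ := splitsOver_upDown J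
  have hiso₀ : (initialCode 1024 1 0 (4 / 25) I).conjTranspose * initialCode 1024 1 0 (4 / 25) I = 1 :=
    place_mul_stack_isometry hL.isometry
  have hiso₁ : (finalCode 1024 1 0 (4 / 25) J).conjTranspose * finalCode 1024 1 0 (4 / 25) J = 1 :=
    place_mul_stack_isometry hL.isometry
  have hE := hL.entropy_bounds (p := leftRight 1024 1 0 (4 / 25) I) east_iff_not_west
    stabWord_mem stabWord'_mem (sum_stabWords_leftRight I)
  have hs : 0 < 2 * Real.pi / 16 := by positivity
  refine ⟨hasSpread_swapLegs hs (angDist_leftRight I), hasSpread_swapLegs hs (angDist_upDown J),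
    (h₀.recoverable_central hI).1, (h₀.recoverable_central hI).2,
    (h₁.recoverable_central hJ).1, (h₁.recoverable_central hJ).2, hE.1, hE.2,
    _, _, _, _,
    isChannel_krausMap (sum_encOp (h₀.orth.regFam (f := (Subtype.val : {i // i ∈ I} → Fin n))
      Subtype.val_injective fun i => hI.mem i.1 i.2)),
    isChannel_krausMap (sum_encOp (h₀.orth.regFam (f := (Subtype.val : {i // i ∉ I} → Fin n))
      Subtype.val_injective fun i => hI.notMem i.1 i.2)),
    isChannel_krausMap (sum_decOp (h₁.orth.regFam (f := (Subtype.val : {i // i ∈ J} → Fin n))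
      Subtype.val_injective fun i => hJ.mem i.1 i.2)),
    isChannel_krausMap (sum_decOp (h₁.orth.regFam (f := (Subtype.val : {i // i ∉ J} → Fin n))
      Subtype.val_injective fun i => hJ.notMem i.1 i.2)), fun G hG => ?_⟩
  obtain ⟨u, hu, huV⟩ := hL.exists_transversal hG
  have huU := fun e => (hu e).1
  have hU := moveGate_mul_code (θ := 0) (leftRight 1024 1 0 (4 / 25) I)
    (upDown 1024 1 0 (4 / 25) J) huV
  obtain ⟨A, B, C, D, ⟨hA, hA'⟩, ⟨hB, hB'⟩, ⟨hC, hC'⟩, ⟨hD, hD'⟩, hABCD⟩ :=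
    exists_localized_factors huU (angDist_leftRight I) (angDist_upDown J) conePart_cover
  obtain ⟨UN, hUN, hN⟩ := exists_regionOp_main hA hA'
  obtain ⟨US, hUS, hS⟩ := exists_regionOp_main hB hB'
  obtain ⟨UW, hUW, hW⟩ := exists_regionOp_main hC hC'
  obtain ⟨UE, hUE, hEast⟩ := exists_regionOp_main hD hD'
  have hloc : regionOp north UN * regionOp south US * regionOp west UW * regionOp east UE =
      onBoth (dynamics 1024 0 (4 / 25) I J u) 1 := by
    rw [hN, hS, hW, hEast, ← emb_mul mainQubit_injective, ← emb_mul mainQubit_injective,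
      ← emb_mul mainQubit_injective, ← hABCD, emb_mainQubit]
    rfl
  refine ⟨u, fun _ => G, hu, fun _ => hG, fun _ _ => rfl, huV, moveGate_mem_unitary _ _ huU, ?_, hU,
    fun ρ => pseudoBulk_eq h₀ hI east_iff_not_west h₁ hJ south_iff_not_north hU hiso₁ hG.1 ρ,
    UW, UE, UN, US, 1, hUW, hUE, hUN, hUS, one_mem _, hloc,
    nlqcImplements h₀ hI east_iff_not_west h₁ hJ south_iff_not_north hU hiso₀ hiso₁ hG.1 hUW hUE hUN
      hUS hloc⟩
  rw [show 2 * Real.pi / 8 = 2 * Real.pi / 16 + 2 * Real.pi / 16 by ring]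
  exact hasSpread_moveGate huU hs (angDist_leftRight I) (angDist_upDown J)
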